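/- Let $d\ge 1$, $\tau>0$, and let $(X_{\mathbf u})_{\mathbf u\in\mathbb Z^d}$ be a stationary family of real random variables with mean zero and finite variance which satisfies the FKG inequalities (for every finite subfamily, $\mathrm{Cov}(F,G)\ge 0$ for all coordinatewise increasing functions $F,G$ of it with finite second moments) and has finite susceptibility, $v=\sum_{\mathbf u}\mathrm{Cov}(X_{\mathbf 0},X_{\mathbf u})<\infty$. Let $(Z_{\mathbf u})$ be $N(0,\tau)$ random variables, independent of each other and of the family $(X_{\mathbf u})$. For a random variable $U$ with variance $\sigma^2$ and smooth density $f$ let $\rho_U=f'/f$, $J(U)=\mathbb E\rho_U(U)^2$ and $J_{\rm st}(U)=\sigma^2J(U)-1$. For $\mathbf x\in\{1,2,\dots\}^d$ let $|\mathbf x|=\prod_i x_i$, $B_{\mathbf x}=\{\mathbf y\in\mathbb Z^d:1\le y_i\le x_i\text{ for all }i\}$ and $V_{\mathbf x}=|\mathbf x|^{-1/2}\sum_{\mathbf u\in B_{\mathbf x}}(X_{\mathbf u}+Z_{\mathbf u})$, and for $n\ge1$ let $J(n)=\sup\{J_{\rm st}(V_{\mathbf x}):|\mathbf x|=n\}$.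 For a function $\psi$ on $[0,\infty)$ let $\mathcal C_\psi$ be the class of random variables $U$ with finite variance $\sigma^2$ such that $\mathbb E\,U^2\mathbf 1(|U|\ge R\sigma)\le\sigma^2\psi(R)$ for all $R\ge 0$. Assume uniform integrability: there is $\psi$ with $\psi(R)\to0$ as $R\to\infty$ such that $V_{\mathbf x}\in\mathcal C_\psi$ for all $\mathbf x\in\{1,2,\dots\}^d$. Fix such a $\psi$ and a number $K\ge v$. For random variables $S,T$ with mean zero and variances at most $K$ (with any joint law) let $X=S+Z_S$, $Y=T+Z_T$, where $Z_S,Z_T$ are $N(0,\tau)$, independent of $(S,T)$ and of each other, and for $\beta\in[0,1]$ put $$\Delta(X,Y,\beta)=\mathbb E\left(\sqrt\beta\,\rho_X(X)+\sqrt{1-\beta}\,\rho_Y(Y)-\tilde\rho\left(\sqrt\beta X+\sqrt{1-\beta}\,Y\right)\right)^2,$$ where $\tilde\rho$ is the score function of $\sqrt\beta X+\sqrt{1-\beta}\,Y$. Call $\nu:[0,\infty)\to\mathbb R$ admissible if $\nu(\epsilon)\to\nu(0)=0$ as $\epsilon\to0$ and $\beta(1-\beta)J_{\rm st}(X)\le\nu(\Delta(X,Y,\beta))$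 for all such $X,Y\in\mathcal C_\psi$ and all $\beta\in[0,1]$; write $\nu^{-1}(y)=\inf\{\epsilon\ge0:\nu(\epsilon)\ge y\}$. Then admissible functions exist, and for every admissible $\nu$ there is a sequence $d(m)$ with $d(m)\to0$ as $m\to\infty$ such that for all integers $m\ge n\ge1$ $$J(n+m)\le\frac{m}{m+n}J(m)+\frac{n}{m+n}J(n)+d(m)-\nu^{-1}\left(\frac{J(m)\,mn}{(m+n)^2}\right).$$ -/

import Mathlib

open MeasureTheory ProbabilityTheory Filter Topology
open scoped NNReal ENNReal

noncomputable section

namespace FKG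

/-! ### Fisher information of a law on the real line

All quantities attached to a real random variable `U` depend on its law only, so they are defined
for a probability measure `μ` on `ℝ` and used with `μ = P.map U`. They are only used for laws of
the form (law with finite variance) ∗ `N(0, τ)` with `τ > 0`. Such a law has a smooth positive
density, and all expectations below are then finite. -/

/-- The density of a law on `ℝ`, as the derivative of its distribution function. If the law has a
continuous density, this is that density at every point. -/
def density (μ : Measure ℝ) : ℝ → ℝ := deriv fun x => cdf μ x

/-- The score function `ρ = f' / f`, where `f` is the density. -/
def score (μ : Measure ℝ) (x : ℝ) : ℝ := deriv (density μ) x / density μ x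

/-- The Fisher information `J(U) = E ρ(U)²`. -/
def fisherInfo (μ : Measure ℝ) : ℝ := ∫ x, score μ x ^ 2 ∂μ

/-- The standardised Fisher information `J_st(U) = σ² J(U) - 1`, where `σ² = Var U`. -/
def stFisherInfo (μ : Measure ℝ) : ℝ := variance id μ * fisherInfo μ - 1

/-- The class `C_ψ` of laws with finite variance `σ²` such that
`E X² 1(|X| ≥ R σ) ≤ σ² ψ(R)` for all `R ≥ 0`. -/
def MemClass (ψ : ℝ → ℝ) (μ : Measure ℝ) : Prop :=
  MemLp id 2 μ ∧
    ∀ R : ℝ, 0 ≤ R →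
      ∫ x in {x : ℝ | R * √(variance id μ) ≤ |x|}, x ^ 2 ∂μ ≤ variance id μ * ψ R

/-! ### The function `ν` -/

/-- `Δ(X, Y, β) = E (√β ρ_X(X) + √(1-β) ρ_Y(Y) - ρ̃(√β X + √(1-β) Y))²`, as a function of the joint
law `κ` of `(X, Y)`; here `ρ̃` is the score function of `√β X + √(1-β) Y`. -/
def scoreGap (κ : Measure (ℝ × ℝ)) (β : ℝ) : ℝ :=
  ∫ p, (√β * score (κ.map Prod.fst) p.1 + √(1 - β) * score (κ.map Prod.snd) p.2
    - score (κ.map fun q => √β * q.1 + √(1 - β) * q.2) (√β * p.1 + √(1 - β) * p.2)) ^ 2 ∂κ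

/-- The joint law of `(S + Z_S, T + Z_T)`, where `(S, T)` has joint law `μ` and `Z_S`, `Z_T` are
`N(0, τ)`, independent of `(S, T)` and of each other. -/
def perturb (τ : ℝ≥0) (μ : Measure (ℝ × ℝ)) : Measure (ℝ × ℝ) :=
  (μ.prod ((gaussianReal 0 τ).prod (gaussianReal 0 τ))).map fun p => p.1 + p.2

/-- `ν` tends to `0` at `0` (on `[0, ∞)`), and `β (1 - β) J_st(X) ≤ ν (Δ(X, Y, β))` for all
`β ∈ [0, 1]` and all `X = S + Z_S`, `Y = T + Z_T` in the class `C_ψ`, where `S`, `T` are mean zero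
random variables with variance at most `K`, with any joint law `μ`. -/
structure IsModulus (ψ : ℝ → ℝ) (τ : ℝ≥0) (K : ℝ) (ν : ℝ → ℝ) : Prop where
  tendsto_zero : Tendsto ν (𝓝[≥] 0) (𝓝 0)
  le_apply : ∀ μ : Measure (ℝ × ℝ), IsProbabilityMeasure μ →
    MemLp Prod.fst 2 μ → MemLp Prod.snd 2 μ →
    ∫ p, p.1 ∂μ = 0 → ∫ p, p.2 ∂μ = 0 →
    variance Prod.fst μ ≤ K → variance Prod.snd μ ≤ K →
    MemClass ψ ((perturb τ μ).map Prod.fst) → MemClass ψ ((perturb τ μ).map Prod.snd) →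
    ∀ β ∈ Set.Icc (0 : ℝ) 1,
      β * (1 - β) * stFisherInfo ((perturb τ μ).map Prod.fst) ≤ ν (scoreGap (perturb τ μ) β)

/-- The generalized inverse `ν⁻¹(y) = inf {ε ≥ 0 : y ≤ ν(ε)}`. -/
def genInv (ν : ℝ → ℝ) (y : ℝ) : ℝ := sInf {ε : ℝ | 0 ≤ ε ∧ y ≤ ν ε}

/-! ### Random fields on the lattice -/

variable {Ω : Type*} [MeasurableSpace Ω] {d : ℕ}

/-- The law of the field is invariant under all translations of the lattice. -/
def IsStationary (X : (Fin d → ℤ) → Ω → ℝ) (P : Measure Ω) : Prop :=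
  ∀ a : Fin d → ℤ, IdentDistrib (fun ω u => X (u + a) ω) (fun ω u => X u ω) P P

/-- The FKG inequalities: for every finite subfamily and all coordinatewise increasing `F`, `G`
(with finite second moments, so that the covariance exists), `Cov(F(X), G(X)) ≥ 0`. -/
def IsFKG (X : (Fin d → ℤ) → Ω → ℝ) (P : Measure Ω) : Prop :=
  ∀ (s : Finset (Fin d → ℤ)) (F G : (s → ℝ) → ℝ),
    Measurable F → Measurable G → Monotone F → Monotone G →
    MemLp (fun ω => F fun u => X u ω) 2 P → MemLp (fun ω => G fun u => X u ω) 2 P →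
    0 ≤ covariance (fun ω => F fun u => X u ω) (fun ω => G fun u => X u ω) P

/-- The box of lattice points with `1 ≤ y_i ≤ x_i` for all `i`. -/
def box (x : Fin d → ℕ) : Finset (Fin d → ℤ) :=
  Fintype.piFinset fun i => Finset.Icc 1 (x i : ℤ)

/-- The volume `|x| = ∏ x_i` of the box. -/
def vol (x : Fin d → ℕ) : ℕ := ∏ i, x i

/-- The perturbed normalized sum `V_x = (∑_{u ∈ B_x} (X_u + Z_u)) / √|x|`. -/
def boxSum (X Z : (Fin d → ℤ) → Ω → ℝ) (x : Fin d → ℕ) (ω : Ω) : ℝ :=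
  (∑ u ∈ box x, (X u ω + Z u ω)) / √(vol x : ℝ)

/-- `J(n) = sup {J_st(V_x) : |x| = n}`. For `n ≥ 1` and `d ≥ 1` this is the supremum of a nonempty
finite set. -/
def supFisher (X Z : (Fin d → ℤ) → Ω → ℝ) (P : Measure Ω) (n : ℕ) : ℝ :=
  sSup {j : ℝ | ∃ x : Fin d → ℕ, vol x = n ∧ j = stFisherInfo (P.map (boxSum X Z x))}

end FKG

end

/-!
The sequence `J` tends to zero, so that the increments in the asserted inequality are negligible
and the quantity to be controlled is `ν⁻¹`.

* An FKG field nearly factorises over disjoint slabs: by Newman's inequality the characteristic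
  function of the sum over two adjacent boxes differs from the product of the two characteristic
  functions by at most a multiple of the covariance of the two sums, which finite susceptibility
  makes small compared with the volume once boxes grow by slabs of a fixed, large width. Starting
  from short boxes, where uniform integrability gives a Taylor expansion, this shows that the
  characteristic functions of `|x|^{-1/2} ∑_{u ∈ B_x} X_u` become normal as `|x| → ∞`. After
  perturbation by `N(0, τ)` the Fisher information is weakly continuous, and `J(m) → 0`.
* The least increasing admissible function tends to zero at zero by compactness: a weak limit of
  test laws whose score gaps tend to zero has score gap zero, and this makes the score of its first
  marginal affine (hence `J_st = 0`) unless `β (1 - β) = 0`.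
* Two independent copies of a test law `S + Z_S` have a score gap of at most `J_st / τ`, whence
  `ν⁻¹(β (1 - β) J_st) ≤ J_st / τ` for every admissible `ν`. With `β = m / (m + n)` at a maximising
  box this bounds the last term by `J(m) / τ`.
-/

open scoped BoundedContinuousFunction ZeroAtInfty

noncomputable section

namespace FKG

/-! ### Smoothing a law by a kernel -/

section Smooth

variable {E : Type*} [NormedAddCommGroup E] [MeasurableSpace E] [BorelSpace E]

/-- The convolution of a kernel with a law. -/
def smooth (k : E →ᵇ ℝ) (μ : Measure E) (x : E) : ℝ := ∫ s, k (x - s) ∂μ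

theorem integrable_translate (k : E →ᵇ ℝ) (μ : Measure E) [IsFiniteMeasure μ] (x : E) :
    Integrable (fun s => k (x - s)) μ :=
  (k.compContinuous ⟨(x - ·), by fun_prop⟩).integrable μ

theorem tendsto_smooth_apply (k : E →ᵇ ℝ) {ι : Type*} {l : Filter ι}
    {μs : ι → ProbabilityMeasure E} {μ : ProbabilityMeasure E} (hμ : Tendsto μs l (𝓝 μ)) (x : E) :
    Tendsto (fun i => smooth k (μs i) x) l (𝓝 (smooth k μ x)) :=
  ProbabilityMeasure.tendsto_iff_forall_integral_tendsto.1 hμ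
    (k.compContinuous ⟨(x - ·), by fun_prop⟩)

theorem dist_smooth_le {k : E →ᵇ ℝ} {μ : Measure E} [IsProbabilityMeasure μ] {x y : E} {ε : ℝ}
    (h : ∀ s, dist (k (x - s)) (k (y - s)) ≤ ε) : dist (smooth k μ x) (smooth k μ y) ≤ ε := by
  rw [dist_eq_norm, smooth, smooth,
    ← integral_sub (integrable_translate k μ x) (integrable_translate k μ y)]
  simpa using norm_integral_le_of_norm_le_const (μ := μ)
    (f := fun s => k (x - s) - k (y - s)) (.of_forall h)

theorem tendsto_smooth {k : E →ᵇ ℝ} (hk : UniformContinuous k) {ι : Type*} {l : Filter ι}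
    {μs : ι → ProbabilityMeasure E} {μ : ProbabilityMeasure E} (hμ : Tendsto μs l (𝓝 μ))
    {xs : ι → E} {x : E} (hx : Tendsto xs l (𝓝 x)) :
    Tendsto (fun i => smooth k (μs i) (xs i)) l (𝓝 (smooth k μ x)) := by
  refine tendsto_of_tendsto_of_dist (tendsto_smooth_apply k hμ x) ?_
  refine Metric.tendsto_nhds.2 fun ε hε => ?_
  obtain ⟨η, hη, h⟩ := Metric.uniformContinuous_iff.1 hk (ε / 2) (half_pos hε)
  filter_upwards [Metric.tendsto_nhds.1 hx η hη] with i hi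
  rw [dist_zero_right, Real.norm_of_nonneg dist_nonneg]
  refine (dist_smooth_le (ε := ε / 2) fun s => (h ?_).le).trans_lt (half_lt_self hε)
  rwa [dist_sub_right, dist_comm]

theorem continuous_smooth {k : E →ᵇ ℝ} (hk : UniformContinuous k) (μ : Measure E)
    [IsProbabilityMeasure μ] : Continuous (smooth k μ) :=
  continuous_iff_continuousAt.2 fun _ =>
    tendsto_smooth (μs := fun _ => ⟨μ, inferInstance⟩) (μ := ⟨μ, inferInstance⟩) hk
      tendsto_const_nhds tendsto_id

theorem smooth_pos {k : E →ᵇ ℝ} (hk : ∀ x, 0 < k x) (μ : Measure E) [IsProbabilityMeasure μ]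
    (x : E) : 0 < smooth k μ x := by
  rw [smooth, integral_pos_iff_support_of_nonneg (fun s => (hk _).le) (integrable_translate k μ x)]
  simp [Function.support, (hk _).ne']

variable [SecondCountableTopology E]

theorem measurable_smooth (k : E →ᵇ ℝ) (μ : Measure E) [SFinite μ] : Measurable (smooth k μ) :=
  (StronglyMeasurable.integral_prod_right' (f := fun p : E × E => k (p.1 - p.2))
    (by fun_prop : Continuous _).stronglyMeasurable).measurable

variable {m : Measure E} [SFinite m] [m.IsAddLeftInvariant]

theorem measurePreserving_shear (μ : Measure E) [SFinite μ] :
    MeasurePreserving (MeasurableEquiv.shearAddRight E) (μ.prod m) (μ.prod m) :=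
  measurePreserving_prod_add μ m

theorem conv_withDensity_ofReal {k : E →ᵇ ℝ} (hk : ∀ x, 0 ≤ k x) (μ : Measure E)
    [IsFiniteMeasure μ] [SFinite (m.withDensity fun x => ENNReal.ofReal (k x))] :
    μ ∗ m.withDensity (fun x => ENNReal.ofReal (k x))
      = m.withDensity fun x => ENNReal.ofReal (smooth k μ x) := by
  have hsm := measurable_smooth k μ
  refine Measure.ext_of_lintegral _ fun f hf => ?_
  calc ∫⁻ x, f x ∂(μ ∗ m.withDensity fun x => ENNReal.ofReal (k x))
      = ∫⁻ p, ENNReal.ofReal (k p.2) * f (p.1 + p.2) ∂μ.prod m := by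
        rw [Measure.conv, lintegral_map hf (by fun_prop), prod_withDensity_right (by fun_prop),
          lintegral_withDensity_eq_lintegral_mul _ (by fun_prop) (by fun_prop)]
        rfl
    _ = ∫⁻ p, ENNReal.ofReal (k (p.2 - p.1)) * f p.2 ∂μ.prod m := by
        simpa [MeasurableEquiv.shearAddRight] using (measurePreserving_shear μ).lintegral_comp
          (f := fun p : E × E => ENNReal.ofReal (k (p.2 - p.1)) * f p.2) (by fun_prop)
    _ = ∫⁻ x, (∫⁻ s, ENNReal.ofReal (k (x - s)) ∂μ) * f x ∂m := by
        rw [lintegral_prod_symm' _ (by fun_prop)]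
        exact lintegral_congr fun x =>
          lintegral_mul_const (f x) (by fun_prop : Measurable fun s => ENNReal.ofReal (k (x - s)))
    _ = ∫⁻ x, f x ∂m.withDensity fun x => ENNReal.ofReal (smooth k μ x) := by
        rw [lintegral_withDensity_eq_lintegral_mul _ (by fun_prop) hf]
        refine lintegral_congr fun x => ?_
        rw [Pi.mul_apply, smooth, ofReal_integral_eq_lintegral_ofReal
          (integrable_translate k μ x) (.of_forall fun s => hk _)]

section Shear

variable {k : E →ᵇ ℝ} {μ : Measure E} [SFinite μ] {h : E → ℝ}

theorem integrable_prod_shear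
    (hh : Integrable (fun p : E × E => h (p.1 + p.2) * k p.2) (μ.prod m)) :
    Integrable (fun p : E × E => h p.2 * k (p.2 - p.1)) (μ.prod m) := by
  rw [← (measurePreserving_shear μ).integrable_comp_emb (MeasurableEquiv.measurableEmbedding _)]
  simpa [Function.comp_def, MeasurableEquiv.shearAddRight] using hh

theorem integrable_mul_smooth
    (hh : Integrable (fun p : E × E => h (p.1 + p.2) * k p.2) (μ.prod m)) :
    Integrable (fun x => h x * smooth k μ x) m := by
  simpa only [smooth, integral_const_mul] using (integrable_prod_shear hh).integral_prod_right

theorem integral_mul_smooth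
    (hh : Integrable (fun p : E × E => h (p.1 + p.2) * k p.2) (μ.prod m)) :
    ∫ x, h x * smooth k μ x ∂m = ∫ p : E × E, h (p.1 + p.2) * k p.2 ∂μ.prod m := by
  calc ∫ x, h x * smooth k μ x ∂m = ∫ p : E × E, h p.2 * k (p.2 - p.1) ∂μ.prod m := by
        rw [integral_prod_symm _ (integrable_prod_shear hh)]
        simp only [smooth, integral_const_mul]
    _ = ∫ p : E × E, h (p.1 + p.2) * k p.2 ∂μ.prod m := by
        rw [← (measurePreserving_shear μ).integral_comp (MeasurableEquiv.measurableEmbedding _)]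
        simp [MeasurableEquiv.shearAddRight]

end Shear

end Smooth

/-! ### Gaussian kernels -/

theorem continuous_gaussianPDFReal (τ : ℝ≥0) : Continuous (gaussianPDFReal 0 τ) := by
  unfold gaussianPDFReal
  fun_prop

theorem tendsto_pow_mul_gaussianPDFReal_cocompact (τ : ℝ≥0) (n : ℕ) :
    Tendsto (fun z => z ^ n * gaussianPDFReal 0 τ z) (cocompact ℝ) (𝓝 0) := by
  rcases eq_or_ne τ 0 with rfl | hτ
  · simp
  have hτ' : 0 < (2 * τ : ℝ)⁻¹ := by positivity
  have h := (tendsto_rpow_abs_mul_exp_neg_mul_sq_cocompact hτ' n).const_mul (√(2 * Real.pi * τ))⁻¹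
  rw [mul_zero] at h
  refine squeeze_zero_norm (fun z => le_of_eq ?_) h
  rw [norm_mul, norm_pow, Real.norm_of_nonneg (gaussianPDFReal_nonneg 0 τ z), gaussianPDFReal,
    Real.rpow_natCast, Real.norm_eq_abs, sub_zero, neg_div, div_eq_inv_mul (z ^ 2)]
  ring_nf

/-- The kernel `z ↦ zⁿ g(z)`, where `g` is the density of `N(0, τ)`. It is identically zero if
`τ = 0`. -/
def momentKernel (τ : ℝ≥0) (n : ℕ) : ℝ →ᵇ ℝ :=
  ZeroAtInftyContinuousMap.toBCF
    ⟨⟨fun z => z ^ n * gaussianPDFReal 0 τ z,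
      (continuous_pow n).mul (continuous_gaussianPDFReal τ)⟩,
      tendsto_pow_mul_gaussianPDFReal_cocompact τ n⟩

theorem momentKernel_apply (τ : ℝ≥0) (n : ℕ) (z : ℝ) :
    momentKernel τ n z = z ^ n * gaussianPDFReal 0 τ z := rfl

theorem momentKernel_zero_apply (τ : ℝ≥0) (z : ℝ) :
    momentKernel τ 0 z = gaussianPDFReal 0 τ z := by
  rw [momentKernel_apply, pow_zero, one_mul]

theorem uniformContinuous_momentKernel (τ : ℝ≥0) (n : ℕ) : UniformContinuous (momentKernel τ n) :=
  (map_continuous _).uniformContinuous_of_tendsto_cocompact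
    (tendsto_pow_mul_gaussianPDFReal_cocompact τ n)

theorem hasDerivAt_gaussianPDFReal (τ : ℝ≥0) (z : ℝ) :
    HasDerivAt (gaussianPDFReal 0 τ) (-(z * gaussianPDFReal 0 τ z) / τ) z := by
  have h : HasDerivAt (fun z : ℝ => -(z - 0) ^ 2 / (2 * τ)) (-(z / τ)) z := by
    refine (((((hasDerivAt_id z).sub_const 0).fun_pow 2).fun_neg).div_const _).congr_deriv ?_
    simp [neg_div, mul_div_mul_left]
  refine (h.exp.const_mul (√(2 * Real.pi * τ))⁻¹).congr_deriv ?_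
  rw [gaussianPDFReal]
  ring

theorem memLp_two_gaussianReal (τ : ℝ≥0) : MemLp id 2 (gaussianReal 0 τ) :=
  memLp_id_gaussianReal' 2 (by simp)

theorem integral_sq_gaussianReal (τ : ℝ≥0) : ∫ z, z ^ 2 ∂gaussianReal 0 τ = τ := by
  have h := variance_of_integral_eq_zero (X := id) (μ := gaussianReal 0 τ) (by fun_prop)
    integral_id_gaussianReal
  rw [variance_id_gaussianReal] at h
  exact h.symm

variable {τ : ℝ≥0}

theorem gaussianReal_eq_withDensity_momentKernel (hτ : 0 < τ) :
    gaussianReal 0 τ = volume.withDensity fun z => ENNReal.ofReal (momentKernel τ 0 z) := by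
  simp_rw [gaussianReal_of_var_ne_zero 0 hτ.ne', momentKernel_zero_apply]
  rfl

theorem momentKernel_zero_pos (hτ : 0 < τ) (z : ℝ) : 0 < momentKernel τ 0 z := by
  rw [momentKernel_zero_apply]
  exact gaussianPDFReal_pos 0 τ z hτ.ne'

/-! ### The density of a law perturbed by a Gaussian -/

/-- The moments of the noise given the perturbed variable: if `S` has law `μ` and `Z` is `N(0, τ)`,
independent of `S`, this is the density of `S + Z` at `x` times `E[Zⁿ | S + Z = x]`. -/
def noiseMoment (τ : ℝ≥0) (n : ℕ) (μ : Measure ℝ) : ℝ → ℝ := smooth (momentKernel τ n) μ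

theorem prod_gaussianReal_eq_withDensity (μ : Measure ℝ) (hτ : 0 < τ) :
    μ.prod (gaussianReal 0 τ)
      = (μ.prod volume).withDensity fun p => ENNReal.ofReal (momentKernel τ 0 p.2) := by
  rw [gaussianReal_eq_withDensity_momentKernel hτ, prod_withDensity_right (by fun_prop)]

theorem integrable_mul_pow_prod_gaussianReal (μ : Measure ℝ) (hτ : 0 < τ) {n : ℕ} {h : ℝ → ℝ}
    (hh : Integrable (fun p : ℝ × ℝ => h (p.1 + p.2) * p.2 ^ n) (μ.prod (gaussianReal 0 τ))) :
    Integrable (fun p : ℝ × ℝ => h (p.1 + p.2) * momentKernel τ n p.2) (μ.prod volume) := by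
  rw [prod_gaussianReal_eq_withDensity μ hτ, integrable_withDensity_iff (by fun_prop)
    (.of_forall fun _ => by simp)] at hh
  refine hh.congr (.of_forall fun p => ?_)
  beta_reduce
  rw [ENNReal.toReal_ofReal (momentKernel_zero_pos hτ _).le, momentKernel_zero_apply,
    momentKernel_apply, mul_assoc]

section NoiseMoment

variable (μ : Measure ℝ) [IsProbabilityMeasure μ]

theorem noiseMoment_zero_pos (hτ : 0 < τ) (x : ℝ) : 0 < noiseMoment τ 0 μ x :=
  smooth_pos (momentKernel_zero_pos hτ) μ x

theorem continuous_noiseMoment (τ : ℝ≥0) (n : ℕ) : Continuous (noiseMoment τ n μ) :=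
  continuous_smooth (uniformContinuous_momentKernel τ n) μ

theorem hasDerivAt_noiseMoment_zero (τ : ℝ≥0) (x : ℝ) :
    HasDerivAt (noiseMoment τ 0 μ) (-noiseMoment τ 1 μ x / τ) x := by
  have hderiv : ∀ z, HasDerivAt (momentKernel τ 0) (-momentKernel τ 1 z / τ) z := fun z => by
    rw [funext (momentKernel_zero_apply τ), momentKernel_apply, pow_one]
    exact hasDerivAt_gaussianPDFReal τ z
  have h := (hasDerivAt_integral_of_dominated_loc_of_deriv_le (μ := μ) (x₀ := x)
    (F := fun x s => momentKernel τ 0 (x - s)) (F' := fun x s => -momentKernel τ 1 (x - s) / τ)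
    (bound := fun _ => ‖momentKernel τ 1‖ / τ) univ_mem
    (.of_forall fun y => (integrable_translate _ μ y).aestronglyMeasurable)
    (integrable_translate _ μ x)
    ((integrable_translate _ μ x).neg.div_const (τ : ℝ)).aestronglyMeasurable
    (.of_forall fun s y _ => ?_) (integrable_const _)
    (.of_forall fun s y _ => (hderiv (y - s)).comp_sub_const y s)).2
  · rwa [integral_div, integral_neg] at h
  · rw [norm_div, norm_neg, Real.norm_of_nonneg τ.coe_nonneg]
    gcongr
    exact (momentKernel τ 1).norm_coe_le_norm _

theorem conv_gaussianReal_eq_withDensity (hτ : 0 < τ) :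
    μ ∗ gaussianReal 0 τ = volume.withDensity fun x => ENNReal.ofReal (noiseMoment τ 0 μ x) := by
  have hγ := gaussianReal_eq_withDensity_momentKernel hτ
  have : SFinite ((volume : Measure ℝ).withDensity
      fun z => ENNReal.ofReal (momentKernel τ 0 z)) := hγ ▸ inferInstance
  rw [hγ, conv_withDensity_ofReal (fun z => (momentKernel_zero_pos hτ z).le)]
  rfl

theorem integral_conv_gaussianReal (hτ : 0 < τ) (f : ℝ → ℝ) :
    ∫ x, f x ∂(μ ∗ gaussianReal 0 τ) = ∫ x, f x * noiseMoment τ 0 μ x := by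
  rw [conv_gaussianReal_eq_withDensity μ hτ, integral_withDensity_eq_integral_toReal_smul
    (continuous_noiseMoment μ τ 0).measurable.ennreal_ofReal (.of_forall fun _ => by simp)]
  simp_rw [ENNReal.toReal_ofReal (noiseMoment_zero_pos μ hτ _).le, smul_eq_mul, mul_comm]

theorem integrable_conv_gaussianReal_iff (hτ : 0 < τ) (f : ℝ → ℝ) :
    Integrable f (μ ∗ gaussianReal 0 τ) ↔ Integrable fun x => f x * noiseMoment τ 0 μ x := by
  rw [conv_gaussianReal_eq_withDensity μ hτ, integrable_withDensity_iff
    (continuous_noiseMoment μ τ 0).measurable.ennreal_ofReal (.of_forall fun _ => by simp)]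
  simp_rw [ENNReal.toReal_ofReal (noiseMoment_zero_pos μ hτ _).le]

theorem integrable_noiseMoment_zero (hτ : 0 < τ) : Integrable (noiseMoment τ 0 μ) := by
  simpa using (integrable_conv_gaussianReal_iff μ hτ fun _ => 1).1 (integrable_const 1)

theorem integrable_mul_noiseMoment (hτ : 0 < τ) {n : ℕ} {h : ℝ → ℝ}
    (hh : Integrable (fun p : ℝ × ℝ => h (p.1 + p.2) * p.2 ^ n) (μ.prod (gaussianReal 0 τ))) :
    Integrable fun x => h x * noiseMoment τ n μ x :=
  integrable_mul_smooth (integrable_mul_pow_prod_gaussianReal μ hτ hh)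

theorem integral_mul_noiseMoment (hτ : 0 < τ) {n : ℕ} {h : ℝ → ℝ}
    (hh : Integrable (fun p : ℝ × ℝ => h (p.1 + p.2) * p.2 ^ n) (μ.prod (gaussianReal 0 τ))) :
    ∫ x, h x * noiseMoment τ n μ x
      = ∫ p : ℝ × ℝ, h (p.1 + p.2) * p.2 ^ n ∂μ.prod (gaussianReal 0 τ) := by
  calc ∫ x, h x * noiseMoment τ n μ x
      = ∫ p : ℝ × ℝ, h (p.1 + p.2) * momentKernel τ n p.2 ∂μ.prod volume :=
        integral_mul_smooth (integrable_mul_pow_prod_gaussianReal μ hτ hh)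
    _ = ∫ p : ℝ × ℝ, h (p.1 + p.2) * p.2 ^ n ∂μ.prod (gaussianReal 0 τ) := by
        rw [prod_gaussianReal_eq_withDensity μ hτ, integral_withDensity_eq_integral_toReal_smul
          (by fun_prop) (.of_forall fun _ => by simp)]
        refine integral_congr_ae (.of_forall fun p => ?_)
        simp_rw [ENNReal.toReal_ofReal (momentKernel_zero_pos hτ _).le, smul_eq_mul]
        rw [momentKernel_zero_apply, momentKernel_apply]
        ring

theorem integrable_sq_snd_prod_gaussianReal (τ : ℝ≥0) :
    Integrable (fun p : ℝ × ℝ => p.2 ^ 2) (μ.prod (gaussianReal 0 τ)) :=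
  ((memLp_two_gaussianReal τ).integrable_sq).comp_snd μ

theorem integrable_noiseMoment_two (hτ : 0 < τ) : Integrable (noiseMoment τ 2 μ) := by
  simpa using integrable_mul_noiseMoment μ hτ (h := fun _ => 1) (n := 2)
    (by simpa using integrable_sq_snd_prod_gaussianReal μ τ)

theorem integral_noiseMoment_two (hτ : 0 < τ) : ∫ x, noiseMoment τ 2 μ x = τ := by
  have h := integral_mul_noiseMoment μ hτ (h := fun _ => 1) (n := 2)
    (by simpa using integrable_sq_snd_prod_gaussianReal μ τ)
  simp only [one_mul] at h
  rw [h, integral_fun_snd (fun z : ℝ => z ^ 2), integral_sq_gaussianReal, probReal_univ, one_smul]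

theorem noiseMoment_one_sq_le (τ : ℝ≥0) (x : ℝ) :
    noiseMoment τ 1 μ x ^ 2 ≤ noiseMoment τ 0 μ x * noiseMoment τ 2 μ x := by
  have hquad : ∀ c : ℝ, 0 ≤ noiseMoment τ 0 μ x * (c * c) + 2 * noiseMoment τ 1 μ x * c
      + noiseMoment τ 2 μ x := fun c => by
    have h0 := (integrable_translate (momentKernel τ 0) μ x).mul_const (c * c)
    have h1 := ((integrable_translate (momentKernel τ 1) μ x).const_mul 2).mul_const c
    have h2 := integrable_translate (momentKernel τ 2) μ x
    have h01 : Integrable (fun s => momentKernel τ 0 (x - s) * (c * c)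
      + 2 * momentKernel τ 1 (x - s) * c) μ := h0.add h1
    simp only [noiseMoment, smooth]
    rw [← integral_const_mul, ← integral_mul_const, ← integral_mul_const, ← integral_add h0 h1,
      ← integral_add h01 h2]
    refine integral_nonneg fun s => ?_
    have hsq : 0 ≤ (x - s + c) ^ 2 * gaussianPDFReal 0 τ (x - s) :=
      mul_nonneg (sq_nonneg _) (gaussianPDFReal_nonneg 0 τ _)
    simp only [Pi.zero_apply, momentKernel_apply]
    linarith
  have := discrim_le_zero hquad
  rw [discrim] at this
  linarith

/-! ### The score of a law perturbed by a Gaussian -/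

theorem density_conv (hτ : 0 < τ) : density (μ ∗ gaussianReal 0 τ) = noiseMoment τ 0 μ := by
  have hc := continuous_noiseMoment μ τ 0
  have hi := integrable_noiseMoment_zero μ hτ
  have hcdf : ∀ x, cdf (μ ∗ gaussianReal 0 τ) x
      = (∫ t in (0 : ℝ)..x, noiseMoment τ 0 μ t) + ∫ t in Set.Iic 0, noiseMoment τ 0 μ t := by
    intro x
    have h0 := fun t => (noiseMoment_zero_pos μ hτ t).le
    rw [← intervalIntegral.integral_Iic_sub_Iic hi.integrableOn hi.integrableOn, sub_add_cancel,
      cdf_eq_real, measureReal_def, conv_gaussianReal_eq_withDensity μ hτ,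
      withDensity_apply _ measurableSet_Iic,
      ← ofReal_integral_eq_lintegral_ofReal hi.integrableOn (.of_forall h0),
      ENNReal.toReal_ofReal (integral_nonneg h0)]
  funext x
  rw [density, funext hcdf]
  exact ((hc.integral_hasStrictDerivAt 0 x).hasDerivAt.add_const _).deriv

theorem score_conv (hτ : 0 < τ) (x : ℝ) :
    score (μ ∗ gaussianReal 0 τ) x = -(noiseMoment τ 1 μ x / noiseMoment τ 0 μ x) / τ := by
  rw [score, density_conv μ hτ, (hasDerivAt_noiseMoment_zero μ τ x).deriv]
  ring

theorem continuous_score (hτ : 0 < τ) : Continuous (score (μ ∗ gaussianReal 0 τ)) := by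
  rw [funext (score_conv μ hτ)]
  exact (((continuous_noiseMoment μ τ 1).div (continuous_noiseMoment μ τ 0)
    fun x => (noiseMoment_zero_pos μ hτ x).ne').neg).div_const _

theorem score_sq_mul_density_le (hτ : 0 < τ) (x : ℝ) :
    score (μ ∗ gaussianReal 0 τ) x ^ 2 * noiseMoment τ 0 μ x ≤ noiseMoment τ 2 μ x / τ ^ 2 := by
  have h0 := noiseMoment_zero_pos μ hτ x
  calc score (μ ∗ gaussianReal 0 τ) x ^ 2 * noiseMoment τ 0 μ x
      = noiseMoment τ 1 μ x ^ 2 / noiseMoment τ 0 μ x / τ ^ 2 := by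
        rw [score_conv μ hτ]
        field_simp
    _ ≤ noiseMoment τ 2 μ x / τ ^ 2 := by
        gcongr
        exact (div_le_iff₀' h0).2 (noiseMoment_one_sq_le μ τ x)

theorem integrable_score_sq_mul_density (hτ : 0 < τ) :
    Integrable fun x => score (μ ∗ gaussianReal 0 τ) x ^ 2 * noiseMoment τ 0 μ x := by
  refine ((integrable_noiseMoment_two μ hτ).div_const (τ ^ 2)).mono'
    (((continuous_score μ hτ).pow 2).mul
      (continuous_noiseMoment μ τ 0)).aestronglyMeasurable (.of_forall fun x => ?_)
  rw [Real.norm_of_nonneg (mul_nonneg (sq_nonneg _) (noiseMoment_zero_pos μ hτ x).le)]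
  exact score_sq_mul_density_le μ hτ x

theorem memLp_score (hτ : 0 < τ) :
    MemLp (score (μ ∗ gaussianReal 0 τ)) 2 (μ ∗ gaussianReal 0 τ) := by
  rw [memLp_two_iff_integrable_sq (continuous_score μ hτ).aestronglyMeasurable,
    integrable_conv_gaussianReal_iff μ hτ]
  exact integrable_score_sq_mul_density μ hτ

theorem fisherInfo_conv (hτ : 0 < τ) :
    fisherInfo (μ ∗ gaussianReal 0 τ)
      = ∫ x, score (μ ∗ gaussianReal 0 τ) x ^ 2 * noiseMoment τ 0 μ x :=
  integral_conv_gaussianReal μ hτ _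

theorem fisherInfo_conv_le (hτ : 0 < τ) : fisherInfo (μ ∗ gaussianReal 0 τ) ≤ 1 / τ := by
  calc fisherInfo (μ ∗ gaussianReal 0 τ) ≤ ∫ x, noiseMoment τ 2 μ x / τ ^ 2 := by
        rw [fisherInfo_conv μ hτ]
        exact integral_mono (integrable_score_sq_mul_density μ hτ)
          ((integrable_noiseMoment_two μ hτ).div_const _) (score_sq_mul_density_le μ hτ)
    _ = 1 / τ := by
        rw [integral_div, integral_noiseMoment_two μ hτ]
        field_simp

/-- Tweedie's formula: `-τ ρ(x)` is the conditional expectation of `Z` given `S + Z = x`. -/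
theorem integral_mul_score (hτ : 0 < τ) {h : ℝ → ℝ}
    (hh : Integrable (fun p : ℝ × ℝ => h (p.1 + p.2) * p.2) (μ.prod (gaussianReal 0 τ))) :
    ∫ x, h x * score (μ ∗ gaussianReal 0 τ) x ∂(μ ∗ gaussianReal 0 τ)
      = -(∫ p : ℝ × ℝ, h (p.1 + p.2) * p.2 ∂μ.prod (gaussianReal 0 τ)) / τ := by
  have hn := integral_mul_noiseMoment μ hτ (h := h) (n := 1) (by simpa only [pow_one] using hh)
  simp only [pow_one] at hn
  rw [integral_conv_gaussianReal μ hτ, ← hn, ← integral_neg, ← integral_div]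
  refine integral_congr_ae (.of_forall fun x => ?_)
  have h0 := (noiseMoment_zero_pos μ hτ x).ne'
  simp only [score_conv μ hτ]
  field_simp

theorem integrable_snd_prod_gaussianReal (τ : ℝ≥0) :
    Integrable (fun p : ℝ × ℝ => p.2) (μ.prod (gaussianReal 0 τ)) :=
  ((memLp_two_gaussianReal τ).integrable one_le_two).comp_snd μ

theorem integral_snd_prod_gaussianReal (τ : ℝ≥0) :
    ∫ p : ℝ × ℝ, p.2 ∂μ.prod (gaussianReal 0 τ) = 0 := by
  rw [integral_fun_snd (fun z : ℝ => z), integral_id_gaussianReal, smul_zero]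

theorem integral_score (hτ : 0 < τ) :
    ∫ x, score (μ ∗ gaussianReal 0 τ) x ∂(μ ∗ gaussianReal 0 τ) = 0 := by
  have h := integral_mul_score μ hτ (h := fun _ => 1)
    (by simpa only [one_mul] using integrable_snd_prod_gaussianReal μ τ)
  simpa only [one_mul, integral_snd_prod_gaussianReal, neg_zero, zero_div] using h

end NoiseMoment

/-! ### Moments of convolutions -/

section Conv

variable {μ ν : Measure ℝ} [IsProbabilityMeasure μ] [IsProbabilityMeasure ν]

theorem memLp_conv (hμ : MemLp id 2 μ) (hν : MemLp id 2 ν) : MemLp id 2 (μ ∗ ν) := by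
  rw [Measure.conv, memLp_map_measure_iff (by fun_prop) (by fun_prop)]
  exact (hμ.comp_fst _).add (hν.comp_snd μ)

theorem integral_id_conv (hμ : Integrable id μ) (hν : Integrable id ν) :
    ∫ x, x ∂(μ ∗ ν) = (∫ x, x ∂μ) + ∫ x, x ∂ν := by
  have hfst : Integrable (fun p : ℝ × ℝ => p.1) (μ.prod ν) := hμ.comp_fst ν
  have hsnd : Integrable (fun p : ℝ × ℝ => p.2) (μ.prod ν) := hν.comp_snd μ
  rw [Measure.conv, integral_map (by fun_prop) (by fun_prop), integral_add hfst hsnd]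
  simp [integral_fun_fst (fun x : ℝ => x), integral_fun_snd (fun x : ℝ => x)]

theorem variance_conv (hμ : MemLp id 2 μ) (hν : MemLp id 2 ν) :
    variance id (μ ∗ ν) = variance id μ + variance id ν := by
  rw [Measure.conv, variance_map (by fun_prop) (by fun_prop)]
  refine (IndepFun.variance_fun_add (hμ.comp_fst ν) (hν.comp_snd μ)
    (indepFun_prod measurable_id measurable_id)).trans ?_
  rw [measurePreserving_fst.variance_fun_comp (by fun_prop),
    measurePreserving_snd.variance_fun_comp (by fun_prop)]

end Conv

section Fisher

variable {μ : Measure ℝ} [IsProbabilityMeasure μ]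

theorem memLp_conv_gaussianReal (hμ : MemLp id 2 μ) : MemLp id 2 (μ ∗ gaussianReal 0 τ) :=
  memLp_conv hμ (memLp_two_gaussianReal τ)

theorem integral_id_conv_gaussianReal (hμ : Integrable id μ) :
    ∫ x, x ∂(μ ∗ gaussianReal 0 τ) = ∫ x, x ∂μ := by
  rw [integral_id_conv hμ ((memLp_two_gaussianReal τ).integrable one_le_two),
    integral_id_gaussianReal, add_zero]

theorem variance_conv_gaussianReal (hμ : MemLp id 2 μ) :
    variance id (μ ∗ gaussianReal 0 τ) = variance id μ + τ := by
  rw [variance_conv hμ (memLp_two_gaussianReal τ), variance_id_gaussianReal]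

theorem variance_conv_gaussianReal_pos (hτ : 0 < τ) (hμ : MemLp id 2 μ) :
    0 < variance id (μ ∗ gaussianReal 0 τ) := by
  rw [variance_conv_gaussianReal hμ]
  exact add_pos_of_nonneg_of_pos (variance_nonneg _ _) hτ

theorem variance_score (hτ : 0 < τ) :
    variance (score (μ ∗ gaussianReal 0 τ)) (μ ∗ gaussianReal 0 τ)
      = fisherInfo (μ ∗ gaussianReal 0 τ) :=
  variance_of_integral_eq_zero (continuous_score μ hτ).aemeasurable (integral_score μ hτ)

theorem covariance_id_score (hτ : 0 < τ) (hμ : MemLp id 2 μ) :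
    covariance id (score (μ ∗ gaussianReal 0 τ)) (μ ∗ gaussianReal 0 τ) = -1 := by
  have hfst : MemLp (fun p : ℝ × ℝ => p.1) 2 (μ.prod (gaussianReal 0 τ)) := hμ.comp_fst _
  have hsnd : MemLp (fun p : ℝ × ℝ => p.2) 2 (μ.prod (gaussianReal 0 τ)) :=
    (memLp_two_gaussianReal τ).comp_snd μ
  have hcross : Integrable (fun p : ℝ × ℝ => p.1 * p.2) (μ.prod (gaussianReal 0 τ)) :=
    hfst.integrable_mul hsnd
  have hnoise : ∫ p : ℝ × ℝ, (p.1 + p.2) * p.2 ∂μ.prod (gaussianReal 0 τ) = τ := by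
    simp_rw [add_mul, ← sq]
    rw [integral_add hcross (integrable_sq_snd_prod_gaussianReal μ τ),
      integral_prod_mul (fun s : ℝ => s) (fun z : ℝ => z), integral_id_gaussianReal,
      integral_fun_snd (fun z : ℝ => z ^ 2), integral_sq_gaussianReal]
    simp
  rw [covariance_eq_sub (memLp_conv_gaussianReal hμ) (memLp_score μ hτ), integral_score μ hτ,
    mul_zero, sub_zero]
  refine (integral_mul_score μ hτ (h := id) ((hfst.add hsnd).integrable_mul hsnd)).trans ?_
  simp only [id]
  rw [hnoise, neg_div, div_self (by positivity)]

/-- If `v = Var X` then `X + v ρ(X)` measures the deviation of the law of `X` from normality. -/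
theorem variance_add_variance_mul_score (hτ : 0 < τ) (hμ : MemLp id 2 μ) :
    variance (fun x => x + variance id (μ ∗ gaussianReal 0 τ) * score (μ ∗ gaussianReal 0 τ) x)
      (μ ∗ gaussianReal 0 τ)
      = variance id (μ ∗ gaussianReal 0 τ) * stFisherInfo (μ ∗ gaussianReal 0 τ) := by
  have h := variance_fun_add (memLp_conv_gaussianReal (τ := τ) hμ)
    ((memLp_score μ hτ).const_mul (variance id (μ ∗ gaussianReal 0 τ)))
  simp only [covariance_const_mul_right, variance_const_mul, variance_score hτ,
    covariance_id_score hτ hμ] at h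
  rw [stFisherInfo]
  exact h.trans (by ring)

theorem stFisherInfo_nonneg (hτ : 0 < τ) (hμ : MemLp id 2 μ) :
    0 ≤ stFisherInfo (μ ∗ gaussianReal 0 τ) := by
  refine nonneg_of_mul_nonneg_right ?_ (variance_conv_gaussianReal_pos hτ hμ)
  rw [← variance_add_variance_mul_score hτ hμ]
  exact variance_nonneg _ _

theorem stFisherInfo_le (hτ : 0 < τ) (hμ : MemLp id 2 μ) :
    stFisherInfo (μ ∗ gaussianReal 0 τ) ≤ variance id μ / τ := by
  have hτ' : (τ : ℝ) ≠ 0 := by positivity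
  calc stFisherInfo (μ ∗ gaussianReal 0 τ) ≤ (variance id μ + τ) * (1 / τ) - 1 := by
        rw [stFisherInfo, variance_conv_gaussianReal hμ]
        gcongr
        · exact add_nonneg (variance_nonneg _ _) τ.coe_nonneg
        · exact fisherInfo_conv_le μ hτ
    _ = variance id μ / τ := by
        field_simp
        ring

theorem stFisherInfo_eq_zero_of_affine (hτ : 0 < τ) (hμ : MemLp id 2 μ) {a b : ℝ}
    (h : ∀ x, score (μ ∗ gaussianReal 0 τ) x = a * x + b) :
    stFisherInfo (μ ∗ gaussianReal 0 τ) = 0 := by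
  have hL := memLp_conv_gaussianReal (τ := τ) hμ
  have hax : Integrable (fun x => a * id x) (μ ∗ gaussianReal 0 τ) :=
    (hL.integrable one_le_two).const_mul a
  have hcov := covariance_id_score hτ hμ
  have hvar := variance_score (μ := μ) hτ
  rw [funext h] at hcov hvar
  change covariance id (fun x => a * id x + b) _ = -1 at hcov
  change variance (fun x => a * id x + b) _ = _ at hvar
  rw [covariance_add_const_right hax, covariance_const_mul_right,
    covariance_self (by fun_prop)] at hcov
  rw [variance_add_const hax.aestronglyMeasurable, variance_const_mul] at hvar
  rw [stFisherInfo, ← hvar]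
  linear_combination (a * variance id (μ ∗ gaussianReal 0 τ) - 1) * hcov

end Fisher

/-! ### Continuity of the score and of the Fisher information -/

section Pratt

variable {α ι : Type*} [MeasurableSpace α] {m : Measure α} {l : Filter ι} [l.IsCountablyGenerated]

theorem tendsto_integral_of_tendsto_bound {F G : ι → α → ℝ} {f g : α → ℝ}
    (hF : ∀ i, AEStronglyMeasurable (F i) m) (hG : ∀ i, Integrable (G i) m) (hg : Integrable g m)
    (h0 : ∀ i x, 0 ≤ F i x) (hFG : ∀ i x, F i x ≤ G i x)
    (hf : ∀ x, Tendsto (F · x) l (𝓝 (f x))) (hGg : ∀ x, Tendsto (G · x) l (𝓝 (g x)))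
    (hint : Tendsto (fun i => ∫ x, G i x ∂m) l (𝓝 (∫ x, g x ∂m))) :
    Tendsto (fun i => ∫ x, F i x ∂m) l (𝓝 (∫ x, f x ∂m)) := by
  rcases l.eq_or_neBot with rfl | _
  · exact tendsto_bot
  have hfg (x : α) : 0 ≤ f x ∧ f x ≤ g x :=
    ⟨ge_of_tendsto' (hf x) (h0 · x), le_of_tendsto_of_tendsto' (hf x) (hGg x) (hFG · x)⟩
  have hFi (i : ι) : Integrable (F i) m := (hG i).mono' (hF i) (.of_forall fun x => by
    rw [Real.norm_of_nonneg (h0 i x)]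
    exact hFG i x)
  have hpos (i : ι) : Integrable (fun x => max (F i x - G i x + g x) 0) m :=
    (((hFi i).sub (hG i)).add hg).pos_part
  have hlower : Tendsto (fun i => ∫ x, min (F i x) (g x) ∂m) l (𝓝 (∫ x, f x ∂m)) := by
    refine tendsto_integral_filter_of_dominated_convergence g
      (.of_forall fun i => (hF i).inf hg.aestronglyMeasurable) (.of_forall fun i => .of_forall
        fun x => ?_) hg (.of_forall fun x => ?_)
    · rw [Real.norm_of_nonneg (le_min (h0 i x) ((hfg x).1.trans (hfg x).2))]
      exact min_le_right _ _
    · simpa [(hfg x).2] using (hf x).min (tendsto_const_nhds (x := g x))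
  have hupper : Tendsto (fun i => ∫ x, max (F i x - G i x + g x) 0 ∂m) l (𝓝 (∫ x, f x ∂m)) := by
    refine tendsto_integral_filter_of_dominated_convergence g
      (.of_forall fun i => (hpos i).aestronglyMeasurable) (.of_forall fun i => .of_forall
        fun x => ?_) hg (.of_forall fun x => ?_)
    · rw [Real.norm_of_nonneg (le_max_right _ _)]
      exact max_le (by linarith [hFG i x]) ((hfg x).1.trans (hfg x).2)
    · simpa [(hfg x).1] using
        (((hf x).sub (hGg x)).add_const (g x)).max (tendsto_const_nhds (x := (0 : ℝ)))
  refine tendsto_of_tendsto_of_tendsto_of_le_of_le hlower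
    (h := fun i => (∫ x, max (F i x - G i x + g x) 0 ∂m) + ((∫ x, G i x ∂m) - ∫ x, g x ∂m))
    (by simpa using hupper.add (hint.sub_const (∫ x, g x ∂m))) (fun i => ?_) fun i => ?_
  · exact integral_mono ((hFi i).inf hg) (hFi i) fun x => min_le_left _ _
  · have hGi : Integrable (fun x => G i x - g x) m := (hG i).sub hg
    beta_reduce
    rw [← integral_sub (hG i) hg, ← integral_add (hpos i) hGi]
    refine integral_mono (hFi i) ((hpos i).add hGi) fun x => ?_
    linarith [le_max_left (F i x - G i x + g x) 0]

end Pratt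

section Continuity

variable {τ : ℝ≥0} {ι : Type*} {l : Filter ι} {μs : ι → ProbabilityMeasure ℝ}
  {μ : ProbabilityMeasure ℝ}

theorem tendsto_score (hτ : 0 < τ) (hμ : Tendsto μs l (𝓝 μ)) {xs : ι → ℝ} {x : ℝ}
    (hx : Tendsto xs l (𝓝 x)) :
    Tendsto (fun i => score ((μs i : Measure ℝ) ∗ gaussianReal 0 τ) (xs i)) l
      (𝓝 (score ((μ : Measure ℝ) ∗ gaussianReal 0 τ) x)) := by
  simp_rw [score_conv _ hτ]
  exact ((tendsto_smooth (uniformContinuous_momentKernel τ 1) hμ hx).div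
    (tendsto_smooth (uniformContinuous_momentKernel τ 0) hμ hx)
    (noiseMoment_zero_pos _ hτ x).ne').neg.div_const _

theorem tendsto_fisherInfo [l.IsCountablyGenerated] (hτ : 0 < τ) (hμ : Tendsto μs l (𝓝 μ)) :
    Tendsto (fun i => fisherInfo ((μs i : Measure ℝ) ∗ gaussianReal 0 τ)) l
      (𝓝 (fisherInfo ((μ : Measure ℝ) ∗ gaussianReal 0 τ))) := by
  simp_rw [fisherInfo_conv _ hτ]
  refine tendsto_integral_of_tendsto_bound (G := fun i x => noiseMoment τ 2 (μs i) x / τ ^ 2)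
    (fun i => (integrable_score_sq_mul_density _ hτ).aestronglyMeasurable)
    (fun i => (integrable_noiseMoment_two _ hτ).div_const _)
    ((integrable_noiseMoment_two _ hτ).div_const _)
    (fun i x => mul_nonneg (sq_nonneg _) (noiseMoment_zero_pos _ hτ x).le)
    (fun i x => score_sq_mul_density_le _ hτ x) (fun x => ?_)
    (fun x => (tendsto_smooth_apply _ hμ x).div_const _) ?_
  · exact ((tendsto_score hτ hμ tendsto_const_nhds).pow 2).mul (tendsto_smooth_apply _ hμ x)
  · simp_rw [integral_div, integral_noiseMoment_two _ hτ]
    exact tendsto_const_nhds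

end Continuity

/-! ### Perturbed joint laws -/

section Marginals

variable {μ : Measure (ℝ × ℝ)} [IsProbabilityMeasure μ]

instance isProbabilityMeasure_map_fst : IsProbabilityMeasure (μ.map Prod.fst) :=
  Measure.isProbabilityMeasure_map (by fun_prop)

instance isProbabilityMeasure_map_snd : IsProbabilityMeasure (μ.map Prod.snd) :=
  Measure.isProbabilityMeasure_map (by fun_prop)

instance isProbabilityMeasure_map_continuousLinearMap (L : ℝ × ℝ →L[ℝ] ℝ) :
    IsProbabilityMeasure (μ.map L) :=
  Measure.isProbabilityMeasure_map (by fun_prop)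

end Marginals

section Perturb

variable {τ : ℝ≥0} (μ : Measure (ℝ × ℝ)) [IsProbabilityMeasure μ]

theorem perturb_eq_conv (τ : ℝ≥0) (μ : Measure (ℝ × ℝ)) :
    perturb τ μ = μ ∗ (gaussianReal 0 τ).prod (gaussianReal 0 τ) := rfl

theorem map_prod_gaussianReal (τ : ℝ≥0) {L : ℝ × ℝ →L[ℝ] ℝ}
    (hL : L (1, 0) ^ 2 + L (0, 1) ^ 2 = 1) :
    ((gaussianReal 0 τ).prod (gaussianReal 0 τ)).map L = gaussianReal 0 τ := by
  have hsum : (L : ℝ × ℝ → ℝ)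
      = (fun p => p.1 + p.2) ∘ Prod.map (L (1, 0) * ·) (L (0, 1) * ·) := by
    funext p
    rw [Function.comp_apply, Prod.map_apply, mul_comm, mul_comm (L (0, 1)), ← smul_eq_mul,
      ← smul_eq_mul, ← map_smul, ← map_smul, ← map_add]
    simp
  rw [hsum, ← Measure.map_map (by fun_prop) (by fun_prop),
    ← Measure.map_prod_map _ _ (by fun_prop) (by fun_prop), ← Measure.conv,
    gaussianReal_map_const_mul, gaussianReal_map_const_mul, gaussianReal_conv_gaussianReal]
  congr 1
  · simp
  · ext
    simp [← add_mul, hL]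

theorem perturb_map (τ : ℝ≥0) {L : ℝ × ℝ →L[ℝ] ℝ} (hL : L (1, 0) ^ 2 + L (0, 1) ^ 2 = 1) :
    (perturb τ μ).map L = μ.map L ∗ gaussianReal 0 τ := by
  rw [perturb_eq_conv, Measure.map_conv_continuousLinearMap, map_prod_gaussianReal τ hL]

theorem perturb_map_fst (τ : ℝ≥0) :
    (perturb τ μ).map Prod.fst = μ.map Prod.fst ∗ gaussianReal 0 τ :=
  perturb_map μ τ (L := .fst ℝ ℝ ℝ) (by simp)

theorem perturb_map_snd (τ : ℝ≥0) :
    (perturb τ μ).map Prod.snd = μ.map Prod.snd ∗ gaussianReal 0 τ :=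
  perturb_map μ τ (L := .snd ℝ ℝ ℝ) (by simp)

theorem memLp_score_comp (hτ : 0 < τ) {L : ℝ × ℝ →L[ℝ] ℝ}
    (hL : L (1, 0) ^ 2 + L (0, 1) ^ 2 = 1) :
    MemLp (fun p => score (μ.map L ∗ gaussianReal 0 τ) (L p)) 2 (perturb τ μ) := by
  have h := memLp_score (μ.map L) hτ
  nth_rw 2 [← perturb_map μ τ hL] at h
  exact h.comp_of_map (by fun_prop)

theorem integral_score_comp_sq (hτ : 0 < τ) {L : ℝ × ℝ →L[ℝ] ℝ}
    (hL : L (1, 0) ^ 2 + L (0, 1) ^ 2 = 1) :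
    ∫ p, score (μ.map L ∗ gaussianReal 0 τ) (L p) ^ 2 ∂perturb τ μ
      = fisherInfo (μ.map L ∗ gaussianReal 0 τ) := by
  rw [fisherInfo]
  nth_rw 2 [← perturb_map μ τ hL]
  exact (integral_map L.continuous.aemeasurable
    ((continuous_score (μ.map L) hτ).pow 2).aestronglyMeasurable).symm

theorem memLp_score_fst (hτ : 0 < τ) :
    MemLp (fun p => score (μ.map Prod.fst ∗ gaussianReal 0 τ) p.1) 2 (perturb τ μ) :=
  memLp_score_comp μ hτ (L := .fst ℝ ℝ ℝ) (by simp)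

theorem memLp_score_snd (hτ : 0 < τ) :
    MemLp (fun p => score (μ.map Prod.snd ∗ gaussianReal 0 τ) p.2) 2 (perturb τ μ) :=
  memLp_score_comp μ hτ (L := .snd ℝ ℝ ℝ) (by simp)

/-- The density of a pair of independent `N(0, τ)` random variables. It is identically zero if
`τ = 0`. -/
def jointKernel (τ : ℝ≥0) : ℝ × ℝ →ᵇ ℝ :=
  (momentKernel τ 0).compContinuous ⟨Prod.fst, continuous_fst⟩
    * (momentKernel τ 0).compContinuous ⟨Prod.snd, continuous_snd⟩

theorem jointKernel_apply (τ : ℝ≥0) (p : ℝ × ℝ) :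
    jointKernel τ p = momentKernel τ 0 p.1 * momentKernel τ 0 p.2 := rfl

theorem jointKernel_pos (hτ : 0 < τ) (p : ℝ × ℝ) : 0 < jointKernel τ p :=
  mul_pos (momentKernel_zero_pos hτ p.1) (momentKernel_zero_pos hτ p.2)

theorem prod_gaussianReal_eq_withDensity_jointKernel (hτ : 0 < τ) :
    (gaussianReal 0 τ).prod (gaussianReal 0 τ)
      = volume.withDensity fun p => ENNReal.ofReal (jointKernel τ p) := by
  rw [gaussianReal_eq_withDensity_momentKernel hτ, prod_withDensity (by fun_prop) (by fun_prop)]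
  simp_rw [jointKernel_apply, ENNReal.ofReal_mul (momentKernel_zero_pos hτ _).le]
  rfl

theorem perturb_eq_withDensity (hτ : 0 < τ) :
    perturb τ μ = volume.withDensity fun p => ENNReal.ofReal (smooth (jointKernel τ) μ p) := by
  have hγ := prod_gaussianReal_eq_withDensity_jointKernel hτ
  have : SFinite ((volume : Measure (ℝ × ℝ)).withDensity
      fun p => ENNReal.ofReal (jointKernel τ p)) := hγ ▸ inferInstance
  rw [perturb_eq_conv, hγ, conv_withDensity_ofReal fun p => (jointKernel_pos hτ p).le]

/-! ### The score gap -/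

/-- The linear form `(x, y) ↦ √β x + √(1 - β) y`. -/
def linComb (β : ℝ) : ℝ × ℝ →L[ℝ] ℝ :=
  √β • ContinuousLinearMap.fst ℝ ℝ ℝ + √(1 - β) • ContinuousLinearMap.snd ℝ ℝ ℝ

theorem linComb_apply (β : ℝ) (p : ℝ × ℝ) : linComb β p = √β * p.1 + √(1 - β) * p.2 := rfl

theorem continuous_uncurry_linComb : Continuous (Function.uncurry fun β p => linComb β p) := by
  simp only [linComb_apply, Function.uncurry_def]
  fun_prop

theorem linComb_sq_add_sq {β : ℝ} (hβ : β ∈ Set.Icc (0 : ℝ) 1) :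
    linComb β (1, 0) ^ 2 + linComb β (0, 1) ^ 2 = 1 := by
  simp [linComb_apply, Real.sq_sqrt hβ.1, Real.sq_sqrt (sub_nonneg.2 hβ.2)]

/-- The random variable whose second moment is the score gap, for the perturbation of the joint
law `μ`. -/
def gapFun (τ : ℝ≥0) (μ : Measure (ℝ × ℝ)) (β : ℝ) (p : ℝ × ℝ) : ℝ :=
  √β * score (μ.map Prod.fst ∗ gaussianReal 0 τ) p.1
    + √(1 - β) * score (μ.map Prod.snd ∗ gaussianReal 0 τ) p.2
    - score (μ.map (linComb β) ∗ gaussianReal 0 τ) (linComb β p)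

theorem scoreGap_nonneg (κ : Measure (ℝ × ℝ)) (β : ℝ) : 0 ≤ scoreGap κ β :=
  integral_nonneg fun _ => sq_nonneg _

variable {β : ℝ}

theorem scoreGap_perturb (τ : ℝ≥0) (hβ : β ∈ Set.Icc (0 : ℝ) 1) :
    scoreGap (perturb τ μ) β = ∫ p, gapFun τ μ β p ^ 2 ∂perturb τ μ := by
  simp_rw [scoreGap, ← linComb_apply, perturb_map_fst, perturb_map_snd,
    perturb_map μ τ (linComb_sq_add_sq hβ)]
  rfl

theorem continuous_gapFun (hτ : 0 < τ) (β : ℝ) : Continuous (gapFun τ μ β) := by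
  have hfst := continuous_score (μ.map Prod.fst) hτ
  have hsnd := continuous_score (μ.map Prod.snd) hτ
  have hlin := continuous_score (μ.map (linComb β)) hτ
  unfold gapFun
  fun_prop

theorem memLp_gapFun (hτ : 0 < τ) (hβ : β ∈ Set.Icc (0 : ℝ) 1) :
    MemLp (gapFun τ μ β) 2 (perturb τ μ) :=
  (((memLp_score_fst μ hτ).const_mul _).add ((memLp_score_snd μ hτ).const_mul _)).sub
    (memLp_score_comp μ hτ (linComb_sq_add_sq hβ))

theorem ofReal_scoreGap (hτ : 0 < τ) (hβ : β ∈ Set.Icc (0 : ℝ) 1) :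
    ENNReal.ofReal (scoreGap (perturb τ μ) β)
      = ∫⁻ p, ENNReal.ofReal (smooth (jointKernel τ) μ p * gapFun τ μ β p ^ 2) := by
  have hd := measurable_smooth (jointKernel τ) μ
  have hc := (continuous_gapFun μ hτ β).measurable
  rw [scoreGap_perturb μ τ hβ, ofReal_integral_eq_lintegral_ofReal
    (memLp_gapFun μ hτ hβ).integrable_sq (.of_forall fun _ => sq_nonneg _)]
  conv_lhs => rw [perturb_eq_withDensity μ hτ]
  rw [lintegral_withDensity_eq_lintegral_mul _ (by fun_prop) (by fun_prop)]
  refine lintegral_congr fun p => ?_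
  rw [ENNReal.ofReal_mul (smooth_pos (jointKernel_pos hτ) μ p).le]
  rfl

end Perturb

/-! ### Score gaps along weakly convergent laws -/

theorem tendsto_map_of_continuous_uncurry {ι T E G : Type*}
    [TopologicalSpace T] [TopologicalSpace.PseudoMetrizableSpace T] [SecondCountableTopology T]
    [MeasurableSpace T] [OpensMeasurableSpace T]
    [TopologicalSpace E] [TopologicalSpace.PseudoMetrizableSpace E] [SecondCountableTopology E]
    [MeasurableSpace E] [OpensMeasurableSpace E]
    [TopologicalSpace G] [MeasurableSpace G] [BorelSpace G]
    {F : T → E → G} (hF : Continuous F.uncurry) {l : Filter ι} {ts : ι → T} {t : T}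
    (ht : Tendsto ts l (𝓝 t)) {κs : ι → ProbabilityMeasure E} {κ : ProbabilityMeasure E}
    (hκ : Tendsto κs l (𝓝 κ)) :
    Tendsto (fun i => (κs i).map (hF.uncurry_left (ts i)).aemeasurable) l
      (𝓝 (κ.map (hF.uncurry_left t).aemeasurable)) := by
  have hmap (t : T) (κ : ProbabilityMeasure E) :
      ((diracProba t).prod κ).map hF.aemeasurable = κ.map (hF.uncurry_left t).aemeasurable := by
    apply Subtype.ext
    change ((Measure.dirac t).prod (κ : Measure E)).map F.uncurry = _
    rw [Measure.dirac_prod, Measure.map_map hF.measurable (by fun_prop)]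
    rfl
  simp_rw [← hmap]
  refine ProbabilityMeasure.tendsto_map_of_tendsto_of_continuous _ _ ?_ hF
  exact (ProbabilityMeasure.continuous_prod.tendsto (diracProba t, κ)).comp
    (((continuous_diracProba.tendsto t).comp ht).prodMk_nhds hκ)

section GapLimit

variable {τ : ℝ≥0} {ι : Type*} {l : Filter ι} {κs : ι → ProbabilityMeasure (ℝ × ℝ)}
  {κ : ProbabilityMeasure (ℝ × ℝ)} {βs : ι → ℝ} {β : ℝ}

theorem tendsto_score_linComb (hτ : 0 < τ) (hκ : Tendsto κs l (𝓝 κ)) (hβ : Tendsto βs l (𝓝 β))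
    (p : ℝ × ℝ) :
    Tendsto (fun i => score ((κs i : Measure (ℝ × ℝ)).map (linComb (βs i)) ∗ gaussianReal 0 τ)
      (linComb (βs i) p)) l
      (𝓝 (score ((κ : Measure (ℝ × ℝ)).map (linComb β) ∗ gaussianReal 0 τ) (linComb β p))) := by
  have hmap := tendsto_map_of_continuous_uncurry continuous_uncurry_linComb hβ hκ
  exact tendsto_score hτ hmap (((continuous_uncurry_linComb.uncurry_right p).tendsto β).comp hβ)

theorem tendsto_gapFun (hτ : 0 < τ) (hκ : Tendsto κs l (𝓝 κ)) (hβ : Tendsto βs l (𝓝 β))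
    (p : ℝ × ℝ) : Tendsto (fun i => gapFun τ (κs i) (βs i) p) l (𝓝 (gapFun τ κ β p)) :=
  ((hβ.sqrt.mul (tendsto_score hτ (ProbabilityMeasure.tendsto_map_of_tendsto_of_continuous _ _ hκ
    continuous_fst) tendsto_const_nhds)).add ((hβ.const_sub 1).sqrt.mul
    (tendsto_score hτ (ProbabilityMeasure.tendsto_map_of_tendsto_of_continuous _ _ hκ
    continuous_snd) tendsto_const_nhds))).sub (tendsto_score_linComb hτ hκ hβ p)

variable [l.IsCountablyGenerated]

theorem ofReal_scoreGap_le_liminf [l.NeBot] (hτ : 0 < τ) (hκ : Tendsto κs l (𝓝 κ))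
    (hβs : ∀ i, βs i ∈ Set.Icc (0 : ℝ) 1) (hβ : Tendsto βs l (𝓝 β)) :
    ENNReal.ofReal (scoreGap (perturb τ κ) β)
      ≤ liminf (fun i => ENNReal.ofReal (scoreGap (perturb τ (κs i)) (βs i))) l := by
  have hβ01 : β ∈ Set.Icc (0 : ℝ) 1 := isClosed_Icc.mem_of_tendsto hβ (.of_forall hβs)
  have hlim (p : ℝ × ℝ) : liminf (fun i => ENNReal.ofReal
      (smooth (jointKernel τ) (κs i) p * gapFun τ (κs i) (βs i) p ^ 2)) l
      = ENNReal.ofReal (smooth (jointKernel τ) κ p * gapFun τ κ β p ^ 2) :=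
    (ENNReal.tendsto_ofReal ((tendsto_smooth_apply _ hκ p).mul
      ((tendsto_gapFun hτ hκ hβ p).pow 2))).liminf_eq
  simp_rw [ofReal_scoreGap _ hτ hβ01, ofReal_scoreGap _ hτ (hβs _), ← hlim]
  refine lintegral_liminf_le fun i => ?_
  have hd := measurable_smooth (jointKernel τ) (κs i : Measure (ℝ × ℝ))
  have hc := (continuous_gapFun (κs i : Measure (ℝ × ℝ)) hτ (βs i)).measurable
  fun_prop

theorem scoreGap_eq_zero_of_tendsto [l.NeBot] (hτ : 0 < τ) (hκ : Tendsto κs l (𝓝 κ))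
    (hβs : ∀ i, βs i ∈ Set.Icc (0 : ℝ) 1) (hβ : Tendsto βs l (𝓝 β))
    (hgap : Tendsto (fun i => scoreGap (perturb τ (κs i : Measure (ℝ × ℝ))) (βs i)) l (𝓝 0)) :
    scoreGap (perturb τ (κ : Measure (ℝ × ℝ))) β = 0 := by
  have h := ofReal_scoreGap_le_liminf hτ hκ hβs hβ
  rw [(ENNReal.tendsto_ofReal hgap).liminf_eq, ENNReal.ofReal_zero, nonpos_iff_eq_zero,
    ENNReal.ofReal_eq_zero] at h
  exact h.antisymm (scoreGap_nonneg _ _)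

theorem gapFun_eq_zero_of_scoreGap_eq_zero (hτ : 0 < τ) {μ : Measure (ℝ × ℝ)}
    [IsProbabilityMeasure μ] (hβ : β ∈ Set.Icc (0 : ℝ) 1) (h : scoreGap (perturb τ μ) β = 0) :
    gapFun τ μ β = 0 := by
  have hd := measurable_smooth (jointKernel τ) μ
  have hc := continuous_gapFun μ hτ β
  have hc' := hc.measurable
  refine (Continuous.ae_eq_iff_eq volume hc continuous_zero).1 ?_
  have h0 := ofReal_scoreGap μ hτ hβ
  rw [h, ENNReal.ofReal_zero, eq_comm, lintegral_eq_zero_iff (by fun_prop)] at h0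
  filter_upwards [h0] with p hp
  have hle := ENNReal.ofReal_eq_zero.1 hp
  exact pow_eq_zero_iff two_ne_zero |>.1
    ((nonpos_of_mul_nonpos_right hle (smooth_pos (jointKernel_pos hτ) μ p)).antisymm
      (sq_nonneg _))

end GapLimit

/-! ### Weak convergence and second moments -/

theorem tendsto_conv {ι : Type*} {l : Filter ι} {μs νs : ι → ProbabilityMeasure ℝ}
    {μ ν : ProbabilityMeasure ℝ} (hμ : Tendsto μs l (𝓝 μ)) (hν : Tendsto νs l (𝓝 ν)) :
    Tendsto (β := ProbabilityMeasure ℝ) (fun i => ⟨(μs i : Measure ℝ) ∗ νs i, inferInstance⟩) l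
      (𝓝 ⟨(μ : Measure ℝ) ∗ ν, inferInstance⟩) :=
  ProbabilityMeasure.tendsto_map_of_tendsto_of_continuous _ _
    ((ProbabilityMeasure.continuous_prod.tendsto (μ, ν)).comp (hμ.prodMk_nhds hν)) continuous_add

theorem memLp_two_of_tendsto {α : Type*} [MeasurableSpace α] [TopologicalSpace α]
    [OpensMeasurableSpace α] [HasOuterApproxClosed α] {μs : ℕ → ProbabilityMeasure α}
    {μ : ProbabilityMeasure α} (hμ : Tendsto μs atTop (𝓝 μ)) {f : α → ℝ} (hf : Continuous f)
    (hμs : ∀ n, MemLp f 2 (μs n : Measure α)) {M : ℝ}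
    (hM : ∀ n, ∫ x, f x ^ 2 ∂(μs n : Measure α) ≤ M) : MemLp f 2 (μ : Measure α) := by
  have hm : Measurable f := hf.measurable
  have hbound (n : ℕ) : ∫⁻ x, ENNReal.ofReal (f x ^ 2) ∂(μs n : Measure α) ≤ ENNReal.ofReal M := by
    rw [← ofReal_integral_eq_lintegral_ofReal (hμs n).integrable_sq
      (.of_forall fun x => sq_nonneg _)]
    exact ENNReal.ofReal_le_ofReal (hM n)
  rw [memLp_two_iff_integrable_sq hm.aestronglyMeasurable]
  refine ⟨by fun_prop, ?_⟩
  rw [hasFiniteIntegral_iff_ofReal (.of_forall fun x => sq_nonneg _)]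
  calc ∫⁻ x, ENNReal.ofReal (f x ^ 2) ∂(μ : Measure α)
      ≤ liminf (fun n => ∫⁻ x, ENNReal.ofReal (f x ^ 2) ∂(μs n : Measure α)) atTop :=
        lintegral_le_liminf_lintegral_of_forall_isOpen_measure_le_liminf_measure (hf.pow 2)
          (fun x => sq_nonneg _)
          fun G hG => ProbabilityMeasure.le_liminf_measure_open_of_tendsto hμ hG
    _ ≤ ENNReal.ofReal M :=
        (liminf_le_liminf (.of_forall hbound)).trans_eq tendsto_const_nhds.liminf_eq
    _ < ⊤ := ENNReal.ofReal_lt_top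

/-- Truncation to the interval `[-R, R]`, for `R ≥ 0`. -/
def clip (R x : ℝ) : ℝ := max (-R) (min R x)

section Clip

variable {R : ℝ}

theorem continuous_clip (R : ℝ) : Continuous (clip R) := by
  unfold clip
  fun_prop

theorem abs_clip_le (hR : 0 ≤ R) (x : ℝ) : |clip R x| ≤ R :=
  abs_le.2 ⟨le_max_left _ _, max_le (by linarith) (min_le_left _ _)⟩

theorem clip_of_abs_le {x : ℝ} (hx : |x| ≤ R) : clip R x = x := by
  rw [abs_le] at hx
  rw [clip, min_eq_right hx.2, max_eq_right hx.1]

theorem abs_clip_le_abs (hR : 0 ≤ R) (x : ℝ) : |clip R x| ≤ |x| := by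
  rcases le_total |x| R with hx | hx
  · rw [clip_of_abs_le hx]
  · exact (abs_clip_le hR x).trans hx

theorem tendsto_clip_atTop (x : ℝ) : Tendsto (clip · x) atTop (𝓝 x) :=
  tendsto_const_nhds.congr' <| by
    filter_upwards [eventually_ge_atTop |x|] with R hR using (clip_of_abs_le hR).symm

variable {g : ℝ → ℝ}

theorem abs_comp_clip_le (hb : ∀ x, |g x| ≤ 1 + x ^ 2) (hR : 0 ≤ R) (x : ℝ) :
    |g (clip R x)| ≤ 1 + x ^ 2 :=
  (hb _).trans (add_le_add_right (sq_le_sq.2 (abs_clip_le_abs hR x)) 1)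

theorem abs_comp_clip_le_const (hb : ∀ x, |g x| ≤ 1 + x ^ 2) (hR : 0 ≤ R) (x : ℝ) :
    |g (clip R x)| ≤ 1 + R ^ 2 :=
  (hb _).trans (add_le_add_right (sq_le_sq' (neg_le_of_abs_le (abs_clip_le hR x))
    (le_of_abs_le (abs_clip_le hR x))) 1)

variable {μ : Measure ℝ} [IsFiniteMeasure μ]

theorem integrable_of_abs_le_one_add_sq (hμ : MemLp id 2 μ)
    (hg : AEStronglyMeasurable g μ) (hb : ∀ x, |g x| ≤ 1 + x ^ 2) : Integrable g μ :=
  ((integrable_const 1).add hμ.integrable_sq).mono' hg (.of_forall hb)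

theorem abs_integral_sub_integral_clip_le (hμ : MemLp id 2 μ) (hg : Continuous g)
    (hb : ∀ x, |g x| ≤ 1 + x ^ 2) (hR : 1 ≤ R) :
    |∫ x, g x ∂μ - ∫ x, g (clip R x) ∂μ| ≤ 4 * ∫ x in {x : ℝ | R ≤ |x|}, x ^ 2 ∂μ := by
  have hR0 : 0 ≤ R := zero_le_one.trans hR
  have hgi := integrable_of_abs_le_one_add_sq hμ hg.aestronglyMeasurable hb
  have hci : Integrable (fun x => g (clip R x)) μ := integrable_of_abs_le_one_add_sq hμ
    (hg.comp (continuous_clip R)).aestronglyMeasurable (abs_comp_clip_le hb hR0)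
  have hs : MeasurableSet {x : ℝ | R ≤ |x|} := measurableSet_le (by fun_prop) (by fun_prop)
  have hsq : Integrable (fun x : ℝ => x ^ 2) μ := hμ.integrable_sq
  rw [← integral_sub hgi hci, ← integral_const_mul, ← integral_indicator hs]
  refine abs_integral_le_integral_abs.trans
    (integral_mono (hgi.sub hci).abs ((hsq.const_mul 4).indicator hs) fun x => ?_)
  by_cases hx : R ≤ |x|
  · have h1 : 1 ≤ x ^ 2 := (one_le_sq_iff_one_le_abs x).2 (hR.trans hx)
    rw [Set.indicator_of_mem (by exact hx)]
    refine (abs_sub _ _).trans ?_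
    linarith [hb x, abs_comp_clip_le hb hR0 x]
  · rw [Set.indicator_of_notMem (by exact hx)]
    simp [clip_of_abs_le (not_le.1 hx).le]

theorem tendsto_integral_comp_clip (hμ : MemLp id 2 μ) (hg : Continuous g)
    (hb : ∀ x, |g x| ≤ 1 + x ^ 2) :
    Tendsto (fun R => ∫ x, g (clip R x) ∂μ) atTop (𝓝 (∫ x, g x ∂μ)) := by
  refine tendsto_integral_filter_of_dominated_convergence (fun x => 1 + x ^ 2)
    (.of_forall fun R => (hg.comp (continuous_clip R)).aestronglyMeasurable) ?_
    ((integrable_const 1).add hμ.integrable_sq)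
    (.of_forall fun x => (hg.tendsto x).comp (tendsto_clip_atTop x))
  filter_upwards [eventually_ge_atTop 0] with R hR
  exact .of_forall (abs_comp_clip_le hb hR)

end Clip

section SecondMoments

variable {ι : Type*} {l : Filter ι} {μs : ι → ProbabilityMeasure ℝ} {μ : ProbabilityMeasure ℝ}

theorem tendsto_integral_of_uniform_tail (hlim : Tendsto μs l (𝓝 μ))
    (hμs : ∀ i, MemLp id 2 (μs i : Measure ℝ)) (hμ : MemLp id 2 (μ : Measure ℝ))
    (htail : ∀ ε > 0, ∀ᶠ R in atTop, ∀ i,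
      ∫ x in {x : ℝ | R ≤ |x|}, x ^ 2 ∂(μs i : Measure ℝ) ≤ ε)
    {g : ℝ → ℝ} (hg : Continuous g) (hb : ∀ x, |g x| ≤ 1 + x ^ 2) :
    Tendsto (fun i => ∫ x, g x ∂(μs i : Measure ℝ)) l (𝓝 (∫ x, g x ∂(μ : Measure ℝ))) := by
  refine TendstoUniformly.tendsto_of_eventually_tendsto
    (F := fun R i => ∫ x, g (clip R x) ∂(μs i : Measure ℝ)) (p := atTop) ?_ ?_
    (tendsto_integral_comp_clip hμ hg hb)
  · refine Metric.tendstoUniformly_iff.2 fun ε hε => ?_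
    filter_upwards [htail (ε / 8) (by positivity), eventually_ge_atTop 1] with R htail hR i
    rw [Real.dist_eq]
    linarith [abs_integral_sub_integral_clip_le (hμs i) hg hb hR, htail i]
  · filter_upwards [eventually_ge_atTop 0] with R hR
    exact ProbabilityMeasure.tendsto_iff_forall_integral_tendsto.1 hlim
      (.ofNormedAddCommGroup (fun x => g (clip R x)) (hg.comp (continuous_clip R)) (1 + R ^ 2)
        (abs_comp_clip_le_const hb hR))

theorem MemClass.eventually_tail_le {ψ : ℝ → ℝ} (hψ : Tendsto ψ atTop (𝓝 0)) (V : ℝ) {ε : ℝ}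
    (hε : 0 < ε) : ∀ᶠ S in atTop, ∀ μ : Measure ℝ, MemClass ψ μ → variance id μ ≤ V →
      ∫ x in {x : ℝ | S ≤ |x|}, x ^ 2 ∂μ ≤ ε := by
  have hlim : Tendsto (fun R => V * |ψ R|) atTop (𝓝 0) := by
    simpa using hψ.abs.const_mul V
  obtain ⟨R, hR, hR0⟩ := ((hlim.eventually_le_const hε).and (eventually_ge_atTop 0)).exists
  filter_upwards [eventually_ge_atTop (R * √V)] with S hS μ hμ hV
  have hRS : R * √(variance id μ) ≤ S :=
    (mul_le_mul_of_nonneg_left (Real.sqrt_le_sqrt hV) hR0).trans hS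
  have hsub : {x : ℝ | S ≤ |x|} ⊆ {x : ℝ | R * √(variance id μ) ≤ |x|} := fun _ => hRS.trans
  calc ∫ x in {x : ℝ | S ≤ |x|}, x ^ 2 ∂μ
      ≤ ∫ x in {x : ℝ | R * √(variance id μ) ≤ |x|}, x ^ 2 ∂μ :=
        setIntegral_mono_set hμ.1.integrable_sq.integrableOn (.of_forall fun x => sq_nonneg _)
          hsub.eventuallyLE
    _ ≤ variance id μ * ψ R := hμ.2 R hR0
    _ ≤ variance id μ * |ψ R| := mul_le_mul_of_nonneg_left (le_abs_self _) (variance_nonneg id μ)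
    _ ≤ V * |ψ R| := mul_le_mul_of_nonneg_right hV (abs_nonneg _)
    _ ≤ ε := hR

theorem tendsto_variance_of_memClass {ψ : ℝ → ℝ} (hψ : Tendsto ψ atTop (𝓝 0))
    (hlim : Tendsto μs l (𝓝 μ)) (hμs : ∀ i, MemClass ψ (μs i : Measure ℝ)) {V : ℝ}
    (hV : ∀ i, variance id (μs i : Measure ℝ) ≤ V) (hμ : MemLp id 2 (μ : Measure ℝ)) :
    Tendsto (fun i => variance id (μs i : Measure ℝ)) l (𝓝 (variance id (μ : Measure ℝ))) := by
  have htail : ∀ ε > 0, ∀ᶠ R in atTop, ∀ i,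
      ∫ x in {x : ℝ | R ≤ |x|}, x ^ 2 ∂(μs i : Measure ℝ) ≤ ε := fun ε hε => by
    filter_upwards [MemClass.eventually_tail_le hψ V hε] with R hR i using hR _ (hμs i) (hV i)
  have hmean := tendsto_integral_of_uniform_tail hlim (fun i => (hμs i).1) hμ htail continuous_id
    fun x => by
      rw [id, ← sq_abs x]
      nlinarith [sq_nonneg (|x| - 1), abs_nonneg x]
  have hsq := tendsto_integral_of_uniform_tail hlim (fun i => (hμs i).1) hμ htail
    (continuous_pow 2) fun x => by
      rw [abs_of_nonneg (sq_nonneg x)]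
      linarith
  simp_rw [variance_eq_sub hμ, variance_eq_sub (hμs _).1]
  exact hsq.sub (hmean.pow 2)

theorem tendsto_stFisherInfo [l.IsCountablyGenerated] {τ : ℝ≥0} (hτ : 0 < τ) {ψ : ℝ → ℝ}
    (hψ : Tendsto ψ atTop (𝓝 0)) (hlim : Tendsto μs l (𝓝 μ))
    (hμs : ∀ i, MemLp id 2 (μs i : Measure ℝ)) (hμ : MemLp id 2 (μ : Measure ℝ))
    (hc : ∀ i, MemClass ψ ((μs i : Measure ℝ) ∗ gaussianReal 0 τ)) {K : ℝ}
    (hK : ∀ i, variance id (μs i : Measure ℝ) ≤ K) :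
    Tendsto (fun i => stFisherInfo ((μs i : Measure ℝ) ∗ gaussianReal 0 τ)) l
      (𝓝 (stFisherInfo ((μ : Measure ℝ) ∗ gaussianReal 0 τ))) := by
  let γ : ProbabilityMeasure ℝ := ⟨gaussianReal 0 τ, inferInstance⟩
  refine (Tendsto.mul ?_ (tendsto_fisherInfo hτ hlim)).sub_const 1
  refine tendsto_variance_of_memClass (V := K + τ) hψ
    (tendsto_conv hlim (tendsto_const_nhds (x := γ))) hc (fun i => ?_) (memLp_conv_gaussianReal hμ)
  exact (variance_conv_gaussianReal (hμs i)).trans_le (add_le_add_left (hK i) _)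

end SecondMoments

theorem isTightMeasureSet_of_integral_norm_sq_le {E : Type*} [NormedAddCommGroup E]
    [ProperSpace E] [MeasurableSpace E] [BorelSpace E] {S : Set (Measure E)} {K : ℝ}
    (hS : ∀ μ ∈ S, IsFiniteMeasure μ ∧ MemLp id 2 μ ∧ ∫ x, ‖x‖ ^ 2 ∂μ ≤ K) :
    IsTightMeasureSet S := by
  refine isTightMeasureSet_of_tendsto_measure_norm_gt ?_
  have hlim : Tendsto (fun r : ℝ => ENNReal.ofReal (K / r ^ 2)) atTop (𝓝 0) := by
    rw [← ENNReal.ofReal_zero]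
    exact ENNReal.tendsto_ofReal (tendsto_const_nhds.div_atTop (tendsto_pow_atTop two_ne_zero))
  refine tendsto_of_tendsto_of_tendsto_of_le_of_le' tendsto_const_nhds hlim
    (.of_forall fun _ => zero_le) ?_
  filter_upwards [eventually_gt_atTop 0] with r hr
  refine iSup₂_le fun μ hμ => ?_
  obtain ⟨_, hμ2, hK⟩ := hS μ hμ
  have hmarkov := mul_meas_ge_le_integral_of_nonneg
    (.of_forall fun x : E => sq_nonneg ‖x‖) hμ2.integrable_norm_pow' (r ^ 2)
  calc μ {x | r < ‖x‖} ≤ μ {x | r ^ 2 ≤ ‖x‖ ^ 2} :=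
        measure_mono (Set.ofPred_subset_ofPred.2 fun x hx => pow_le_pow_left₀ hr.le hx.le 2)
    _ ≤ ENNReal.ofReal (K / r ^ 2) := by
        rw [← ofReal_measureReal]
        refine ENNReal.ofReal_le_ofReal ?_
        rw [le_div_iff₀' (by positivity)]
        exact hmarkov.trans hK

/-! ### The score gap of independent random variables -/

section Independent

theorem measurePreserving_prodProdProdComm {E F G H : Type*} [MeasurableSpace E]
    [MeasurableSpace F] [MeasurableSpace G] [MeasurableSpace H] (μ : Measure E) (ν : Measure F)
    (κ : Measure G) (η : Measure H) [SFinite μ] [SFinite ν] [SFinite κ] [SFinite η] :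
    MeasurePreserving (fun q => ((q.1.1, q.2.1), q.1.2, q.2.2)) ((μ.prod ν).prod (κ.prod η))
      ((μ.prod κ).prod (ν.prod η)) := by
  have hinner := ((measurePreserving_prodAssoc κ ν η).comp
    (Measure.measurePreserving_swap.prod (.id η))).comp (measurePreserving_prodAssoc ν κ η).symm
  exact ((measurePreserving_prodAssoc μ κ (ν.prod η)).symm.comp
    ((MeasurePreserving.id μ).prod hinner)).comp (measurePreserving_prodAssoc μ ν (κ.prod η))

theorem integral_mul_linear {α : Type*} [MeasurableSpace α] {m : Measure α} {w u v : α → ℝ}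
    (hw : MemLp w 2 m) (hu : MemLp u 2 m) (hv : MemLp v 2 m) (a b : ℝ) :
    ∫ x, w x * (a * u x + b * v x) ∂m = a * ∫ x, w x * u x ∂m + b * ∫ x, w x * v x ∂m := by
  have hwu : Integrable (fun x => w x * u x) m := hw.integrable_mul hu
  have hwv : Integrable (fun x => w x * v x) m := hw.integrable_mul hv
  rw [← integral_const_mul, ← integral_const_mul,
    ← integral_add (hwu.const_mul _) (hwv.const_mul _)]
  exact integral_congr_ae (.of_forall fun x => by ring)

theorem measurePreserving_add_conv (μ ν : Measure ℝ) :
    MeasurePreserving (fun p : ℝ × ℝ => p.1 + p.2) (μ.prod ν) (μ ∗ ν) :=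
  ⟨by fun_prop, rfl⟩

variable {τ : ℝ≥0} (μ ν : Measure ℝ) [IsProbabilityMeasure μ] [IsProbabilityMeasure ν]

theorem perturb_prod (τ : ℝ≥0) :
    perturb τ (μ.prod ν) = (μ ∗ gaussianReal 0 τ).prod (ν ∗ gaussianReal 0 τ) :=
  (((measurePreserving_add_conv μ _).prod (measurePreserving_add_conv ν _)).comp
    (measurePreserving_prodProdProdComm μ ν _ _)).map_eq

theorem integral_mul_score_prod {E : Type*} [MeasurableSpace E] (κ : Measure E) [SFinite κ]
    (hτ : 0 < τ) {h : ℝ × E → ℝ}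
    (hscore : Integrable (fun p => h p * score (μ ∗ gaussianReal 0 τ) p.1)
      ((μ ∗ gaussianReal 0 τ).prod κ))
    (hnoise : Integrable (fun q => h (q.1.1 + q.1.2, q.2) * q.1.2)
      ((μ.prod (gaussianReal 0 τ)).prod κ)) :
    ∫ p, h p * score (μ ∗ gaussianReal 0 τ) p.1 ∂(μ ∗ gaussianReal 0 τ).prod κ
      = -(∫ q, h (q.1.1 + q.1.2, q.2) * q.1.2 ∂(μ.prod (gaussianReal 0 τ)).prod κ) / τ := by
  rw [integral_prod_symm _ hscore, integral_prod_symm _ hnoise, ← integral_neg, ← integral_div]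
  refine integral_congr_ae ?_
  filter_upwards [hnoise.prod_left_ae] with y hy
  exact integral_mul_score μ hτ hy

theorem memLp_score_fst_prod (hτ : 0 < τ) :
    MemLp (fun p => score (μ ∗ gaussianReal 0 τ) p.1) 2 (perturb τ (μ.prod ν)) := by
  rw [perturb_prod]
  exact (memLp_score μ hτ).comp_fst _

theorem memLp_score_snd_prod (hτ : 0 < τ) :
    MemLp (fun p => score (ν ∗ gaussianReal 0 τ) p.2) 2 (perturb τ (μ.prod ν)) := by
  rw [perturb_prod]
  exact (memLp_score ν hτ).comp_snd _

theorem integral_mul_score_fst (hτ : 0 < τ) {h : ℝ × ℝ → ℝ} (hcont : Continuous h)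
    (hh : MemLp h 2 (perturb τ (μ.prod ν))) :
    ∫ p, h p * score (μ ∗ gaussianReal 0 τ) p.1 ∂perturb τ (μ.prod ν)
      = -(∫ q, h (q.1 + q.2) * q.2.1
          ∂(μ.prod ν).prod ((gaussianReal 0 τ).prod (gaussianReal 0 τ))) / τ := by
  have hcomm := ((MeasurePreserving.id _).prod (measurePreserving_add_conv ν _)).comp
    (measurePreserving_prodProdProdComm μ ν (gaussianReal 0 τ) (gaussianReal 0 τ))
  have hscore := hh.integrable_mul (memLp_score_fst_prod μ ν hτ)
  have hnoise := (hh.comp_of_map (by fun_prop)).integrable_mul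
    (((memLp_two_gaussianReal τ).comp_fst (gaussianReal 0 τ)).comp_snd (μ.prod ν))
  rw [perturb_prod] at hscore ⊢
  rw [integral_mul_score_prod μ _ hτ hscore, ← hcomm.map_eq,
    integral_map (by fun_prop) (by fun_prop)]
  · rfl
  · rw [← hcomm.map_eq]
    exact (integrable_map_measure (by fun_prop) (by fun_prop)).2 hnoise

theorem integral_mul_score_snd (hτ : 0 < τ) {h : ℝ × ℝ → ℝ} (hcont : Continuous h)
    (hh : MemLp h 2 (perturb τ (μ.prod ν))) :
    ∫ p, h p * score (ν ∗ gaussianReal 0 τ) p.2 ∂perturb τ (μ.prod ν)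
      = -(∫ q, h (q.1 + q.2) * q.2.2
          ∂(μ.prod ν).prod ((gaussianReal 0 τ).prod (gaussianReal 0 τ))) / τ := by
  have hswap : MeasurePreserving Prod.swap (perturb τ (ν.prod μ)) (perturb τ (μ.prod ν)) := by
    simpa only [perturb_prod] using Measure.measurePreserving_swap
  have hnoise := (Measure.measurePreserving_swap (μ := ν) (ν := μ)).prod
    (Measure.measurePreserving_swap (μ := gaussianReal 0 τ) (ν := gaussianReal 0 τ))
  have hscore := continuous_score ν hτ
  have key := integral_mul_score_fst ν μ hτ (h := h ∘ Prod.swap) (by fun_prop)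
    (hh.comp_measurePreserving hswap)
  rw [← hswap.map_eq, ← hnoise.map_eq,
    integral_map (by fun_prop) (Continuous.aestronglyMeasurable (by fun_prop)),
    integral_map (by fun_prop) (by fun_prop)]
  exact key

theorem integral_comp_mul_score {μ : Measure (ℝ × ℝ)} [IsProbabilityMeasure μ] (hτ : 0 < τ)
    {L : ℝ × ℝ →L[ℝ] ℝ} (hL : L (1, 0) ^ 2 + L (0, 1) ^ 2 = 1) {g : ℝ → ℝ} (hcont : Continuous g)
    (hg : MemLp g 2 (μ.map L ∗ gaussianReal 0 τ)) :
    ∫ p, g (L p) * score (μ.map L ∗ gaussianReal 0 τ) (L p) ∂perturb τ μ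
      = -(∫ q, g (L (q.1 + q.2)) * L q.2
          ∂μ.prod ((gaussianReal 0 τ).prod (gaussianReal 0 τ))) / τ := by
  have hLmap : MeasurePreserving L ((gaussianReal 0 τ).prod (gaussianReal 0 τ))
      (gaussianReal 0 τ) :=
    ⟨by fun_prop, map_prod_gaussianReal τ hL⟩
  have hmap : MeasurePreserving L μ (μ.map L) := ⟨by fun_prop, rfl⟩
  have hpair := hmap.prod hLmap
  have hscore := continuous_score (μ.map L) hτ
  have hnoise : Integrable (fun p : ℝ × ℝ => g (p.1 + p.2) * p.2)
      ((μ.map L).prod (gaussianReal 0 τ)) :=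
    (hg.comp_measurePreserving (measurePreserving_add_conv _ _)).integrable_mul
      ((memLp_two_gaussianReal τ).comp_snd _)
  have key := integral_mul_score (μ.map L) hτ hnoise
  rw [← hpair.map_eq, integral_map (by fun_prop) (by fun_prop)] at key
  simp_rw [map_add]
  refine Eq.trans ?_ key
  rw [← perturb_map μ τ hL] at hscore ⊢
  exact (integral_map (by fun_prop) (hcont.mul hscore).aestronglyMeasurable).symm

variable {β : ℝ}

theorem integral_score_linComb_mul_add (hτ : 0 < τ) (hβ : β ∈ Set.Icc (0 : ℝ) 1) :
    ∫ p, score ((μ.prod ν).map (linComb β) ∗ gaussianReal 0 τ) (linComb β p)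
        * (√β * score (μ ∗ gaussianReal 0 τ) p.1 + √(1 - β) * score (ν ∗ gaussianReal 0 τ) p.2)
        ∂perturb τ (μ.prod ν)
      = fisherInfo ((μ.prod ν).map (linComb β) ∗ gaussianReal 0 τ) := by
  let γ := (gaussianReal 0 τ).prod (gaussianReal 0 τ)
  let g := score ((μ.prod ν).map (linComb β) ∗ gaussianReal 0 τ)
  have hg : Continuous g := continuous_score _ hτ
  have hL := linComb_sq_add_sq hβ
  have hW : MemLp (fun p => g (linComb β p)) 2 (perturb τ (μ.prod ν)) := memLp_score_comp _ hτ hL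
  have hWγ : MemLp (fun q => g (linComb β (q.1 + q.2))) 2 ((μ.prod ν).prod γ) :=
    hW.comp_of_map (by fun_prop)
  calc _ = -(√β * (∫ q, g (linComb β (q.1 + q.2)) * q.2.1 ∂(μ.prod ν).prod γ)
        + √(1 - β) * ∫ q, g (linComb β (q.1 + q.2)) * q.2.2 ∂(μ.prod ν).prod γ) / τ := by
        rw [integral_mul_linear hW (memLp_score_fst_prod μ ν hτ) (memLp_score_snd_prod μ ν hτ),
          integral_mul_score_fst μ ν hτ (by fun_prop) hW,
          integral_mul_score_snd μ ν hτ (by fun_prop) hW]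
        ring
    _ = -(∫ q, g (linComb β (q.1 + q.2)) * linComb β q.2 ∂(μ.prod ν).prod γ) / τ := by
        congr 2
        exact (integral_mul_linear hWγ (((memLp_two_gaussianReal τ).comp_fst _).comp_snd _)
          (((memLp_two_gaussianReal τ).comp_snd _).comp_snd _) _ _).symm
    _ = _ := by
        rw [← integral_comp_mul_score hτ hL hg (memLp_score _ hτ),
          ← integral_score_comp_sq _ hτ hL]
        simp_rw [sq]
        rfl

theorem integral_scoreSum_sq (hτ : 0 < τ) (hβ : β ∈ Set.Icc (0 : ℝ) 1) :
    ∫ p, (√β * score (μ ∗ gaussianReal 0 τ) p.1 + √(1 - β) * score (ν ∗ gaussianReal 0 τ) p.2) ^ 2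
        ∂perturb τ (μ.prod ν)
      = β * fisherInfo (μ ∗ gaussianReal 0 τ) + (1 - β) * fisherInfo (ν ∗ gaussianReal 0 τ) := by
  let u (p : ℝ × ℝ) : ℝ := score (μ ∗ gaussianReal 0 τ) p.1
  let v (p : ℝ × ℝ) : ℝ := score (ν ∗ gaussianReal 0 τ) p.2
  have hu : MemLp u 2 (perturb τ (μ.prod ν)) := memLp_score_fst_prod μ ν hτ
  have hv : MemLp v 2 (perturb τ (μ.prod ν)) := memLp_score_snd_prod μ ν hτ
  have hcross : ∫ p, u p * v p ∂perturb τ (μ.prod ν) = 0 := by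
    rw [perturb_prod, integral_prod_mul, integral_score μ hτ, zero_mul]
  have hu_sq : ∫ p, u p ^ 2 ∂perturb τ (μ.prod ν) = fisherInfo (μ ∗ gaussianReal 0 τ) := by
    rw [perturb_prod, integral_fun_fst (fun x => score (μ ∗ gaussianReal 0 τ) x ^ 2),
      probReal_univ, one_smul, fisherInfo]
  have hv_sq : ∫ p, v p ^ 2 ∂perturb τ (μ.prod ν) = fisherInfo (ν ∗ gaussianReal 0 τ) := by
    rw [perturb_prod, integral_fun_snd (fun x => score (ν ∗ gaussianReal 0 τ) x ^ 2),
      probReal_univ, one_smul, fisherInfo]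
  calc ∫ p, (√β * u p + √(1 - β) * v p) ^ 2 ∂perturb τ (μ.prod ν)
      = √β * ∫ p, u p * (√β * u p + √(1 - β) * v p) ∂perturb τ (μ.prod ν)
        + √(1 - β) * ∫ p, v p * (√β * u p + √(1 - β) * v p) ∂perturb τ (μ.prod ν) := by
        simp_rw [sq, mul_comm (u _) (_ + _), mul_comm (v _) (_ + _)]
        exact integral_mul_linear ((hu.const_mul _).add (hv.const_mul _)) hu hv _ _
    _ = √β ^ 2 * ∫ p, u p ^ 2 ∂perturb τ (μ.prod ν)
        + √(1 - β) ^ 2 * ∫ p, v p ^ 2 ∂perturb τ (μ.prod ν) := by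
        rw [integral_mul_linear hu hu hv, integral_mul_linear hv hu hv]
        simp_rw [mul_comm (v _) (u _), hcross, sq]
        ring
    _ = _ := by
        rw [hu_sq, hv_sq, Real.sq_sqrt hβ.1, Real.sq_sqrt (sub_nonneg.2 hβ.2)]

theorem scoreGap_perturb_prod (hτ : 0 < τ) (hβ : β ∈ Set.Icc (0 : ℝ) 1) :
    scoreGap (perturb τ (μ.prod ν)) β
      = β * fisherInfo (μ ∗ gaussianReal 0 τ) + (1 - β) * fisherInfo (ν ∗ gaussianReal 0 τ)
        - fisherInfo ((μ.prod ν).map (linComb β) ∗ gaussianReal 0 τ) := by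
  let A (p : ℝ × ℝ) : ℝ :=
    √β * score (μ ∗ gaussianReal 0 τ) p.1 + √(1 - β) * score (ν ∗ gaussianReal 0 τ) p.2
  let W (p : ℝ × ℝ) : ℝ :=
    score ((μ.prod ν).map (linComb β) ∗ gaussianReal 0 τ) (linComb β p)
  have hA : MemLp A 2 (perturb τ (μ.prod ν)) :=
    ((memLp_score_fst_prod μ ν hτ).const_mul _).add ((memLp_score_snd_prod μ ν hτ).const_mul _)
  have hW : MemLp W 2 (perturb τ (μ.prod ν)) := memLp_score_comp _ hτ (linComb_sq_add_sq hβ)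
  have hgap (p : ℝ × ℝ) : gapFun τ (μ.prod ν) β p ^ 2 = A p ^ 2 - 2 * (W p * A p) + W p ^ 2 := by
    simp only [gapFun, Measure.map_fst_prod, Measure.map_snd_prod, measure_univ, one_smul]
    ring
  have hWA : Integrable (fun p => 2 * (W p * A p)) (perturb τ (μ.prod ν)) :=
    (hW.integrable_mul hA).const_mul 2
  have hdiff : Integrable (fun p => A p ^ 2 - 2 * (W p * A p)) (perturb τ (μ.prod ν)) :=
    hA.integrable_sq.sub hWA
  rw [scoreGap_perturb _ _ hβ]
  simp_rw [hgap]
  rw [integral_add hdiff hW.integrable_sq, integral_sub hA.integrable_sq hWA, integral_const_mul,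
    integral_scoreSum_sq μ ν hτ hβ, integral_score_linComb_mul_add μ ν hτ hβ,
    integral_score_comp_sq _ hτ (linComb_sq_add_sq hβ)]
  ring

theorem variance_map_linComb_prod (hμ : MemLp id 2 μ) (hν : MemLp id 2 ν)
    (hβ : β ∈ Set.Icc (0 : ℝ) 1) :
    variance id ((μ.prod ν).map (linComb β)) = β * variance id μ + (1 - β) * variance id ν := by
  rw [variance_id_map (by fun_prop)]
  refine (variance_add_prod (hμ.const_mul √β) (hν.const_mul √(1 - β))).trans ?_
  rw [variance_const_mul, variance_const_mul, Real.sq_sqrt hβ.1, Real.sq_sqrt (sub_nonneg.2 hβ.2)]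

theorem scoreGap_perturb_prod_self_le (hτ : 0 < τ) (hμ : MemLp id 2 μ)
    (hβ : β ∈ Set.Icc (0 : ℝ) 1) :
    scoreGap (perturb τ (μ.prod μ)) β ≤ stFisherInfo (μ ∗ gaussianReal 0 τ) / τ := by
  have hσ := variance_conv_gaussianReal_pos hτ hμ
  have hσ_ge : (τ : ℝ) ≤ variance id (μ ∗ gaussianReal 0 τ) := by
    rw [variance_conv_gaussianReal hμ]
    exact le_add_of_nonneg_left (variance_nonneg _ _)
  have hW : MemLp id 2 ((μ.prod μ).map (linComb β)) :=
    (memLp_map_measure_iff (by fun_prop) (by fun_prop)).2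
      (((hμ.comp_fst μ).const_mul _).add ((hμ.comp_snd μ).const_mul _))
  have hW_var : variance id ((μ.prod μ).map (linComb β) ∗ gaussianReal 0 τ)
      = variance id (μ ∗ gaussianReal 0 τ) := by
    rw [variance_conv_gaussianReal hW, variance_map_linComb_prod μ μ hμ hμ hβ,
      variance_conv_gaussianReal hμ]
    ring
  have hcramerRao := stFisherInfo_nonneg hτ hW
  rw [stFisherInfo, hW_var] at hcramerRao
  calc scoreGap (perturb τ (μ.prod μ)) β
      ≤ stFisherInfo (μ ∗ gaussianReal 0 τ) / variance id (μ ∗ gaussianReal 0 τ) := by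
        rw [scoreGap_perturb_prod μ μ hτ hβ, stFisherInfo, le_div_iff₀ hσ]
        linarith
    _ ≤ stFisherInfo (μ ∗ gaussianReal 0 τ) / τ := by
        have := stFisherInfo_nonneg hτ hμ
        gcongr

end Independent

/-! ### Existence of a modulus -/

theorem affine_of_add_eq_comp_add {f g h : ℝ → ℝ} (hf : Continuous f) {a b : ℝ} (ha : a ≠ 0)
    (hb : b ≠ 0) (H : ∀ x y, a * f x + b * g y = h (a * x + b * y)) :
    ∃ c e, ∀ x, f x = c * x + e := by
  let F (u : ℝ) : ℝ := a * f (u / a)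
  have hpexider (u v : ℝ) : F u + b * g (v / b) = h (u + v) := by
    simpa only [mul_div_cancel₀ _ ha, mul_div_cancel₀ _ hb] using H (u / a) (v / b)
  have hadd (u v : ℝ) : F (u + v) - F 0 = (F u - F 0) + (F v - F 0) := by
    have h1 := hpexider (u + v) 0
    have h2 := hpexider 0 v
    have h3 := hpexider v 0
    rw [add_zero] at h1 h3
    rw [zero_add] at h2
    linarith [hpexider u v]
  let L : ℝ →+ ℝ := ⟨⟨fun u => F u - F 0, sub_self _⟩, hadd⟩
  have hL : Continuous L :=
    (continuous_const.mul (hf.comp (continuous_id.div_const a))).sub continuous_const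
  refine ⟨L 1, F 0 / a, fun x => mul_left_cancel₀ ha ?_⟩
  have hlin : L (a * x) = a * x * L 1 := by simpa using map_real_smul L hL (a * x) 1
  have hfx : L (a * x) = a * f x - F 0 := by
    change a * f (a * x / a) - F 0 = _
    rw [mul_div_cancel_left₀ _ ha]
  rw [mul_add, mul_div_cancel₀ _ ha]
  linarith

theorem stFisherInfo_eq_zero_of_scoreGap_eq_zero {τ : ℝ≥0} (hτ : 0 < τ) {μ : Measure (ℝ × ℝ)}
    [IsProbabilityMeasure μ] (hμ : MemLp id 2 (μ.map Prod.fst)) {β : ℝ}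
    (hβ : β ∈ Set.Ioo (0 : ℝ) 1) (h : scoreGap (perturb τ μ) β = 0) :
    stFisherInfo (μ.map Prod.fst ∗ gaussianReal 0 τ) = 0 := by
  have hgap := gapFun_eq_zero_of_scoreGap_eq_zero hτ (Set.Ioo_subset_Icc_self hβ) h
  obtain ⟨a, b, hab⟩ := affine_of_add_eq_comp_add (continuous_score (μ.map Prod.fst) hτ)
    (Real.sqrt_pos.2 hβ.1).ne' (Real.sqrt_pos.2 (sub_pos.2 hβ.2)).ne'
    fun x y => sub_eq_zero.1 (congrFun hgap (x, y))
  exact stFisherInfo_eq_zero_of_affine hτ hμ hab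

theorem mul_one_sub_mul_stFisherInfo_eq_zero {τ : ℝ≥0} (hτ : 0 < τ) {μ : Measure (ℝ × ℝ)}
    [IsProbabilityMeasure μ] (hμ : MemLp id 2 (μ.map Prod.fst)) {β : ℝ}
    (hβ : β ∈ Set.Icc (0 : ℝ) 1) (h : scoreGap (perturb τ μ) β = 0) :
    β * (1 - β) * stFisherInfo (μ.map Prod.fst ∗ gaussianReal 0 τ) = 0 := by
  rcases Set.eq_endpoints_or_mem_Ioo_of_mem_Icc hβ with rfl | rfl | hβ
  · rw [zero_mul, zero_mul]
  · rw [sub_self, mul_zero, zero_mul]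
  · rw [stFisherInfo_eq_zero_of_scoreGap_eq_zero hτ hμ hβ h, mul_zero]

/-- The joint laws `μ` of pairs `(S, T)` that are tested in the definition of a modulus. -/
structure IsTestLaw (ψ : ℝ → ℝ) (τ : ℝ≥0) (K : ℝ) (μ : Measure (ℝ × ℝ)) : Prop where
  isProbabilityMeasure : IsProbabilityMeasure μ
  memLp_fst : MemLp Prod.fst 2 μ
  memLp_snd : MemLp Prod.snd 2 μ
  integral_fst : ∫ p, p.1 ∂μ = 0
  integral_snd : ∫ p, p.2 ∂μ = 0
  variance_fst : variance Prod.fst μ ≤ K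
  variance_snd : variance Prod.snd μ ≤ K
  memClass_fst : MemClass ψ ((perturb τ μ).map Prod.fst)
  memClass_snd : MemClass ψ ((perturb τ μ).map Prod.snd)

section TestLaw

variable {ψ ν : ℝ → ℝ} {τ : ℝ≥0} {K : ℝ} {μ : Measure (ℝ × ℝ)}

theorem IsModulus.mul_stFisherInfo_le (hν : IsModulus ψ τ K ν) (hμ : IsTestLaw ψ τ K μ) {β : ℝ}
    (hβ : β ∈ Set.Icc (0 : ℝ) 1) :
    β * (1 - β) * stFisherInfo ((perturb τ μ).map Prod.fst) ≤ ν (scoreGap (perturb τ μ) β) :=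
  hν.le_apply μ hμ.1 hμ.2 hμ.3 hμ.4 hμ.5 hμ.6 hμ.7 hμ.8 hμ.9 β hβ

namespace IsTestLaw

theorem memLp_map_fst (h : IsTestLaw ψ τ K μ) : MemLp id 2 (μ.map Prod.fst) :=
  (memLp_map_measure_iff (by fun_prop) (by fun_prop)).2 h.memLp_fst

theorem memLp_map_snd (h : IsTestLaw ψ τ K μ) : MemLp id 2 (μ.map Prod.snd) :=
  (memLp_map_measure_iff (by fun_prop) (by fun_prop)).2 h.memLp_snd

theorem variance_map_fst (h : IsTestLaw ψ τ K μ) : variance id (μ.map Prod.fst) ≤ K :=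
  (variance_map (by fun_prop) (by fun_prop)).trans_le h.variance_fst

theorem integral_fst_sq_le (h : IsTestLaw ψ τ K μ) : ∫ p, p.1 ^ 2 ∂μ ≤ K :=
  (variance_of_integral_eq_zero (by fun_prop) h.integral_fst).symm.trans_le h.variance_fst

theorem integral_snd_sq_le (h : IsTestLaw ψ τ K μ) : ∫ p, p.2 ^ 2 ∂μ ≤ K :=
  (variance_of_integral_eq_zero (by fun_prop) h.integral_snd).symm.trans_le h.variance_snd

theorem stFisherInfo_nonneg (hτ : 0 < τ) (h : IsTestLaw ψ τ K μ) :
    0 ≤ stFisherInfo ((perturb τ μ).map Prod.fst) := by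
  have := h.isProbabilityMeasure
  rw [perturb_map_fst]
  exact FKG.stFisherInfo_nonneg hτ h.memLp_map_fst

theorem stFisherInfo_le (hτ : 0 < τ) (h : IsTestLaw ψ τ K μ) :
    stFisherInfo ((perturb τ μ).map Prod.fst) ≤ K / τ := by
  have := h.isProbabilityMeasure
  rw [perturb_map_fst]
  exact (FKG.stFisherInfo_le hτ h.memLp_map_fst).trans (by gcongr; exact h.variance_map_fst)

theorem mul_stFisherInfo_le (hτ : 0 < τ) (h : IsTestLaw ψ τ K μ) (β : ℝ) :
    β * (1 - β) * stFisherInfo ((perturb τ μ).map Prod.fst) ≤ K / τ := by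
  have hβ1 : β * (1 - β) ≤ 1 := by nlinarith [sq_nonneg (β - 1 / 2)]
  exact (mul_le_of_le_one_left (h.stFisherInfo_nonneg hτ) hβ1).trans (h.stFisherInfo_le hτ)

theorem isTightMeasureSet_setOf (ψ : ℝ → ℝ) (τ : ℝ≥0) (K : ℝ) :
    IsTightMeasureSet {μ | IsTestLaw ψ τ K μ} := by
  refine IsTightMeasureSet.prodMk ?_ ?_ <;>
    refine isTightMeasureSet_of_integral_norm_sq_le (K := K) ?_ <;>
    rintro _ ⟨μ, hμ, rfl⟩ <;>
    have := hμ.isProbabilityMeasure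
  · refine ⟨inferInstance, hμ.memLp_map_fst, ?_⟩
    simp_rw [Real.norm_eq_abs, sq_abs]
    rw [Measure.fst, integral_map (by fun_prop) (by fun_prop)]
    exact hμ.integral_fst_sq_le
  · refine ⟨inferInstance, hμ.memLp_map_snd, ?_⟩
    simp_rw [Real.norm_eq_abs, sq_abs]
    rw [Measure.snd, integral_map (by fun_prop) (by fun_prop)]
    exact hμ.integral_snd_sq_le

theorem exists_tendsto_subseq {κs : ℕ → ProbabilityMeasure (ℝ × ℝ)}
    (hκs : ∀ n, IsTestLaw ψ τ K (κs n : Measure (ℝ × ℝ))) {βs : ℕ → ℝ}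
    (hβs : ∀ n, βs n ∈ Set.Icc (0 : ℝ) 1) :
    ∃ (κ : ProbabilityMeasure (ℝ × ℝ)) (β : ℝ) (φ : ℕ → ℕ), β ∈ Set.Icc (0 : ℝ) 1 ∧
      StrictMono φ ∧ Tendsto (κs ∘ φ) atTop (𝓝 κ) ∧ Tendsto (βs ∘ φ) atTop (𝓝 β) := by
  have hcompact : IsCompact (closure (Set.range κs)) := by
    refine isCompact_closure_of_isTightMeasureSet ((isTightMeasureSet_setOf ψ τ K).subset ?_)
    rintro _ ⟨_, ⟨n, rfl⟩, rfl⟩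
    exact hκs n
  obtain ⟨⟨κ, β⟩, ⟨-, hβ⟩, φ, hφ, hlim⟩ := (hcompact.prod isCompact_Icc).tendsto_subseq
    (x := fun n => (κs n, βs n)) fun n => ⟨subset_closure ⟨n, rfl⟩, hβs n⟩
  exact ⟨κ, β, φ, hβ, hφ, hlim.fst_nhds, hlim.snd_nhds⟩

section Limit

variable {κs : ℕ → ProbabilityMeasure (ℝ × ℝ)} {κ : ProbabilityMeasure (ℝ × ℝ)}

theorem memLp_map_fst_of_tendsto (hκs : ∀ n, IsTestLaw ψ τ K (κs n : Measure (ℝ × ℝ)))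
    (hlim : Tendsto κs atTop (𝓝 κ)) : MemLp id 2 ((κ : Measure (ℝ × ℝ)).map Prod.fst) :=
  (memLp_map_measure_iff (by fun_prop) (by fun_prop)).2 <|
    memLp_two_of_tendsto hlim continuous_fst (fun n => (hκs n).memLp_fst)
      fun n => (hκs n).integral_fst_sq_le

theorem tendsto_stFisherInfo (hτ : 0 < τ) (hψ : Tendsto ψ atTop (𝓝 0))
    (hκs : ∀ n, IsTestLaw ψ τ K (κs n : Measure (ℝ × ℝ))) (hlim : Tendsto κs atTop (𝓝 κ)) :
    Tendsto (fun n => stFisherInfo ((perturb τ (κs n : Measure (ℝ × ℝ))).map Prod.fst)) atTop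
      (𝓝 (stFisherInfo ((κ : Measure (ℝ × ℝ)).map Prod.fst ∗ gaussianReal 0 τ))) := by
  simp_rw [perturb_map_fst]
  have hmap := ProbabilityMeasure.tendsto_map_of_tendsto_of_continuous _ _ hlim continuous_fst
  have hclass (n : ℕ) : MemClass ψ
      ((κs n).map continuous_fst.measurable.aemeasurable ∗ gaussianReal 0 τ : Measure ℝ) := by
    rw [ProbabilityMeasure.toMeasure_map, ← perturb_map_fst]
    exact (hκs n).memClass_fst
  have h := FKG.tendsto_stFisherInfo hτ hψ hmap (fun n => (hκs n).memLp_map_fst)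
    (memLp_map_fst_of_tendsto hκs hlim) hclass fun n => (hκs n).variance_map_fst
  simpa only [ProbabilityMeasure.toMeasure_map, ← perturb_map_fst] using h

end Limit

theorem exists_scoreGap_bound (hτ : 0 < τ) (hψ : Tendsto ψ atTop (𝓝 0)) (K : ℝ) {c : ℝ}
    (hc : 0 < c) : ∃ ε > 0, ∀ μ : Measure (ℝ × ℝ), IsTestLaw ψ τ K μ →
      ∀ β ∈ Set.Icc (0 : ℝ) 1, scoreGap (perturb τ μ) β ≤ ε →
        β * (1 - β) * stFisherInfo ((perturb τ μ).map Prod.fst) ≤ c := by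
  by_contra! hcon
  choose μs hμs βs hβs hgap hlt using fun n : ℕ => hcon (1 / ((n : ℝ) + 1)) (by positivity)
  let κs (n : ℕ) : ProbabilityMeasure (ℝ × ℝ) := ⟨μs n, (hμs n).isProbabilityMeasure⟩
  obtain ⟨κ, β, φ, hβ, hφ, hκlim, hβlim⟩ := exists_tendsto_subseq (κs := κs) hμs hβs
  have hgaplim : Tendsto (fun n => scoreGap (perturb τ (κs n : Measure (ℝ × ℝ))) (βs n))
      atTop (𝓝 0) :=
    squeeze_zero (fun n => scoreGap_nonneg _ _) hgap tendsto_one_div_add_atTop_nhds_zero_nat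
  have hzero := scoreGap_eq_zero_of_tendsto hτ hκlim (fun n => hβs (φ n)) hβlim
    (hgaplim.comp hφ.tendsto_atTop)
  have hJ := (hβlim.mul (hβlim.const_sub 1)).mul
    (tendsto_stFisherInfo hτ hψ (fun n => hμs (φ n)) hκlim)
  rw [mul_one_sub_mul_stFisherInfo_eq_zero hτ
    (memLp_map_fst_of_tendsto (fun n => hμs (φ n)) hκlim) hβ hzero] at hJ
  exact hc.not_ge (ge_of_tendsto' hJ fun n => (hlt (φ n)).le)

end IsTestLaw

/-- The smallest increasing admissible function `ν`. When no test law has score gap at most `ε`, the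
supremum over the empty set is `0`. -/
def leastModulus (ψ : ℝ → ℝ) (τ : ℝ≥0) (K ε : ℝ) : ℝ :=
  sSup {y | ∃ (μ : Measure (ℝ × ℝ)) (β : ℝ), IsTestLaw ψ τ K μ ∧ β ∈ Set.Icc (0 : ℝ) 1 ∧
    scoreGap (perturb τ μ) β ≤ ε ∧
      β * (1 - β) * stFisherInfo ((perturb τ μ).map Prod.fst) = y}

theorem isModulus_leastModulus (hτ : 0 < τ) (hψ : Tendsto ψ atTop (𝓝 0)) (K : ℝ) :
    IsModulus ψ τ K (leastModulus ψ τ K) where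
  tendsto_zero := by
    have hnonneg (ε : ℝ) : 0 ≤ leastModulus ψ τ K ε := by
      refine Real.sSup_nonneg ?_
      rintro _ ⟨μ, β, hμ, hβ, -, rfl⟩
      exact mul_nonneg (mul_nonneg hβ.1 (sub_nonneg.2 hβ.2)) (hμ.stFisherInfo_nonneg hτ)
    refine tendsto_order.2 ⟨fun c hc => .of_forall fun ε => hc.trans_le (hnonneg ε),
      fun c hc => ?_⟩
    obtain ⟨ε, hε, h⟩ := IsTestLaw.exists_scoreGap_bound hτ hψ K (half_pos hc)
    filter_upwards [nhdsWithin_le_nhds (Iio_mem_nhds hε)] with x hx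
    refine (Real.sSup_le ?_ (half_pos hc).le).trans_lt (half_lt_self hc)
    rintro _ ⟨μ, β, hμ, hβ, hgap, rfl⟩
    exact h μ hμ β hβ (hgap.trans (le_of_lt hx))
  le_apply μ h1 h2 h3 h4 h5 h6 h7 h8 h9 β hβ := by
    refine le_csSup ⟨K / τ, ?_⟩ ⟨μ, β, ⟨h1, h2, h3, h4, h5, h6, h7, h8, h9⟩, hβ, le_rfl, rfl⟩
    rintro _ ⟨μ, β, hμ, -, -, rfl⟩
    exact hμ.mul_stFisherInfo_le hτ β

theorem genInv_le {y ε : ℝ} (hε : 0 ≤ ε) (h : y ≤ ν ε) : genInv ν y ≤ ε :=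
  csInf_le ⟨0, fun _ hx => hx.1⟩ ⟨hε, h⟩

theorem isTestLaw_prod {μ : Measure ℝ} [IsProbabilityMeasure μ] (hμ : MemLp id 2 μ)
    (hmean : ∫ x, x ∂μ = 0) (hvar : variance id μ ≤ K)
    (hclass : MemClass ψ (μ ∗ gaussianReal 0 τ)) : IsTestLaw ψ τ K (μ.prod μ) where
  isProbabilityMeasure := inferInstance
  memLp_fst := hμ.comp_fst μ
  memLp_snd := hμ.comp_snd μ
  integral_fst := by rw [integral_fun_fst (fun x : ℝ => x), hmean, smul_zero]
  integral_snd := by rw [integral_fun_snd (fun x : ℝ => x), hmean, smul_zero]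
  variance_fst := by
    refine le_of_eq_of_le ?_ hvar
    rw [← variance_id_map (by fun_prop), Measure.map_fst_prod, measure_univ, one_smul]
  variance_snd := by
    refine le_of_eq_of_le ?_ hvar
    rw [← variance_id_map (by fun_prop), Measure.map_snd_prod, measure_univ, one_smul]
  memClass_fst := by rwa [perturb_map_fst, Measure.map_fst_prod, measure_univ, one_smul]
  memClass_snd := by rwa [perturb_map_snd, Measure.map_snd_prod, measure_univ, one_smul]

theorem IsModulus.genInv_mul_stFisherInfo_le (hτ : 0 < τ) (hν : IsModulus ψ τ K ν)
    {μ : Measure ℝ} [IsProbabilityMeasure μ] (hμ : MemLp id 2 μ) (hmean : ∫ x, x ∂μ = 0)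
    (hvar : variance id μ ≤ K) (hclass : MemClass ψ (μ ∗ gaussianReal 0 τ)) {β : ℝ}
    (hβ : β ∈ Set.Icc (0 : ℝ) 1) :
    genInv ν (β * (1 - β) * stFisherInfo (μ ∗ gaussianReal 0 τ))
      ≤ stFisherInfo (μ ∗ gaussianReal 0 τ) / τ := by
  have h := hν.mul_stFisherInfo_le (isTestLaw_prod hμ hmean hvar hclass) hβ
  rw [perturb_map_fst, Measure.map_fst_prod, measure_univ, one_smul] at h
  exact (genInv_le (scoreGap_nonneg _ _) h).trans (scoreGap_perturb_prod_self_le μ hτ hμ hβ)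

end TestLaw

/-! ### Comparison of characteristic functions with normal ones -/

/-- The distance at `t` between the characteristic function of a law and that of the centred normal
law with the same variance. -/
def charFunDefect (μ : Measure ℝ) (t : ℝ) : ℝ :=
  ‖charFun μ t - (Real.exp (-(t ^ 2 * variance id μ / 2)) : ℝ)‖

theorem charFunDefect_nonneg (μ : Measure ℝ) (t : ℝ) : 0 ≤ charFunDefect μ t := norm_nonneg _

theorem charFunDefect_map_mul (μ : Measure ℝ) (a t : ℝ) :
    charFunDefect (μ.map (a * ·)) t = charFunDefect μ (a * t) := by
  have hvar : variance id (μ.map (a * ·)) = a ^ 2 * variance id μ := by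
    rw [variance_id_map (by fun_prop), variance_const_mul]
    rfl
  rw [charFunDefect, charFunDefect, charFun_map_mul, hvar]
  ring_nf

theorem charFunDefect_conv_gaussianReal {μ : Measure ℝ} [IsProbabilityMeasure μ]
    (hμ : MemLp id 2 μ) (τ : ℝ≥0) (t : ℝ) :
    charFunDefect (μ ∗ gaussianReal 0 τ) t
      = charFunDefect μ t * Real.exp (-(t ^ 2 * τ / 2)) := by
  have hnormal : charFun (gaussianReal 0 τ) t = (Real.exp (-(t ^ 2 * τ / 2)) : ℝ) := by
    rw [charFun_gaussianReal]
    push_cast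
    ring_nf
  have hexp : Real.exp (-(t ^ 2 * (variance id μ + τ) / 2))
      = Real.exp (-(t ^ 2 * variance id μ / 2)) * Real.exp (-(t ^ 2 * τ / 2)) := by
    rw [← Real.exp_add]
    ring_nf
  rw [charFunDefect, charFunDefect, charFun_conv, variance_conv_gaussianReal hμ, hexp, hnormal,
    Complex.ofReal_mul, ← sub_mul, norm_mul, Complex.norm_of_nonneg (Real.exp_nonneg _)]

theorem norm_exp_mul_I_sub_taylor_le_cube {y : ℝ} (hy : |y| ≤ 1) :
    ‖Complex.exp (y * Complex.I) - (1 + y * Complex.I - (y : ℂ) ^ 2 / 2)‖ ≤ |y| ^ 3 := by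
  have hnorm : ‖(y : ℂ) * Complex.I‖ = |y| := by simp
  have hbound := Complex.exp_bound (hnorm.trans_le hy) (n := 3) (by norm_num)
  have htaylor : ∑ m ∈ Finset.range 3, ((y : ℂ) * Complex.I) ^ m / (m.factorial : ℂ)
      = 1 + y * Complex.I - (y : ℂ) ^ 2 / 2 := by
    simp [Finset.sum_range_succ, mul_pow, Nat.factorial]
    ring
  rw [hnorm, htaylor] at hbound
  refine hbound.trans (mul_le_of_le_one_right (by positivity) ?_)
  norm_num [Nat.factorial]

theorem norm_exp_mul_I_sub_taylor_le_sq (y : ℝ) :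
    ‖Complex.exp (y * Complex.I) - (1 + y * Complex.I - (y : ℂ) ^ 2 / 2)‖ ≤ 4 * y ^ 2 := by
  rcases le_total |y| 1 with hy | hy
  · refine (norm_exp_mul_I_sub_taylor_le_cube hy).trans ?_
    rw [← sq_abs y]
    nlinarith [abs_nonneg y, sq_nonneg |y|]
  · calc _ ≤ ‖Complex.exp (y * Complex.I)‖ + (‖(1 : ℂ)‖ + ‖(y : ℂ) * Complex.I‖
          + ‖(y : ℂ) ^ 2 / 2‖) :=
          norm_sub_le_of_le le_rfl (norm_sub_le_of_le (norm_add_le _ _) le_rfl)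
      _ = 2 + |y| + y ^ 2 / 2 := by
          rw [Complex.norm_exp_ofReal_mul_I]
          simp
          ring
      _ ≤ 4 * y ^ 2 := by
          rw [← sq_abs y]
          nlinarith

section Taylor

variable {μ : Measure ℝ} [IsProbabilityMeasure μ]

theorem integral_exp_sub_taylor (hμ : MemLp id 2 μ) (hmean : ∫ x, x ∂μ = 0) (t : ℝ) :
    ∫ x, (Complex.exp ((t * x : ℝ) * Complex.I)
        - (1 + (t * x : ℝ) * Complex.I - ((t * x : ℝ) : ℂ) ^ 2 / 2)) ∂μ
      = charFun μ t - (1 - t ^ 2 * variance id μ / 2 : ℝ) := by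
  have hsq : ∫ x, x ^ 2 ∂μ = variance id μ :=
    (variance_of_integral_eq_zero (X := id) measurable_id.aemeasurable hmean).symm
  have hexp : Integrable (fun x : ℝ => Complex.exp ((t * x : ℝ) * Complex.I)) μ :=
    Integrable.of_bound (by fun_prop) 1 (.of_forall fun x =>
      (Complex.norm_exp_ofReal_mul_I (t * x)).le)
  have hlin : Integrable (fun x : ℝ => ((t * x : ℝ) : ℂ) * Complex.I) μ :=
    (((hμ.integrable one_le_two).const_mul t).ofReal).mul_const _
  have hquad : Integrable (fun x : ℝ => ((t ^ 2 * x ^ 2 / 2 : ℝ) : ℂ)) μ :=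
    ((hμ.integrable_sq.const_mul (t ^ 2)).div_const 2).ofReal
  have hintlin : ∫ x : ℝ, ((t * x : ℝ) : ℂ) * Complex.I ∂μ = 0 := by
    rw [integral_mul_const, integral_complex_ofReal, integral_const_mul, hmean]
    simp
  have hintquad : ∫ x : ℝ, ((t ^ 2 * x ^ 2 / 2 : ℝ) : ℂ) ∂μ
      = (t ^ 2 * variance id μ / 2 : ℝ) := by
    rw [integral_complex_ofReal, integral_div, integral_const_mul, hsq]
  have hpow (x : ℝ) : ((t * x : ℝ) : ℂ) ^ 2 / 2 = (t ^ 2 * x ^ 2 / 2 : ℝ) := by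
    push_cast
    ring
  have hone : Integrable (fun x : ℝ => 1 + ((t * x : ℝ) : ℂ) * Complex.I) μ :=
    (integrable_const 1).add hlin
  simp_rw [hpow]
  rw [integral_sub hexp (by exact hone.sub hquad), integral_sub hone hquad,
    integral_add (integrable_const 1) hlin, hintlin, hintquad, charFun_apply_real]
  simp

theorem norm_charFun_sub_quadratic_le (hμ : MemLp id 2 μ) (hmean : ∫ x, x ∂μ = 0) {t R : ℝ}
    (hR : 0 ≤ R) (htR : |t| * R ≤ 1) :
    ‖charFun μ t - (1 - t ^ 2 * variance id μ / 2 : ℝ)‖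
      ≤ 4 * t ^ 2 * ∫ x in {x : ℝ | R ≤ |x|}, x ^ 2 ∂μ + |t| * R * (t ^ 2 * variance id μ) := by
  have hsq : ∫ x, x ^ 2 ∂μ = variance id μ :=
    (variance_of_integral_eq_zero (X := id) measurable_id.aemeasurable hmean).symm
  have htail : MeasurableSet {x : ℝ | R ≤ |x|} := measurableSet_le (by fun_prop) (by fun_prop)
  have hint : Integrable (fun x : ℝ => x ^ 2) μ := hμ.integrable_sq
  have hlarge := (hint.indicator htail).const_mul (4 * t ^ 2)
  have hsmall := (hint.const_mul (t ^ 2)).const_mul (|t| * R)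
  rw [← integral_exp_sub_taylor hμ hmean]
  calc _ ≤ ∫ x, (4 * t ^ 2 * {x : ℝ | R ≤ |x|}.indicator (fun x => x ^ 2) x
        + |t| * R * (t ^ 2 * x ^ 2)) ∂μ := by
        refine norm_integral_le_of_norm_le (hlarge.add hsmall) (.of_forall fun x => ?_)
        by_cases hx : R ≤ |x|
        · rw [Set.indicator_of_mem (by exact hx), mul_assoc, ← mul_pow]
          exact (norm_exp_mul_I_sub_taylor_le_sq (t * x)).trans
            (le_add_of_nonneg_right (by positivity))
        · have hle : |t * x| ≤ |t| * R := by
            rw [abs_mul]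
            gcongr
            exact (not_le.1 hx).le
          rw [Set.indicator_of_notMem (by exact hx), mul_zero, zero_add, ← mul_pow]
          calc _ ≤ |t * x| ^ 3 := norm_exp_mul_I_sub_taylor_le_cube (hle.trans htR)
            _ = |t * x| * (t * x) ^ 2 := by rw [← sq_abs (t * x)]; ring
            _ ≤ |t| * R * (t * x) ^ 2 := by gcongr
    _ = _ := by
        rw [integral_add hlarge hsmall, integral_const_mul, integral_const_mul, integral_const_mul,
          integral_indicator htail, hsq]

theorem charFunDefect_le (hμ : MemLp id 2 μ) (hmean : ∫ x, x ∂μ = 0) {t R : ℝ} (hR : 0 ≤ R)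
    (htR : |t| * R ≤ 1) (htv : t ^ 2 * variance id μ ≤ 1) :
    charFunDefect μ t ≤ t ^ 2 * (4 * ∫ x in {x : ℝ | R ≤ |x|}, x ^ 2 ∂μ
      + |t| * R * variance id μ + t ^ 2 * variance id μ ^ 2) := by
  have hnonneg : 0 ≤ t ^ 2 * variance id μ := mul_nonneg (sq_nonneg t) (variance_nonneg id μ)
  have hquad : ‖((1 - t ^ 2 * variance id μ / 2 : ℝ) : ℂ)
      - (Real.exp (-(t ^ 2 * variance id μ / 2)) : ℝ)‖ ≤ (t ^ 2 * variance id μ) ^ 2 := by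
    rw [← Complex.ofReal_sub, Complex.norm_real, Real.norm_eq_abs, abs_sub_comm]
    calc _ = |Real.exp (-(t ^ 2 * variance id μ / 2)) - 1 - -(t ^ 2 * variance id μ / 2)| := by
          ring_nf
      _ ≤ (-(t ^ 2 * variance id μ / 2)) ^ 2 := Real.abs_exp_sub_one_sub_id_le (by
          rw [abs_neg, abs_of_nonneg (by positivity)]
          linarith)
      _ ≤ (t ^ 2 * variance id μ) ^ 2 := by nlinarith
  calc _ ≤ _ := norm_sub_le_norm_sub_add_norm_sub _ _ _
    _ ≤ _ := add_le_add (norm_charFun_sub_quadratic_le hμ hmean hR htR) hquad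
    _ = _ := by ring

end Taylor

theorem eventually_charFunDefect_le {ψ : ℝ → ℝ} (hψ : Tendsto ψ atTop (𝓝 0)) (V : ℝ) {ε : ℝ}
    (hε : 0 < ε) : ∀ᶠ t in 𝓝 (0 : ℝ), ∀ μ : Measure ℝ, IsProbabilityMeasure μ → MemClass ψ μ →
      ∫ x, x ∂μ = 0 → variance id μ ≤ V → charFunDefect μ t ≤ t ^ 2 * ε := by
  obtain ⟨R, htail, hR⟩ := ((MemClass.eventually_tail_le hψ V (show 0 < ε / 8 by positivity)).and
    (eventually_ge_atTop 0)).exists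
  have hsmall {g : ℝ → ℝ} (hg : Continuous g) (h0 : g 0 = 0) {η : ℝ} (hη : 0 < η) :
      ∀ᶠ t in 𝓝 0, g t ≤ η :=
    (hg.tendsto' 0 0 h0).eventually_le_const hη
  filter_upwards [hsmall (g := fun t => |t| * R) (by fun_prop) (by simp) one_pos,
    hsmall (g := fun t => t ^ 2 * V) (by fun_prop) (by simp) one_pos,
    hsmall (g := fun t => |t| * R * V + t ^ 2 * V ^ 2) (by fun_prop) (by simp)
      (show 0 < ε / 2 by positivity)] with t htR htV hrem μ _ hμ hmean hvar
  have hnonneg := variance_nonneg id μ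
  refine (charFunDefect_le hμ.1 hmean hR htR (le_trans (by gcongr) htV)).trans ?_
  have h1 := htail μ hμ hvar
  have h2 : |t| * R * variance id μ + t ^ 2 * variance id μ ^ 2 ≤ ε / 2 :=
    le_trans (by gcongr) hrem
  gcongr
  linarith

/-! ### Newman's inequality -/

/-- Positive quadrant dependence of two random variables, formulated with increasing functions
instead of indicators of half-lines. -/
def IsPQD {Ω : Type*} [MeasurableSpace Ω] (A B : Ω → ℝ) (P : Measure Ω) : Prop :=
  ∀ F G : ℝ → ℝ, Monotone F → Monotone G →
    MemLp (fun ω => F (A ω)) 2 P → MemLp (fun ω => G (B ω)) 2 P →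
    0 ≤ covariance (fun ω => F (A ω)) (fun ω => G (B ω)) P

theorem monotone_mul_add_of_lipschitzWith {c : ℝ≥0} {f : ℝ → ℝ} (hf : LipschitzWith c f) :
    Monotone fun x => c * x + f x := by
  intro x y hxy
  have h := (le_abs_self _).trans (hf.dist_le_mul x y)
  rw [dist_comm, Real.dist_eq, abs_of_nonneg (sub_nonneg.2 hxy)] at h
  simp only
  linarith

section Newman

variable {Ω : Type*} [MeasurableSpace Ω] {P : Measure Ω} {A B : Ω → ℝ}

theorem IsPQD.covariance_nonneg (hAB : IsPQD A B P) (hA : MemLp A 2 P) (hB : MemLp B 2 P) :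
    0 ≤ covariance A B P :=
  hAB _ _ monotone_id monotone_id hA hB

theorem memLp_comp_of_lipschitzWith [IsFiniteMeasure P] (hA : MemLp A 2 P) {c : ℝ≥0} {f : ℝ → ℝ}
    (hf : LipschitzWith c f) : MemLp (fun ω => f (A ω)) 2 P := by
  have hcentred : MemLp (fun ω => f (A ω) - f 0) 2 P :=
    (hf.sub (LipschitzWith.const (f 0))).comp_memLp (sub_self _) hA
  simpa only [Pi.add_def, sub_add_cancel] using hcentred.add (memLp_const (f 0))

section Lipschitz

variable [IsProbabilityMeasure P] {f g : ℝ → ℝ} {a b : ℝ≥0}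

theorem IsPQD.neg_covariance_le (hAB : IsPQD A B P) (hA : MemLp A 2 P) (hB : MemLp B 2 P)
    (hf : LipschitzWith a f) (hg : LipschitzWith b g) :
    -covariance (fun ω => f (A ω)) (fun ω => g (B ω)) P ≤ a * b * covariance A B P := by
  have hexpand {F G : Ω → ℝ} (hF : MemLp F 2 P) (hG : MemLp G 2 P) :
      covariance (fun ω => a * A ω + F ω) (fun ω => b * B ω + G ω) P
        = a * b * covariance A B P + a * covariance A G P + b * covariance F B P
          + covariance F G P := by
    have haA := hA.const_mul (a : ℝ)
    have hbB := hB.const_mul (b : ℝ)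
    refine (covariance_add_left haA hF (hbB.add hG)).trans ?_
    rw [covariance_add_right haA hbB hG, covariance_add_right hF hbB hG,
      covariance_const_mul_left, covariance_const_mul_left, covariance_const_mul_right,
      covariance_const_mul_right]
    ring
  have hnonneg {f g : ℝ → ℝ} (hf : LipschitzWith a f) (hg : LipschitzWith b g) :
      0 ≤ a * b * covariance A B P + a * covariance A (fun ω => g (B ω)) P
        + b * covariance (fun ω => f (A ω)) B P
        + covariance (fun ω => f (A ω)) (fun ω => g (B ω)) P := by
    have hF := memLp_comp_of_lipschitzWith hA hf
    have hG := memLp_comp_of_lipschitzWith hB hg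
    rw [← hexpand hF hG]
    exact hAB _ _ (monotone_mul_add_of_lipschitzWith hf) (monotone_mul_add_of_lipschitzWith hg)
      ((hA.const_mul _).add hF) ((hB.const_mul _).add hG)
  have hplus := hnonneg hf hg
  have hminus := hnonneg hf.neg hg.neg
  simp only [Pi.neg_apply, covariance_fun_neg_left, covariance_fun_neg_right] at hminus
  linarith

theorem IsPQD.abs_covariance_le (hAB : IsPQD A B P) (hA : MemLp A 2 P) (hB : MemLp B 2 P)
    (hf : LipschitzWith a f) (hg : LipschitzWith b g) :
    |covariance (fun ω => f (A ω)) (fun ω => g (B ω)) P| ≤ a * b * covariance A B P := by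
  have hneg := hAB.neg_covariance_le hA hB hf.neg hg
  simp only [Pi.neg_apply, covariance_fun_neg_left, neg_neg] at hneg
  exact abs_le'.2 ⟨hneg, hAB.neg_covariance_le hA hB hf hg⟩

end Lipschitz

theorem charFun_map_eq_cos_add_sin [IsFiniteMeasure P] (hA : AEMeasurable A P) (t : ℝ) :
    charFun (P.map A) t
      = ((∫ ω, Real.cos (t * A ω) ∂P : ℝ) : ℂ)
        + ((∫ ω, Real.sin (t * A ω) ∂P : ℝ) : ℂ) * Complex.I := by
  have hcos : Integrable (fun ω => (Real.cos (t * A ω) : ℂ)) P :=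
    (Integrable.of_bound (f := fun ω => Real.cos (t * A ω)) (by fun_prop) 1
      (.of_forall fun ω => Real.abs_cos_le_one _)).ofReal
  have hsin : Integrable (fun ω => (Real.sin (t * A ω) : ℂ) * Complex.I) P :=
    (Integrable.of_bound (f := fun ω => Real.sin (t * A ω)) (by fun_prop) 1
      (.of_forall fun ω => Real.abs_sin_le_one _)).ofReal.mul_const _
  rw [charFun_apply_real, integral_map hA (by fun_prop), ← integral_complex_ofReal,
    ← integral_complex_ofReal, ← integral_mul_const, ← integral_add hcos hsin]
  congr with ω
  rw [← Complex.ofReal_mul, Complex.exp_mul_I, Complex.ofReal_cos, Complex.ofReal_sin]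

theorem charFun_map_add_sub_mul [IsProbabilityMeasure P] (hA : AEMeasurable A P)
    (hB : AEMeasurable B P) (t : ℝ) :
    charFun (P.map fun ω => A ω + B ω) t - charFun (P.map A) t * charFun (P.map B) t
      = ((covariance (fun ω => Real.cos (t * A ω)) (fun ω => Real.cos (t * B ω)) P
            - covariance (fun ω => Real.sin (t * A ω)) (fun ω => Real.sin (t * B ω)) P : ℝ) : ℂ)
        + ((covariance (fun ω => Real.sin (t * A ω)) (fun ω => Real.cos (t * B ω)) P
            + covariance (fun ω => Real.cos (t * A ω)) (fun ω => Real.sin (t * B ω)) P : ℝ) : ℂ)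
          * Complex.I := by
  have hcos {Y : Ω → ℝ} (hY : AEMeasurable Y P) : MemLp (fun ω => Real.cos (t * Y ω)) 2 P :=
    MemLp.of_bound (by fun_prop) 1 (.of_forall fun ω => Real.abs_cos_le_one _)
  have hsin {Y : Ω → ℝ} (hY : AEMeasurable Y P) : MemLp (fun ω => Real.sin (t * Y ω)) 2 P :=
    MemLp.of_bound (by fun_prop) 1 (.of_forall fun ω => Real.abs_sin_le_one _)
  have hcosadd : ∫ ω, Real.cos (t * (A ω + B ω)) ∂P
      = ∫ ω, Real.cos (t * A ω) * Real.cos (t * B ω) ∂P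
        - ∫ ω, Real.sin (t * A ω) * Real.sin (t * B ω) ∂P := by
    simp only [mul_add, Real.cos_add]
    exact integral_sub ((hcos hA).integrable_mul (hcos hB)) ((hsin hA).integrable_mul (hsin hB))
  have hsinadd : ∫ ω, Real.sin (t * (A ω + B ω)) ∂P
      = ∫ ω, Real.sin (t * A ω) * Real.cos (t * B ω) ∂P
        + ∫ ω, Real.cos (t * A ω) * Real.sin (t * B ω) ∂P := by
    simp only [mul_add, Real.sin_add]
    exact integral_add ((hsin hA).integrable_mul (hcos hB)) ((hcos hA).integrable_mul (hsin hB))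
  rw [charFun_map_eq_cos_add_sin (by fun_prop), charFun_map_eq_cos_add_sin hA,
    charFun_map_eq_cos_add_sin hB, covariance_eq_sub (hcos hA) (hcos hB),
    covariance_eq_sub (hsin hA) (hsin hB), covariance_eq_sub (hsin hA) (hcos hB),
    covariance_eq_sub (hcos hA) (hsin hB), hcosadd, hsinadd]
  apply Complex.ext <;> simp <;> ring

variable [IsProbabilityMeasure P]

theorem IsPQD.norm_charFun_map_add_sub_mul_le (hAB : IsPQD A B P) (hA : MemLp A 2 P)
    (hB : MemLp B 2 P) (t : ℝ) :
    ‖charFun (P.map fun ω => A ω + B ω) t - charFun (P.map A) t * charFun (P.map B) t‖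
      ≤ 4 * (t ^ 2 * covariance A B P) := by
  have hscale : LipschitzWith ‖t‖₊ fun x : ℝ => t * x := lipschitzWith_smul t
  have hcos : LipschitzWith ‖t‖₊ fun x => Real.cos (t * x) := by
    simpa only [one_mul] using! Real.lipschitzWith_cos.comp hscale
  have hsin : LipschitzWith ‖t‖₊ fun x => Real.sin (t * x) := by
    simpa only [one_mul] using! Real.lipschitzWith_sin.comp hscale
  have hcov {f g : ℝ → ℝ} (hf : LipschitzWith ‖t‖₊ f) (hg : LipschitzWith ‖t‖₊ g) :
      |covariance (fun ω => f (A ω)) (fun ω => g (B ω)) P| ≤ t ^ 2 * covariance A B P := by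
    simpa [← sq] using hAB.abs_covariance_le hA hB hf hg
  rw [charFun_map_add_sub_mul hA.aemeasurable hB.aemeasurable]
  refine (norm_add_le _ _).trans ?_
  rw [norm_mul, Complex.norm_I, mul_one, Complex.norm_real, Complex.norm_real]
  calc _ ≤ (t ^ 2 * covariance A B P + t ^ 2 * covariance A B P)
        + (t ^ 2 * covariance A B P + t ^ 2 * covariance A B P) :=
        add_le_add (norm_sub_le_of_le (hcov hcos hcos) (hcov hsin hsin))
          (norm_add_le_of_le (hcov hsin hcos) (hcov hcos hsin))
    _ = _ := by ring

theorem norm_mul_sub_exp_le {z w : ℂ} (hz : ‖z‖ ≤ 1) {u v c : ℝ} (hu : 0 ≤ u) (hv : 0 ≤ v)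
    (hc : 0 ≤ c) :
    ‖z * w - (Real.exp (-(u + v + c)) : ℝ)‖
      ≤ ‖z - (Real.exp (-u) : ℝ)‖ + ‖w - (Real.exp (-v) : ℝ)‖ + c := by
  have hsplit : z * w - (Real.exp (-(u + v + c)) : ℝ)
      = (z - (Real.exp (-u) : ℝ)) * (Real.exp (-v) : ℝ) + z * (w - (Real.exp (-v) : ℝ))
        + (Real.exp (-(u + v)) - Real.exp (-(u + v + c)) : ℝ) := by
    rw [neg_add u v, Real.exp_add]
    push_cast
    ring
  have hexp : ‖((Real.exp (-(u + v)) - Real.exp (-(u + v + c)) : ℝ) : ℂ)‖ ≤ c := by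
    have hnonneg : 0 ≤ 1 - Real.exp (-c) := sub_nonneg.2 (Real.exp_le_one_iff.2 (neg_nonpos.2 hc))
    rw [neg_add (u + v), Real.exp_add, ← mul_one_sub,
      Complex.norm_of_nonneg (mul_nonneg (Real.exp_nonneg _) hnonneg)]
    refine (mul_le_of_le_one_left hnonneg
      (Real.exp_le_one_iff.2 (neg_nonpos.2 (add_nonneg hu hv)))).trans ?_
    linarith [Real.add_one_le_exp (-c)]
  have hv1 : ‖((Real.exp (-v) : ℝ) : ℂ)‖ ≤ 1 := by
    rw [Complex.norm_of_nonneg (Real.exp_nonneg _)]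
    exact Real.exp_le_one_iff.2 (neg_nonpos.2 hv)
  rw [hsplit]
  refine norm_add_le_of_le (norm_add_le_of_le ?_ ?_) hexp
  · exact (norm_mul_le _ _).trans (mul_le_of_le_one_right (norm_nonneg _) hv1)
  · exact (norm_mul_le _ _).trans (mul_le_of_le_one_left (norm_nonneg _) hz)

theorem IsPQD.charFunDefect_map_add_le (hAB : IsPQD A B P) (hA : MemLp A 2 P) (hB : MemLp B 2 P)
    (t : ℝ) :
    charFunDefect (P.map fun ω => A ω + B ω) t
      ≤ charFunDefect (P.map A) t + charFunDefect (P.map B) t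
        + 5 * (t ^ 2 * covariance A B P) := by
  have hAm := hA.aemeasurable
  have hBm := hB.aemeasurable
  have hcov := mul_nonneg (sq_nonneg t) (hAB.covariance_nonneg hA hB)
  have hvA : 0 ≤ t ^ 2 * variance A P / 2 :=
    div_nonneg (mul_nonneg (sq_nonneg t) (variance_nonneg A P)) zero_le_two
  have hvB : 0 ≤ t ^ 2 * variance B P / 2 :=
    div_nonneg (mul_nonneg (sq_nonneg t) (variance_nonneg B P)) zero_le_two
  have : IsProbabilityMeasure (P.map A) := Measure.isProbabilityMeasure_map hAm
  have hvar : t ^ 2 * variance (fun ω => A ω + B ω) P / 2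
      = t ^ 2 * variance A P / 2 + t ^ 2 * variance B P / 2 + t ^ 2 * covariance A B P := by
    rw [variance_fun_add hA hB]
    ring
  unfold charFunDefect
  rw [variance_id_map (by fun_prop), variance_id_map hAm, variance_id_map hBm, hvar]
  have hprod := norm_mul_sub_exp_le (norm_charFun_le_one (μ := P.map A) t)
    (w := charFun (P.map B) t) hvA hvB hcov
  have hnewman := hAB.norm_charFun_map_add_sub_mul_le hA hB t
  linarith [norm_sub_le_norm_sub_add_norm_sub (charFun (P.map fun ω => A ω + B ω) t)
    (charFun (P.map A) t * charFun (P.map B) t)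
    (Real.exp (-(t ^ 2 * variance A P / 2 + t ^ 2 * variance B P / 2
      + t ^ 2 * covariance A B P)) : ℝ)]

end Newman

theorem IsFKG.isPQD_sum {Ω : Type*} [MeasurableSpace Ω] {d : ℕ} {X : (Fin d → ℤ) → Ω → ℝ}
    {P : Measure Ω} (hX : IsFKG X P) (s t : Finset (Fin d → ℤ)) :
    IsPQD (fun ω => ∑ u ∈ s, X u ω) (fun ω => ∑ u ∈ t, X u ω) P := by
  intro F G hF hG hFmem hGmem
  have hmono {r : Finset (Fin d → ℤ)} (hr : r ⊆ s ∪ t) :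
      Monotone fun y : (s ∪ t : Finset _) → ℝ => ∑ u ∈ r.attach, y ⟨u, hr u.2⟩ :=
    fun y z hyz => Finset.sum_le_sum fun u _ => hyz _
  have hmeas {r : Finset (Fin d → ℤ)} (hr : r ⊆ s ∪ t) :
      Measurable fun y : (s ∪ t : Finset _) → ℝ => ∑ u ∈ r.attach, y ⟨u, hr u.2⟩ := by
    fun_prop
  have h := hX (s ∪ t) _ _
    (hF.measurable.comp (hmeas Finset.subset_union_left))
    (hG.measurable.comp (hmeas Finset.subset_union_right))
    (hF.comp (hmono Finset.subset_union_left)) (hG.comp (hmono Finset.subset_union_right))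
  simp only [Function.comp_apply, fun ω => s.sum_attach fun u => X u ω,
    fun ω => t.sum_attach fun u => X u ω] at h
  exact h hFmem hGmem

/-! ### Boxes -/

section

variable {d : ℕ} {x : Fin d → ℕ} {i : Fin d} {u : Fin d → ℤ}

theorem mem_box_update {n : ℕ} :
    u ∈ box (Function.update x i n)
      ↔ (1 ≤ u i ∧ u i ≤ n) ∧ ∀ j, j ≠ i → 1 ≤ u j ∧ u j ≤ x j := by
  rw [box, Fintype.mem_piFinset]
  simp_rw [Finset.mem_Icc]
  exact Function.forall_update_iff x fun j (k : ℕ) => 1 ≤ u j ∧ u j ≤ k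

theorem card_box (x : Fin d → ℕ) : (box x).card = vol x := by
  simp [box, vol]

/-- The volume of the sections of the box of `x` orthogonal to the direction `i`. -/
def sectionVol (x : Fin d → ℕ) (i : Fin d) : ℕ := ∏ j ∈ Finset.univ \ {i}, x j

theorem vol_update (x : Fin d → ℕ) (i : Fin d) (n : ℕ) :
    vol (Function.update x i n) = n * sectionVol x i :=
  Finset.prod_update_of_mem (Finset.mem_univ i) x n

theorem vol_eq (x : Fin d → ℕ) (i : Fin d) : vol x = x i * sectionVol x i := by
  rw [← vol_update x i (x i), Function.update_eq_self]

theorem one_le_of_one_le_vol (hx : 1 ≤ vol x) (i : Fin d) : 1 ≤ x i := by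
  rw [vol_eq x i] at hx
  exact Nat.pos_of_mul_pos_right hx

theorem exists_lt_of_pow_lt_vol {n : ℕ} (hx : n ^ d < vol x) : ∃ i, n < x i := by
  by_contra! hle
  refine hx.not_ge ((Finset.prod_le_pow_card _ _ n fun i _ => hle i).trans_eq ?_)
  rw [Finset.card_univ, Fintype.card_fin]

/-- The part with `q < u i ≤ q + m` of the box whose side in the direction `i` is `q + m` and
whose other sides are those of `x`. -/
def slab (x : Fin d → ℕ) (i : Fin d) (q m : ℕ) : Finset (Fin d → ℤ) :=
  (box (Function.update x i m)).map (addRightEmbedding (Pi.single i (q : ℤ)))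

theorem mem_slab {q m : ℕ} :
    u ∈ slab x i q m
      ↔ ((q : ℤ) + 1 ≤ u i ∧ u i ≤ q + m) ∧ ∀ j, j ≠ i → 1 ≤ u j ∧ u j ≤ x j := by
  have hshift : u ∈ slab x i q m ↔ u - Pi.single i (q : ℤ) ∈ box (Function.update x i m) := by
    simp [slab, ← eq_sub_iff_add_eq]
  rw [hshift, mem_box_update, Pi.sub_apply, Pi.single_eq_same]
  refine and_congr (by omega) (forall₂_congr fun j hj => ?_)
  rw [Pi.sub_apply, Pi.single_eq_of_ne hj, sub_zero]

theorem sum_box_update_add {M : Type*} [AddCommMonoid M] (x : Fin d → ℕ) (i : Fin d) (q m : ℕ)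
    (f : (Fin d → ℤ) → M) :
    ∑ u ∈ box (Function.update x i (q + m)), f u
      = ∑ u ∈ box (Function.update x i q), f u + ∑ u ∈ slab x i q m, f u := by
  have hdisj : Disjoint (box (Function.update x i q)) (slab x i q m) :=
    Finset.disjoint_left.2 fun u hu hu' => by
      have := (mem_box_update.1 hu).1
      have := (mem_slab.1 hu').1
      omega
  rw [← Finset.sum_union hdisj]
  congr 1
  ext u
  rw [Finset.mem_union, mem_box_update, mem_box_update, mem_slab, ← or_and_right]
  refine and_congr_left fun _ => ?_
  push_cast
  omega

theorem sum_box_update_apply {R : Type*} [Semiring R] (x : Fin d → ℕ) (i : Fin d) (g : ℤ → R)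
    (q : ℕ) :
    ∑ u ∈ box (Function.update x i q), g (u i)
      = sectionVol x i * ∑ k ∈ Finset.range q, g (k + 1) := by
  induction q with
  | zero =>
    have hempty : box (Function.update x i 0) = ∅ := by
      rw [← Finset.card_eq_zero, card_box, vol_update, zero_mul]
    simp [hempty]
  | succ q ih =>
    have hslab : ∀ u ∈ slab x i q 1, g (u i) = g (q + 1) := fun u hu => by
      have := (mem_slab.1 hu).1
      congr 1
      omega
    rw [sum_box_update_add, ih, Finset.sum_congr rfl hslab, Finset.sum_const, slab,
      Finset.card_map, card_box, vol_update, one_mul, nsmul_eq_mul, Finset.sum_range_succ, mul_add]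

end

/-! ### Covariances in a stationary FKG field -/

section

variable {Ω : Type*} [MeasurableSpace Ω] {d : ℕ} {X : (Fin d → ℤ) → Ω → ℝ} {P : Measure Ω}

/-- A stationary field with mean zero and finite variance which satisfies the FKG inequalities
and has finite susceptibility. -/
structure IsFKGField (X : (Fin d → ℤ) → Ω → ℝ) (P : Measure Ω) : Prop where
  measurable : ∀ u, Measurable (X u)
  stationary : IsStationary X P
  memLp : ∀ u, MemLp (X u) 2 P
  integral_eq_zero : ∀ u, ∫ ω, X u ω ∂P = 0
  isFKG : IsFKG X P
  summable : Summable fun u => covariance (X 0) (X u) P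

/-- The covariance function `w ↦ Cov(X_0, X_w)` of the field. -/
def covFun (X : (Fin d → ℤ) → Ω → ℝ) (P : Measure Ω) (w : Fin d → ℤ) : ℝ :=
  covariance (X 0) (X w) P

/-- The part of the susceptibility that comes from the points `w` with `w i ≥ k`. -/
def covTail (X : (Fin d → ℤ) → Ω → ℝ) (P : Measure Ω) (i : Fin d) (k : ℤ) : ℝ :=
  ∑' w, {w | k ≤ w i}.indicator (covFun X P) w

namespace IsFKGField

theorem measurable_sum (h : IsFKGField X P) (s : Finset (Fin d → ℤ)) :
    Measurable fun ω => ∑ u ∈ s, X u ω :=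
  Finset.measurable_sum s fun u _ => h.measurable u

theorem memLp_sum (h : IsFKGField X P) (s : Finset (Fin d → ℤ)) :
    MemLp (fun ω => ∑ u ∈ s, X u ω) 2 P :=
  memLp_finsetSum s fun u _ => h.memLp u

theorem covFun_nonneg (h : IsFKGField X P) (w : Fin d → ℤ) : 0 ≤ covFun X P w :=
  h.isFKG {0, w} (fun y => y ⟨0, by simp⟩) (fun y => y ⟨w, by simp⟩) (measurable_pi_apply _)
    (measurable_pi_apply _) (fun _ _ hy => hy _) (fun _ _ hy => hy _) (h.memLp 0) (h.memLp w)

theorem covariance_eq (h : IsFKGField X P) (u w : Fin d → ℤ) :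
    covariance (X u) (X w) P = covFun X P (w - u) := by
  have hcoord : ∀ v : Fin d → ℤ, Measurable fun y : (Fin d → ℤ) → ℝ => y v := measurable_pi_apply
  have hident := h.stationary u
  have hshifted := covariance_map_fun (hcoord 0).aestronglyMeasurable
    (hcoord (w - u)).aestronglyMeasurable hident.aemeasurable_fst
  have hfield := covariance_map_fun (hcoord 0).aestronglyMeasurable
    (hcoord (w - u)).aestronglyMeasurable hident.aemeasurable_snd
  rw [hident.map_eq, hfield] at hshifted
  simpa only [zero_add, sub_add_cancel] using! hshifted.symm

theorem map_sum_map_add (h : IsFKGField X P) (s : Finset (Fin d → ℤ)) (a : Fin d → ℤ) :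
    P.map (fun ω => ∑ u ∈ s.map (addRightEmbedding a), X u ω)
      = P.map fun ω => ∑ u ∈ s, X u ω := by
  have hsum : Measurable fun y : (Fin d → ℤ) → ℝ => ∑ u ∈ s, y u :=
    Finset.measurable_sum _ fun u _ => measurable_pi_apply u
  simp only [Finset.sum_map, addRightEmbedding_apply]
  exact ((h.stationary a).comp hsum).map_eq

theorem tendsto_covTail (h : IsFKGField X P) (i : Fin d) :
    Tendsto (fun n : ℕ => covTail X P i (n + 1)) atTop (𝓝 0) := by
  rw [← tsum_zero (β := Fin d → ℤ)]
  refine tendsto_tsum_of_dominated_convergence (bound := covFun X P) h.summable (fun w => ?_)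
    (.of_forall fun n w => ?_)
  · refine tendsto_const_nhds.congr' ?_
    filter_upwards [eventually_ge_atTop (w i).toNat] with n hn
    exact (Set.indicator_of_notMem (by simp; omega) _).symm
  · exact (norm_indicator_le_norm_self _ w).trans_eq (Real.norm_of_nonneg (h.covFun_nonneg w))

theorem exists_sum_covTail_le (h : IsFKGField X P) {η : ℝ} (hη : 0 < η) :
    ∃ q, 1 ≤ q ∧ ∀ i : Fin d, ∑ k ∈ Finset.range q, covTail X P i (k + 1) ≤ q * η := by
  have hmeans : ∀ᶠ q : ℕ in atTop, ∀ i : Fin d,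
      (q : ℝ)⁻¹ * ∑ k ∈ Finset.range q, covTail X P i (k + 1) < η :=
    eventually_all.2 fun i => (h.tendsto_covTail i).cesaro.eventually_lt_const hη
  obtain ⟨q, hq, hq1⟩ := (hmeans.and (eventually_ge_atTop 1)).exists
  exact ⟨q, hq1, fun i => ((inv_mul_lt_iff₀ (by positivity)).1 (hq i)).le⟩

theorem sum_covFun_sub_le (h : IsFKGField X P) (t : Finset (Fin d → ℤ)) (u : Fin d → ℤ) :
    ∑ w ∈ t, covFun X P (w - u) ≤ ∑' w, covFun X P w := by
  rw [← (Equiv.subRight u).tsum_eq (covFun X P)]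
  exact ((Equiv.subRight u).summable_iff.2 h.summable).sum_le_tsum t fun w _ => h.covFun_nonneg _

theorem sum_covFun_sub_le_covTail (h : IsFKGField X P) {t : Finset (Fin d → ℤ)} {i : Fin d} {k : ℤ}
    (ht : ∀ w ∈ t, k ≤ w i) (u : Fin d → ℤ) :
    ∑ w ∈ t, covFun X P (w - u) ≤ covTail X P i (k - u i) := by
  have hsummable : Summable ({w | k - u i ≤ w i}.indicator (covFun X P)) :=
    Summable.indicator h.summable _
  rw [covTail, ← (Equiv.subRight u).tsum_eq]
  refine le_trans (Finset.sum_le_sum fun w hw => ?_)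
    (((Equiv.subRight u).summable_iff.2 hsummable).sum_le_tsum t fun w _ =>
      Set.indicator_nonneg (fun w _ => h.covFun_nonneg w) _)
  rw [Set.indicator_of_mem (by simpa using ht w hw), Equiv.subRight_apply]

variable [IsProbabilityMeasure P]

theorem covariance_sum_sum (h : IsFKGField X P) (s t : Finset (Fin d → ℤ)) :
    covariance (fun ω => ∑ u ∈ s, X u ω) (fun ω => ∑ u ∈ t, X u ω) P
      = ∑ u ∈ s, ∑ w ∈ t, covFun X P (w - u) := by
  rw [covariance_fun_sum_fun_sum' (fun u _ => h.memLp u) (fun u _ => h.memLp u)]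
  simp_rw [h.covariance_eq]

theorem variance_sum_le (h : IsFKGField X P) (s : Finset (Fin d → ℤ)) :
    variance (fun ω => ∑ u ∈ s, X u ω) P ≤ s.card * ∑' w, covFun X P w := by
  rw [← covariance_self (h.measurable_sum s).aemeasurable, h.covariance_sum_sum, ← nsmul_eq_mul]
  exact Finset.sum_le_card_nsmul _ _ _ fun u _ => h.sum_covFun_sub_le s u

theorem covariance_box_slab_le (h : IsFKGField X P) (x : Fin d → ℕ) (i : Fin d) (q m : ℕ) :
    covariance (fun ω => ∑ u ∈ box (Function.update x i q), X u ω)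
      (fun ω => ∑ u ∈ slab x i q m, X u ω) P
      ≤ sectionVol x i * ∑ k ∈ Finset.range q, covTail X P i (k + 1) := by
  rw [h.covariance_sum_sum, ← Finset.sum_range_reflect]
  calc ∑ u ∈ box (Function.update x i q), ∑ w ∈ slab x i q m, covFun X P (w - u)
      ≤ ∑ u ∈ box (Function.update x i q), covTail X P i (q + 1 - u i) :=
        Finset.sum_le_sum fun u _ =>
          h.sum_covFun_sub_le_covTail (fun w hw => (mem_slab.1 hw).1.1) u
    _ = sectionVol x i * ∑ k ∈ Finset.range q, covTail X P i (q + 1 - (k + 1)) :=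
        sum_box_update_apply x i (fun k => covTail X P i (q + 1 - k)) q
    _ = _ := by
        congr 1
        refine Finset.sum_congr rfl fun k hk => ?_
        have := Finset.mem_range.1 hk
        congr 1
        omega

end IsFKGField

end

section

variable {Ω : Type*} {d : ℕ} {X Z : (Fin d → ℤ) → Ω → ℝ} {x : Fin d → ℕ}

/-! ### Normalized sums over boxes -/

/-- The normalized sum `(∑_{u ∈ B_x} X_u) / √|x|` of the field without normal perturbations. -/
def normSum (X : (Fin d → ℤ) → Ω → ℝ) (x : Fin d → ℕ) (ω : Ω) : ℝ :=
  (∑ u ∈ box x, X u ω) / √(vol x : ℝ)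

theorem normSum_eq_inv_mul (X : (Fin d → ℤ) → Ω → ℝ) (x : Fin d → ℕ) :
    normSum X x = fun ω => (√(vol x : ℝ))⁻¹ * ∑ u ∈ box x, X u ω :=
  funext fun _ => div_eq_inv_mul _ _

variable [MeasurableSpace Ω] {P : Measure Ω}

theorem measurable_normSum (hX : ∀ u, Measurable (X u)) (x : Fin d → ℕ) :
    Measurable (normSum X x) :=
  (Finset.measurable_sum _ fun u _ => hX u).div_const _

theorem map_normSum (hX : ∀ u, Measurable (X u)) (x : Fin d → ℕ) :
    P.map (normSum X x) = (P.map fun ω => ∑ u ∈ box x, X u ω).map ((√(vol x : ℝ))⁻¹ * ·) := by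
  rw [Measure.map_map (by fun_prop) (Finset.measurable_sum _ fun u _ => hX u), normSum_eq_inv_mul]
  rfl

theorem map_sum_gaussianReal [IsProbabilityMeasure P] {τ : ℝ≥0} (hZ : ∀ u, Measurable (Z u))
    (hlaw : ∀ u, P.map (Z u) = gaussianReal 0 τ) (hind : iIndepFun Z P) (s : Finset (Fin d → ℤ)) :
    P.map (fun ω => ∑ u ∈ s, Z u ω) = gaussianReal 0 (s.card * τ) := by
  induction s using Finset.induction_on with
  | empty => simp
  | insert a s ha ih =>
    have hsum : (fun ω => ∑ u ∈ s, Z u ω) = ∑ u ∈ s, Z u := by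
      ext ω
      rw [Finset.sum_apply]
    have hinsert : (fun ω => ∑ u ∈ insert a s, Z u ω) = (∑ u ∈ s, Z u) + Z a := by
      rw [← hsum]
      ext ω
      rw [Finset.sum_insert ha, Pi.add_apply, add_comm]
    rw [hsum] at ih
    rw [hinsert, gaussianReal_add_gaussianReal_of_indepFun
      (hind.indepFun_finsetSum_of_notMem hZ ha) ih (hlaw a), Finset.card_insert_of_notMem ha,
      add_zero, Nat.cast_succ, add_mul, one_mul]

theorem map_normSum_gaussianReal [IsProbabilityMeasure P] {τ : ℝ≥0} (hZ : ∀ u, Measurable (Z u))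
    (hlaw : ∀ u, P.map (Z u) = gaussianReal 0 τ) (hind : iIndepFun Z P) (hx : 1 ≤ vol x) :
    P.map (normSum Z x) = gaussianReal 0 τ := by
  have hvol : (vol x : ℝ) ≠ 0 := by positivity
  rw [map_normSum hZ, map_sum_gaussianReal hZ hlaw hind, gaussianReal_map_const_mul, mul_zero,
    card_box]
  congr 1
  ext
  push_cast
  rw [inv_pow, Real.sq_sqrt (Nat.cast_nonneg _), inv_mul_cancel_left₀ hvol]

theorem map_boxSum [IsProbabilityMeasure P] {τ : ℝ≥0} (hX : ∀ u, Measurable (X u))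
    (hZ : ∀ u, Measurable (Z u)) (hlaw : ∀ u, P.map (Z u) = gaussianReal 0 τ)
    (hind : iIndepFun Z P) (hXZ : IndepFun (fun ω u => X u ω) (fun ω u => Z u ω) P)
    (hx : 1 ≤ vol x) :
    P.map (boxSum X Z x) = P.map (normSum X x) ∗ gaussianReal 0 τ := by
  have hmeas : Measurable fun y : (Fin d → ℤ) → ℝ => (∑ u ∈ box x, y u) / √(vol x : ℝ) :=
    (Finset.measurable_sum _ fun u _ => measurable_pi_apply u).div_const _
  have hindep : IndepFun (normSum X x) (normSum Z x) P := hXZ.comp hmeas hmeas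
  have hsum : boxSum X Z x = normSum X x + normSum Z x := by
    ext ω
    rw [boxSum, Finset.sum_add_distrib, add_div]
    rfl
  rw [← map_normSum_gaussianReal hZ hlaw hind hx, hsum,
    hindep.map_add_eq_map_conv_map (measurable_normSum hX x) (measurable_normSum hZ x)]

namespace IsFKGField

theorem memLp_normSum (h : IsFKGField X P) (x : Fin d → ℕ) : MemLp (normSum X x) 2 P := by
  rw [normSum_eq_inv_mul]
  exact (h.memLp_sum (box x)).const_mul _

theorem memLp_id_map_normSum (h : IsFKGField X P) (x : Fin d → ℕ) :
    MemLp id 2 (P.map (normSum X x)) :=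
  (memLp_map_measure_iff (by fun_prop) (measurable_normSum h.measurable x).aemeasurable).2
    (h.memLp_normSum x)

variable [IsProbabilityMeasure P]

theorem isProbabilityMeasure_map_normSum (h : IsFKGField X P) (x : Fin d → ℕ) :
    IsProbabilityMeasure (P.map (normSum X x)) :=
  Measure.isProbabilityMeasure_map (measurable_normSum h.measurable x).aemeasurable

theorem integral_map_normSum (h : IsFKGField X P) (x : Fin d → ℕ) :
    ∫ y, y ∂P.map (normSum X x) = 0 := by
  rw [integral_map (measurable_normSum h.measurable x).aemeasurable (by fun_prop)]
  simp only [normSum]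
  rw [integral_div, integral_finsetSum _ fun u _ => (h.memLp u).integrable one_le_two]
  simp [h.integral_eq_zero]

theorem variance_map_normSum_le (h : IsFKGField X P) (x : Fin d → ℕ) :
    variance id (P.map (normSum X x)) ≤ ∑' w, covFun X P w := by
  have hvar : variance id (P.map (normSum X x))
      = variance (fun ω => ∑ u ∈ box x, X u ω) P / vol x := by
    rw [variance_id_map (measurable_normSum h.measurable x).aemeasurable,
      normSum_eq_inv_mul,
      variance_const_mul, inv_pow, Real.sq_sqrt (Nat.cast_nonneg _), div_eq_inv_mul]
  rw [hvar]
  refine div_le_of_le_mul₀ (Nat.cast_nonneg _) (tsum_nonneg h.covFun_nonneg) ?_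
  rw [mul_comm, ← card_box]
  exact h.variance_sum_le (box x)

end IsFKGField

/-! ### The central limit theorem for normalized sums -/

theorem mul_pow_le_of_step_le {D : ℕ → ℝ} {θ A B : ℝ} {q : ℕ} (hD : ∀ n, 0 ≤ D n) (hθ : 0 ≤ θ)
    (hθ' : θ ≤ 1) (hB : 0 ≤ B) (hq : 1 ≤ q) (hbase : ∀ n, 1 ≤ n → n ≤ q → D n * θ ^ n ≤ n * A)
    (hstep : ∀ m, D (q + m) ≤ D q + D m + q * B) {n : ℕ} (hn : 1 ≤ n) :
    D n * θ ^ n ≤ n * (A + B) := by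
  have hpow : ∀ k, θ ^ k ≤ 1 := fun k => pow_le_one₀ hθ hθ'
  induction n using Nat.strong_induction_on with
  | _ n ih =>
    rcases le_or_gt n q with hnq | hnq
    · exact (hbase n hn hnq).trans (by gcongr; linarith)
    · obtain ⟨m, rfl⟩ := Nat.exists_eq_add_of_le hnq.le
      calc D (q + m) * θ ^ (q + m) ≤ (D q + D m + q * B) * θ ^ (q + m) := by
            gcongr
            exact hstep m
        _ = D q * θ ^ q * θ ^ m + D m * θ ^ m * θ ^ q + q * B * θ ^ (q + m) := by
            rw [pow_add]
            ring
        _ ≤ D q * θ ^ q + D m * θ ^ m + q * B :=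
            add_le_add_three
              (mul_le_of_le_one_right (mul_nonneg (hD q) (pow_nonneg hθ q)) (hpow m))
              (mul_le_of_le_one_right (mul_nonneg (hD m) (pow_nonneg hθ m)) (hpow q))
              (mul_le_of_le_one_right (by positivity) (hpow _))
        _ ≤ q * A + m * (A + B) + q * B := by
            gcongr ?_ + ?_ + _
            exacts [hbase q hq le_rfl, ih m (by omega) (by omega)]
        _ = (q + m : ℕ) * (A + B) := by
            push_cast
            ring

namespace IsFKGField

variable [IsProbabilityMeasure P]

theorem charFunDefect_sum_update_add_le (h : IsFKGField X P) (x : Fin d → ℕ) (i : Fin d)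
    (q m : ℕ) (s : ℝ) :
    charFunDefect (P.map fun ω => ∑ u ∈ box (Function.update x i (q + m)), X u ω) s
      ≤ charFunDefect (P.map fun ω => ∑ u ∈ box (Function.update x i q), X u ω) s
        + charFunDefect (P.map fun ω => ∑ u ∈ box (Function.update x i m), X u ω) s
        + 5 * (s ^ 2 * (sectionVol x i * ∑ k ∈ Finset.range q, covTail X P i (k + 1))) := by
  have hpqd := h.isFKG.isPQD_sum (box (Function.update x i q)) (slab x i q m)
  have hadd := hpqd.charFunDefect_map_add_le (h.memLp_sum _) (h.memLp_sum _) s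
  simp_rw [← fun ω => sum_box_update_add x i q m fun u => X u ω] at hadd
  have hslab : P.map (fun ω => ∑ u ∈ slab x i q m, X u ω)
      = P.map fun ω => ∑ u ∈ box (Function.update x i m), X u ω := h.map_sum_map_add _ _
  rw [hslab] at hadd
  refine hadd.trans ?_
  gcongr
  exact h.covariance_box_slab_le x i q m

theorem charFunDefect_map_normSum_conv (h : IsFKGField X P) {i : Fin d} {n : ℕ}
    (hn : 1 ≤ vol (Function.update x i n)) (τ : ℝ≥0) (s : ℝ) :
    charFunDefect (P.map (normSum X (Function.update x i n)) ∗ gaussianReal 0 τ)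
        (√(vol (Function.update x i n) : ℝ) * s)
      = charFunDefect (P.map fun ω => ∑ u ∈ box (Function.update x i n), X u ω) s
        * Real.exp (-(sectionVol x i * s ^ 2 * τ / 2)) ^ n := by
  have := h.isProbabilityMeasure_map_normSum (Function.update x i n)
  have hvol : √(vol (Function.update x i n) : ℝ) ≠ 0 := by positivity
  rw [charFunDefect_conv_gaussianReal (h.memLp_id_map_normSum _), map_normSum h.measurable,
    charFunDefect_map_mul, inv_mul_cancel_left₀ hvol, mul_pow, Real.sq_sqrt (Nat.cast_nonneg _),
    ← Real.exp_nat_mul, vol_update]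
  push_cast
  ring_nf

/-- Boxes are grown in one direction by slabs of fixed width `q`, so that the covariance between a
box and the next slab stays small compared with the volume of the slab. -/
theorem charFunDefect_map_normSum_update_le (h : IsFKGField X P) {i : Fin d} {s ε η : ℝ} {τ : ℝ≥0}
    {q : ℕ} (hx : 1 ≤ sectionVol x i) (hη : 0 ≤ η) (hq : 1 ≤ q)
    (htail : ∑ k ∈ Finset.range q, covTail X P i (k + 1) ≤ q * η)
    (hbase : ∀ n, 1 ≤ n → n ≤ q →
      charFunDefect (P.map (normSum X (Function.update x i n)) ∗ gaussianReal 0 τ)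
          (√(vol (Function.update x i n) : ℝ) * s)
        ≤ (√(vol (Function.update x i n) : ℝ) * s) ^ 2 * ε) {n : ℕ} (hn : 1 ≤ n) :
    charFunDefect (P.map (normSum X (Function.update x i n)) ∗ gaussianReal 0 τ)
        (√(vol (Function.update x i n) : ℝ) * s)
      ≤ (√(vol (Function.update x i n) : ℝ) * s) ^ 2 * (ε + 5 * η) := by
  have hvol : ∀ n, 1 ≤ n → 1 ≤ vol (Function.update x i n) := fun n hn => by
    rw [vol_update]
    exact Nat.mul_pos hn hx
  have hsq : ∀ n, (√(vol (Function.update x i n) : ℝ) * s) ^ 2 = n * (sectionVol x i * s ^ 2) :=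
    fun n => by
      rw [mul_pow, Real.sq_sqrt (Nat.cast_nonneg _), vol_update]
      push_cast
      ring
  have hexp : Real.exp (-(sectionVol x i * s ^ 2 * τ / 2)) ≤ 1 :=
    Real.exp_le_one_iff.2 (neg_nonpos.2 (by positivity))
  rw [h.charFunDefect_map_normSum_conv (hvol n hn), hsq]
  refine (mul_pow_le_of_step_le
    (D := fun n => charFunDefect (P.map fun ω => ∑ u ∈ box (Function.update x i n), X u ω) s)
    (A := sectionVol x i * s ^ 2 * ε)
    (B := 5 * (sectionVol x i * s ^ 2 * η)) (fun n => charFunDefect_nonneg _ _) (Real.exp_pos _).le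
    hexp (by positivity) hq (fun n hn hnq => ?_) (fun m => ?_) hn).trans_eq (by ring)
  · rw [← h.charFunDefect_map_normSum_conv (hvol n hn), ← mul_assoc, ← hsq]
    exact hbase n hn hnq
  · refine (h.charFunDefect_sum_update_add_le x i q m s).trans ?_
    rw [show (q : ℝ) * (5 * (sectionVol x i * s ^ 2 * η))
      = 5 * (s ^ 2 * (sectionVol x i * (q * η))) by ring]
    gcongr

theorem eventually_forall_charFunDefect_map_normSum_conv_le (h : IsFKGField X P) {τ : ℝ≥0}
    {ψ : ℝ → ℝ} (hψ : Tendsto ψ atTop (𝓝 0))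
    (hmem : ∀ x, 1 ≤ vol x → MemClass ψ (P.map (normSum X x) ∗ gaussianReal 0 τ)) {ε : ℝ}
    (hε : 0 < ε) :
    ∀ᶠ t in 𝓝 (0 : ℝ), ∀ x, 1 ≤ vol x →
      charFunDefect (P.map (normSum X x) ∗ gaussianReal 0 τ) t ≤ t ^ 2 * ε := by
  filter_upwards [eventually_charFunDefect_le hψ ((∑' w, covFun X P w) + τ) hε] with t ht x hx
  have := h.isProbabilityMeasure_map_normSum x
  have hLp := h.memLp_id_map_normSum x
  refine ht _ inferInstance (hmem x hx) ?_ ?_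
  · rw [integral_id_conv_gaussianReal (hLp.integrable one_le_two), h.integral_map_normSum]
  · rw [variance_conv_gaussianReal hLp]
    gcongr
    exact h.variance_map_normSum_le x

theorem eventually_charFunDefect_map_normSum_conv_le (h : IsFKGField X P) {τ : ℝ≥0} {ψ : ℝ → ℝ}
    (hψ : Tendsto ψ atTop (𝓝 0))
    (hmem : ∀ x, 1 ≤ vol x → MemClass ψ (P.map (normSum X x) ∗ gaussianReal 0 τ)) (r : ℝ) {ε : ℝ}
    (hε : 0 < ε) :
    ∀ᶠ x in comap vol atTop,
      charFunDefect (P.map (normSum X x) ∗ gaussianReal 0 τ) r ≤ r ^ 2 * ε := by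
  have hε' : 0 < ε / 6 := by positivity
  obtain ⟨δ, hδ, hnear⟩ := Metric.eventually_nhds_iff.1
    (h.eventually_forall_charFunDefect_map_normSum_conv_le hψ hmem hε')
  obtain ⟨q, hq, htail⟩ := h.exists_sum_covTail_le hε'
  obtain ⟨H, hH⟩ := exists_nat_gt (q * r ^ 2 / δ ^ 2)
  filter_upwards [tendsto_comap.eventually (eventually_gt_atTop (H ^ d))] with x hx
  obtain ⟨i, hi⟩ := exists_lt_of_pow_lt_vol hx
  have hvol : 1 ≤ vol x := by omega
  have hsection : 1 ≤ sectionVol x i := Nat.pos_of_mul_pos_left (vol_eq x i ▸ hvol)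
  have hsmall : ∀ n ≤ q, |√(vol (Function.update x i n) : ℝ) * (r / √(vol x : ℝ))| < δ := by
    intro n hn
    have hxi : (H : ℝ) < x i := by exact_mod_cast hi
    have hxi_pos : (0 : ℝ) < x i := H.cast_nonneg.trans_lt hxi
    refine abs_lt_of_sq_lt_sq ?_ hδ.le
    calc (√(vol (Function.update x i n) : ℝ) * (r / √(vol x : ℝ))) ^ 2 = n * r ^ 2 / x i := by
          rw [mul_pow, div_pow, Real.sq_sqrt (Nat.cast_nonneg _), Real.sq_sqrt (Nat.cast_nonneg _),
            vol_update, vol_eq x i]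
          push_cast
          field_simp
      _ ≤ q * r ^ 2 / x i := by gcongr
      _ < δ ^ 2 := (div_lt_comm₀ (by positivity) hxi_pos).1 (hH.trans hxi)
  have hbound := h.charFunDefect_map_normSum_update_le (s := r / √(vol x : ℝ)) (ε := ε / 6)
    (τ := τ) hsection hε'.le hq (htail i) (fun n hn hnq => hnear
      (by simpa only [Real.dist_eq, sub_zero] using hsmall n hnq) _ (by
        rw [vol_update]
        exact Nat.mul_pos hn hsection)) (one_le_of_one_le_vol hvol i)
  rw [Function.update_eq_self, mul_div_cancel₀ _ (by positivity)] at hbound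
  exact hbound.trans_eq (by ring)

theorem tendsto_charFunDefect_map_normSum (h : IsFKGField X P) {τ : ℝ≥0} {ψ : ℝ → ℝ}
    (hψ : Tendsto ψ atTop (𝓝 0))
    (hmem : ∀ x, 1 ≤ vol x → MemClass ψ (P.map (normSum X x) ∗ gaussianReal 0 τ)) (r : ℝ) :
    Tendsto (fun x => charFunDefect (P.map (normSum X x)) r) (comap vol atTop) (𝓝 0) := by
  refine tendsto_order.2 ⟨fun a ha => .of_forall fun x => ha.trans_le (charFunDefect_nonneg _ _),
    fun η hη => ?_⟩
  have hexp := Real.exp_pos (-(r ^ 2 * τ / 2))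
  have hε : 0 < η * Real.exp (-(r ^ 2 * τ / 2)) / (r ^ 2 + 1) := by positivity
  filter_upwards [h.eventually_charFunDefect_map_normSum_conv_le hψ hmem r hε] with x hx
  have := h.isProbabilityMeasure_map_normSum x
  rw [charFunDefect_conv_gaussianReal (h.memLp_id_map_normSum x)] at hx
  refine lt_of_mul_lt_mul_right (hx.trans_lt ?_) hexp.le
  rw [← mul_div_assoc, div_lt_iff₀ (by positivity), mul_comm]
  gcongr
  exact lt_add_one _

end IsFKGField

end

/-! ### Decay of the standardised Fisher information -/

theorem stFisherInfo_gaussianReal_conv {τ : ℝ≥0} (hτ : 0 < τ) (w : ℝ≥0) :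
    stFisherInfo (gaussianReal 0 w ∗ gaussianReal 0 τ) = 0 := by
  have hwτ : 0 < w + τ := by positivity
  have hdirac : gaussianReal 0 w ∗ gaussianReal 0 τ
      = Measure.dirac 0 ∗ gaussianReal 0 (w + τ) := by
    rw [gaussianReal_conv_gaussianReal, Measure.dirac_zero_conv, add_zero]
  refine stFisherInfo_eq_zero_of_affine hτ (memLp_two_gaussianReal w)
    (a := -((w + τ : ℝ≥0) : ℝ)⁻¹) (b := 0) fun x => ?_
  have hpos := (noiseMoment_zero_pos (Measure.dirac 0) hwτ x).ne'
  have hmoment : noiseMoment (w + τ) 1 (Measure.dirac 0) x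
      = x * noiseMoment (w + τ) 0 (Measure.dirac 0) x := by
    simp [noiseMoment, smooth, momentKernel]
  rw [hdirac, score_conv _ hwτ, hmoment, mul_div_cancel_right₀ _ hpos]
  ring

theorem tendsto_gaussianReal_of_charFunDefect {μs : ℕ → ProbabilityMeasure ℝ} {w : ℝ≥0}
    (hvar : Tendsto (fun n => variance id (μs n : Measure ℝ)) atTop (𝓝 w))
    (hdefect : ∀ r, Tendsto (fun n => charFunDefect (μs n : Measure ℝ) r) atTop (𝓝 0)) :
    Tendsto μs atTop (𝓝 (⟨gaussianReal 0 w, inferInstance⟩ : ProbabilityMeasure ℝ)) := by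
  refine ProbabilityMeasure.tendsto_iff_tendsto_charFun.2 fun r => ?_
  have hgauss : charFun (gaussianReal 0 w) r = (Real.exp (-(r ^ 2 * w / 2)) : ℝ) := by
    rw [charFun_gaussianReal, Complex.ofReal_exp]
    congr 1
    push_cast
    ring
  have hexp : Tendsto
      (fun n => ((Real.exp (-(r ^ 2 * variance id (μs n : Measure ℝ) / 2)) : ℝ) : ℂ)) atTop
      (𝓝 ((Real.exp (-(r ^ 2 * w / 2)) : ℝ) : ℂ)) :=
    ((by fun_prop : Continuous fun v : ℝ => ((Real.exp (-(r ^ 2 * v / 2)) : ℝ) : ℂ)).tendsto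
      _).comp hvar
  have hsum := (tendsto_zero_iff_norm_tendsto_zero.2 (hdefect r)).add hexp
  simp only [sub_add_cancel, zero_add] at hsum
  exact hgauss ▸ hsum

theorem tendsto_stFisherInfo_of_charFunDefect {ι : Type*} {l : Filter ι} [l.IsCountablyGenerated]
    {τ : ℝ≥0} (hτ : 0 < τ) {V : ℝ} {μs : ι → ProbabilityMeasure ℝ}
    (hμ : ∀ i, MemLp id 2 (μs i : Measure ℝ)) (hV : ∀ i, variance id (μs i : Measure ℝ) ≤ V)
    (hdefect : ∀ r, Tendsto (fun i => charFunDefect (μs i : Measure ℝ) r) l (𝓝 0)) :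
    Tendsto (fun i => stFisherInfo ((μs i : Measure ℝ) ∗ gaussianReal 0 τ)) l (𝓝 0) := by
  refine tendsto_of_subseq_tendsto fun u hu => ?_
  obtain ⟨w, hw, φ, hφ, hlim⟩ := isCompact_Icc.tendsto_subseq
    (x := fun n => variance id (μs (u n) : Measure ℝ)) (s := Set.Icc 0 V)
    fun n => ⟨variance_nonneg _ _, hV (u n)⟩
  lift w to ℝ≥0 using hw.1
  refine ⟨φ, ?_⟩
  have hweak := tendsto_gaussianReal_of_charFunDefect (μs := fun n => μs (u (φ n))) hlim
    fun r => (hdefect r).comp (hu.comp hφ.tendsto_atTop)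
  have hstd : Tendsto (fun n => stFisherInfo ((μs (u (φ n)) : Measure ℝ) ∗ gaussianReal 0 τ)) atTop
      (𝓝 (stFisherInfo (gaussianReal 0 w ∗ gaussianReal 0 τ))) := by
    simp only [stFisherInfo, variance_conv_gaussianReal (hμ _),
      variance_conv_gaussianReal (memLp_two_gaussianReal w), variance_id_gaussianReal]
    exact ((hlim.add_const _).mul (tendsto_fisherInfo hτ hweak)).sub_const 1
  rwa [stFisherInfo_gaussianReal_conv hτ] at hstd

theorem tendsto_iSup_add_atTop {u : ℕ → ℝ} {a : ℝ} (hu : Tendsto u atTop (𝓝 a)) :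
    Tendsto (fun m => ⨆ k, u (m + k)) atTop (𝓝 a) := by
  have hbdd : ∀ m, BddAbove (Set.range fun k => u (m + k)) := fun m =>
    hu.bddAbove_range.mono (Set.range_comp_subset_range (m + ·) u)
  refine tendsto_order.2 ⟨fun b hb => ?_, fun b hb => ?_⟩
  · filter_upwards [(tendsto_order.1 hu).1 b hb] with m hm
    exact hm.trans_le (le_ciSup (hbdd m) 0)
  · obtain ⟨c, hac, hcb⟩ := exists_between hb
    filter_upwards [eventually_forall_ge_atTop.2 ((tendsto_order.1 hu).2 c hac)] with m hm
    exact (ciSup_le fun k => (hm _ (Nat.le_add_right m k)).le).trans_lt hcb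

section

variable {Ω : Type*} [MeasurableSpace Ω] {d : ℕ} {X Z : (Fin d → ℤ) → Ω → ℝ} {P : Measure Ω}

theorem exists_vol_eq_supFisher_eq (X Z : (Fin d → ℤ) → Ω → ℝ) (P : Measure Ω) (hd : 1 ≤ d)
    {m : ℕ} (hm : 1 ≤ m) :
    ∃ x, vol x = m ∧ supFisher X Z P m = stFisherInfo (P.map (boxSum X Z x)) := by
  have hfinite : {x : Fin d → ℕ | vol x = m}.Finite := by
    refine (Set.finite_Iic fun _ => m).subset fun x hx i => ?_
    exact Nat.le_of_dvd hm (hx ▸ Finset.dvd_prod_of_mem x (Finset.mem_univ i))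
  have hnonempty : {x : Fin d → ℕ | vol x = m}.Nonempty :=
    ⟨Pi.mulSingle ⟨0, hd⟩ m, Fintype.prod_pi_mulSingle' _ _⟩
  have himage : {j | ∃ x : Fin d → ℕ, vol x = m ∧ j = stFisherInfo (P.map (boxSum X Z x))}
      = (fun x => stFisherInfo (P.map (boxSum X Z x))) '' {x | vol x = m} := by
    ext j
    exact exists_congr fun x => and_congr_right' eq_comm
  obtain ⟨x, hx, hsup⟩ := (hnonempty.image _).csSup_mem (hfinite.image
    fun x => stFisherInfo (P.map (boxSum X Z x)))
  exact ⟨x, hx, by rw [supFisher, himage, ← hsup]⟩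

theorem tendsto_supFisher {a : ℝ} (hd : 1 ≤ d)
    (hlim : Tendsto (fun x => stFisherInfo (P.map (boxSum X Z x))) (comap vol atTop) (𝓝 a)) :
    Tendsto (supFisher X Z P) atTop (𝓝 a) := by
  choose! x hvol hsup using fun m (hm : 1 ≤ m) => exists_vol_eq_supFisher_eq X Z P hd hm
  have hx : Tendsto x atTop (comap vol atTop) := by
    refine tendsto_comap_iff.2 (tendsto_id.congr' ?_)
    filter_upwards [eventually_ge_atTop 1] with m hm using (hvol m hm).symm
  refine (hlim.comp hx).congr' ?_
  filter_upwards [eventually_ge_atTop 1] with m hm using (hsup m hm).symm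

namespace IsFKGField

variable [IsProbabilityMeasure P] {τ : ℝ≥0} {ψ : ℝ → ℝ}

theorem tendsto_stFisherInfo_map_normSum (h : IsFKGField X P) (hτ : 0 < τ)
    (hψ : Tendsto ψ atTop (𝓝 0))
    (hmem : ∀ x, 1 ≤ vol x → MemClass ψ (P.map (normSum X x) ∗ gaussianReal 0 τ)) :
    Tendsto (fun x => stFisherInfo (P.map (normSum X x) ∗ gaussianReal 0 τ)) (comap vol atTop)
      (𝓝 0) :=
  tendsto_stFisherInfo_of_charFunDefect hτ
    (μs := fun x => ⟨P.map (normSum X x), h.isProbabilityMeasure_map_normSum x⟩)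
    h.memLp_id_map_normSum h.variance_map_normSum_le (h.tendsto_charFunDefect_map_normSum hψ hmem)

theorem tendsto_supFisher (h : IsFKGField X P) (hd : 1 ≤ d) (hτ : 0 < τ)
    (hψ : Tendsto ψ atTop (𝓝 0))
    (hmap : ∀ x, 1 ≤ vol x → P.map (boxSum X Z x) = P.map (normSum X x) ∗ gaussianReal 0 τ)
    (hmem : ∀ x, 1 ≤ vol x → MemClass ψ (P.map (boxSum X Z x))) :
    Tendsto (supFisher X Z P) atTop (𝓝 0) := by
  refine FKG.tendsto_supFisher hd ((h.tendsto_stFisherInfo_map_normSum hτ hψ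
    fun x hx => hmap x hx ▸ hmem x hx).congr' ?_)
  filter_upwards [tendsto_comap.eventually (eventually_ge_atTop 1)] with x hx
  rw [hmap x hx]

theorem supFisher_nonneg (h : IsFKGField X P) (hd : 1 ≤ d) (hτ : 0 < τ)
    (hmap : ∀ x, 1 ≤ vol x → P.map (boxSum X Z x) = P.map (normSum X x) ∗ gaussianReal 0 τ)
    {m : ℕ} (hm : 1 ≤ m) : 0 ≤ supFisher X Z P m := by
  obtain ⟨x, rfl, hsup⟩ := exists_vol_eq_supFisher_eq X Z P hd hm
  have := h.isProbabilityMeasure_map_normSum x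
  rw [hsup, hmap x hm]
  exact stFisherInfo_nonneg hτ (h.memLp_id_map_normSum x)

theorem genInv_supFisher_mul_le (h : IsFKGField X P) (hd : 1 ≤ d) (hτ : 0 < τ)
    (hmap : ∀ x, 1 ≤ vol x → P.map (boxSum X Z x) = P.map (normSum X x) ∗ gaussianReal 0 τ)
    (hmem : ∀ x, 1 ≤ vol x → MemClass ψ (P.map (boxSum X Z x))) {K : ℝ}
    (hK : ∑' u, covFun X P u ≤ K) {ν : ℝ → ℝ} (hν : IsModulus ψ τ K ν) {m : ℕ} (hm : 1 ≤ m)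
    (n : ℕ) :
    genInv ν (supFisher X Z P m * (m * n) / ((m : ℝ) + n) ^ 2) ≤ supFisher X Z P m / τ := by
  obtain ⟨x, rfl, hsup⟩ := exists_vol_eq_supFisher_eq X Z P hd hm
  have := h.isProbabilityMeasure_map_normSum x
  have hβ : (vol x : ℝ) / (vol x + n) ∈ Set.Icc 0 1 :=
    ⟨by positivity, div_le_one_of_le₀ (by linarith [n.cast_nonneg (α := ℝ)]) (by positivity)⟩
  have hle := hν.genInv_mul_stFisherInfo_le hτ (h.memLp_id_map_normSum x)
    (h.integral_map_normSum x) ((h.variance_map_normSum_le x).trans hK)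
    (hmap x hm ▸ hmem x hm) hβ
  rw [← hmap x hm, ← hsup] at hle
  convert hle using 2
  field_simp
  ring

end IsFKGField

end

end FKG

end

theorem corollary2p4_general {Ω : Type*} [MeasurableSpace Ω] (P : Measure Ω)
    [IsProbabilityMeasure P] {d : ℕ} (hd : 1 ≤ d) (X Z : (Fin d → ℤ) → Ω → ℝ) (τ : ℝ≥0)
    (hτ : 0 < τ) (h : FKG.IsFKGField X P) (hZmeas : ∀ u, Measurable (Z u))
    (hZlaw : ∀ u, P.map (Z u) = gaussianReal 0 τ) (hZindep : iIndepFun Z P)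
    (hXZ : IndepFun (fun ω u => X u ω) (fun ω u => Z u ω) P)
    (ψ : ℝ → ℝ) (hψ : Tendsto ψ atTop (𝓝 0))
    (hUI : ∀ x : Fin d → ℕ, (∀ i, 1 ≤ x i) → FKG.MemClass ψ (P.map (FKG.boxSum X Z x)))
    (K : ℝ) (hK : ∑' u, covariance (X 0) (X u) P ≤ K) :
    (∃ ν : ℝ → ℝ, FKG.IsModulus ψ τ K ν) ∧
    ∀ ν : ℝ → ℝ, FKG.IsModulus ψ τ K ν →
      ∃ δ : ℕ → ℝ, Tendsto δ atTop (𝓝 0) ∧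
        ∀ m n : ℕ, 1 ≤ m → 1 ≤ n →
          FKG.supFisher X Z P (n + m) ≤
            (m : ℝ) / (m + n) * FKG.supFisher X Z P m
              + (n : ℝ) / (m + n) * FKG.supFisher X Z P n + δ m
              - FKG.genInv ν (FKG.supFisher X Z P m * (m * n) / ((m : ℝ) + n) ^ 2) := by
  have hmap : ∀ x, 1 ≤ FKG.vol x → P.map (FKG.boxSum X Z x) = P.map (FKG.normSum X x) ∗ _ :=
    fun x hx => FKG.map_boxSum h.measurable hZmeas hZlaw hZindep hXZ hx
  have hmem : ∀ x, 1 ≤ FKG.vol x → FKG.MemClass ψ (P.map (FKG.boxSum X Z x)) :=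
    fun x hx => hUI x (FKG.one_le_of_one_le_vol hx)
  have hlim := h.tendsto_supFisher hd hτ hψ hmap hmem
  refine ⟨⟨_, FKG.isModulus_leastModulus hτ hψ K⟩, fun ν hν =>
    ⟨fun m => (⨆ k, FKG.supFisher X Z P (m + k)) + FKG.supFisher X Z P m / τ, ?_,
      fun m n hm hn => ?_⟩⟩
  · simpa using (FKG.tendsto_iSup_add_atTop hlim).add (hlim.div_const (τ : ℝ))
  · have hsup : FKG.supFisher X Z P (n + m) ≤ ⨆ k, FKG.supFisher X Z P (m + k) :=
      add_comm n m ▸ le_ciSup (hlim.bddAbove_range.mono (Set.range_comp_subset_range (m + ·) _)) n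
    have hgenInv := h.genInv_supFisher_mul_le hd hτ hmap hmem hK hν hm n
    have hJm : 0 ≤ (m : ℝ) / (m + n) * FKG.supFisher X Z P m :=
      mul_nonneg (by positivity) (h.supFisher_nonneg hd hτ hmap hm)
    have hJn : 0 ≤ (n : ℝ) / (m + n) * FKG.supFisher X Z P n :=
      mul_nonneg (by positivity) (h.supFisher_nonneg hd hτ hmap hn)
    linarith

theorem corollary2p4 {Ω : Type*} [MeasurableSpace Ω] (P : Measure Ω) [IsProbabilityMeasure P]
    {d : ℕ} (hd : 1 ≤ d) (X Z : (Fin d → ℤ) → Ω → ℝ) (τ : ℝ≥0) (hτ : 0 < τ)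
    -- the stationary FKG system, with mean zero, finite variance and finite susceptibility
    (hXmeas : ∀ u, Measurable (X u))
    (hXstat : FKG.IsStationary X P)
    (hXvar : ∀ u, MemLp (X u) 2 P)
    (hXmean : ∀ u, ∫ ω, X u ω ∂P = 0)
    (hXfkg : FKG.IsFKG X P)
    (hXsus : Summable fun u => covariance (X 0) (X u) P)
    -- the normal perturbations, independent of the system and of each other
    (hZmeas : ∀ u, Measurable (Z u))
    (hZlaw : ∀ u, P.map (Z u) = gaussianReal 0 τ)
    (hZindep : iIndepFun Z P)
    (hXZ : IndepFun (fun ω u => X u ω) (fun ω u => Z u ω) P)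
    -- uniform integrability
    (ψ : ℝ → ℝ) (hψ : Tendsto ψ atTop (𝓝 0))
    (hUI : ∀ x : Fin d → ℕ, (∀ i, 1 ≤ x i) → FKG.MemClass ψ (P.map (FKG.boxSum X Z x)))
    -- a bound for the variances of the unperturbed normalized sums
    (K : ℝ) (hK : ∑' u, covariance (X 0) (X u) P ≤ K) :
    (∃ ν : ℝ → ℝ, FKG.IsModulus ψ τ K ν) ∧
    ∀ ν : ℝ → ℝ, FKG.IsModulus ψ τ K ν →
      ∃ δ : ℕ → ℝ, Tendsto δ atTop (𝓝 0) ∧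
        ∀ m n : ℕ, 1 ≤ n → n ≤ m →
          FKG.supFisher X Z P (n + m) ≤
            (m : ℝ) / (m + n) * FKG.supFisher X Z P m
              + (n : ℝ) / (m + n) * FKG.supFisher X Z P n + δ m
              - FKG.genInv ν (FKG.supFisher X Z P m * (m * n) / ((m : ℝ) + n) ^ 2) := by
  obtain ⟨hadm, hbound⟩ := corollary2p4_general P hd X Z τ hτ
    ⟨hXmeas, hXstat, hXvar, hXmean, hXfkg, hXsus⟩ hZmeas hZlaw hZindep hXZ ψ hψ hUI K hK
  exact ⟨hadm, fun ν hν => (hbound ν hν).imp fun _ hδ =>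
    ⟨hδ.1, fun m n hn hnm => hδ.2 m n (hn.trans hnm) hn⟩⟩
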